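/- **Theorem** (provable in $\mathrm{RCA}_0$; that is, true in every model $(\mathbb N,\mathcal S)$ of $\mathrm{RCA}_0$, where $\mathbb N$ is the possibly nonstandard first-order part, all numbers $i,d,k,\ell,\dots$ range over $\mathbb N$, and all sets, functions, graphs, colorings, isomorphisms and strategies belong to the model). Let $\mathcal K$ be a natural class of graphs. 1. For every $k\in\mathbb N$: if $\mathcal K$ is not locally on-line $k$-colorable but every graph in $\mathcal K$ is $k$-colorable, then there is a $d\ge 1$ such that $\mathrm{DNR}_d(k,f)$ holds for all $f\colon\mathbb N\to\mathbb N$. 2. If $\mathcal K$ is not locally on-line $k$-colorable for any $k\in\mathbb N$ but every graph in $\mathcal K$ is $k$-colorable for some $k \in \mathbb N$, then for every $f\colon\mathbb N\to\mathbb N$ there are $d\ge 1$ and $k$ such that $\mathrm{DNR}_d(k,f)$ holds. *Definitions.* *Graphs.* A graph $G=(V,E)$ consists of a set $V\subseteq\mathbb N$ and an irreflexive symmetric relation $E\subseteq V\times V$. It is $k$-colorable if there is a function $\chi\colon V\to\{0,\dots,k-1\}$ with $\chi(u)\ne\chi(v)$ whenever $(u,v)\in E$. A class $\mathcal K$ of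 graphs is *natural* if there is a set $K$ of (codes of) finite graphs such that a graph belongs to $\mathcal K$ if and only if each of its finite induced subgraphs is isomorphic to a graph in $K$, and if moreover $\mathcal K$ is closed under disjoint sums: if $(V_0,E_0),(V_1,E_1)\in\mathcal K$ and $V_0\cap V_1=\emptyset$, then $(V_0\cup V_1,E_0\cup E_1)\in\mathcal K$. *The game.* The on-line coloring game $\Gamma_d(\mathcal K,k)$ lasts for $d$ rounds. In each round Player $\forall$ adds a new vertex and connects it to some of the existing vertices so that the graph remains in $\mathcal K$, and then Player $\exists$ colors the new vertex. Player $\exists$ loses exactly if $\forall$ has played $d$ legal rounds and she has not produced a proper coloring of the resulting graph with colors from $\{0,\dots,k-1\}$. The class $\mathcal K$ is *locally on-line $k$-colorable* if for every $d\in\mathbb N$ Player $\exists$ has a winning strategy in $\Gamma_d(\mathcal K,k)$. *Diagonal non-recursiveness.* $\Phi_e^f$ is the partial function computed by the $e$-th Turing machine with oracle $f$; $p_0,\dots,p_{d-1}\colon\mathbb N\to\mathbb N$ are the projections of a fixed primitive recursive $d$-tupling function. Let $\Delta^f_{i,d}(x)=\Phi^f_{p_i(x)}(p_i(x))$ if $\Phi^f_{p_j(x)}(p_j(x))$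 converges for all $j\le i$, and let $\Delta^f_{i,d}(x)$ be undefined otherwise. Let $D^f_{0,d}=\mathbb N$ and $D^f_{i+1,d}=\mathrm{dom}(\Delta^f_{i,d})$. For $d\ge1$, $\mathrm{DNR}_d(k,f)$ is the statement that there is a sequence $(g_i)_{i<d}$ of functions $g_i\colon D^f_{i,d}\to\{0,\dots,k-1\}$ such that for every $x$ there is an $i<d$ with $g_i(x)\neq\Delta^f_{i,d}(x)$. Here the $g_i$ are partial functions on $\mathbb N$, given uniformly in $i$ as partial recursive functions relative to an element of the model, i.e. the relation $g_i(x)=y$ in $(i,x,y)$ is $\Sigma^0_1$ with parameters in the model. -/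

import Mathlib

/-!
Reverse mathematics over `RCA₀`.

A structure for second-order arithmetic has a first-order part `N`, which is an ordered
commutative semiring, and a second-order part `S`, which is a collection of subsets of `N`.
Both parts may be nonstandard. A statement is a theorem of `RCA₀` if and only if it holds in
every model `(N, S)` of `RCA₀`.
-/

namespace RevMath

/-! ### Formulas with bounded quantifiers, and the axioms of `RCA₀` -/

/-- Terms of arithmetic in `n` number variables. -/
inductive Tm (n : ℕ) : Type
  | var (i : Fin n) : Tm n
  | zero : Tm n
  | one : Tm n
  | add (t u : Tm n) : Tm n
  | mul (t u : Tm n) : Tm n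

/-- Bounded (`Σ⁰₀`) formulas of second-order arithmetic with `m` set variables and `n` free
number variables; in `ball t φ` and `bex t φ` the quantified variable is variable `0` of `φ`. -/
inductive BForm (m : ℕ) : ℕ → Type
  | eq {n : ℕ} (t u : Tm n) : BForm m n
  | lt {n : ℕ} (t u : Tm n) : BForm m n
  | mem {n : ℕ} (t : Tm n) (X : Fin m) : BForm m n
  | neg {n : ℕ} (φ : BForm m n) : BForm m n
  | and {n : ℕ} (φ ψ : BForm m n) : BForm m n
  | or {n : ℕ} (φ ψ : BForm m n) : BForm m n
  | ball {n : ℕ} (t : Tm n) (φ : BForm m (n + 1)) : BForm m n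
  | bex {n : ℕ} (t : Tm n) (φ : BForm m (n + 1)) : BForm m n

section Axioms

variable {N : Type*} [CommSemiring N] [LinearOrder N]

/-- The value of a term. -/
def Tm.eval {n : ℕ} (v : Fin n → N) : Tm n → N
  | .var i => v i
  | .zero => 0
  | .one => 1
  | .add t u => t.eval v + u.eval v
  | .mul t u => t.eval v * u.eval v

/-- Truth of a bounded formula, with `X` interpreting the set variables. -/
def BForm.Holds {m : ℕ} (X : Fin m → Set N) : {n : ℕ} → BForm m n → (Fin n → N) → Prop
  | _, .eq t u, v => t.eval v = u.eval v
  | _, .lt t u, v => t.eval v < u.eval v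
  | _, .mem t i, v => t.eval v ∈ X i
  | _, .neg φ, v => ¬ φ.Holds X v
  | _, .and φ ψ, v => φ.Holds X v ∧ ψ.Holds X v
  | _, .or φ ψ, v => φ.Holds X v ∨ ψ.Holds X v
  | _, .ball t φ, v => ∀ x : N, x < t.eval v → φ.Holds X (Fin.cons x v)
  | _, .bex t φ, v => ∃ x : N, x < t.eval v ∧ φ.Holds X (Fin.cons x v)

/-- The second-order axioms of `RCA₀`, and discreteness of the order. Together with the class
assumptions `[CommSemiring N] [LinearOrder N] [IsStrictOrderedRing N] [CanonicallyOrderedAdd N]`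
this says that `(N, S)` is a model of `RCA₀`: discretely ordered nonnegative semiring axioms
(`PA⁻`), induction for `Σ⁰₁` formulas and comprehension for `Δ⁰₁` formulas, both with number
parameters `v` and set parameters `X`. -/
structure ModelsRCA₀ (S : Set (Set N)) : Prop where
  discrete : ∀ x : N, 0 < x → 1 ≤ x
  induction : ∀ (m n : ℕ) (X : Fin m → Set N), (∀ i, X i ∈ S) → ∀ (v : Fin n → N)
    (φ : BForm m (n + 2)),
    (∃ y : N, φ.Holds X (Fin.cons y (Fin.cons 0 v))) →
    (∀ x : N, (∃ y : N, φ.Holds X (Fin.cons y (Fin.cons x v))) →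
      ∃ y : N, φ.Holds X (Fin.cons y (Fin.cons (x + 1) v))) →
    ∀ x : N, ∃ y : N, φ.Holds X (Fin.cons y (Fin.cons x v))
  comprehension : ∀ (m n : ℕ) (X : Fin m → Set N), (∀ i, X i ∈ S) → ∀ (v : Fin n → N)
    (φ ψ : BForm m (n + 2)),
    (∀ x : N, (∃ y : N, φ.Holds X (Fin.cons y (Fin.cons x v))) ↔
      ∀ y : N, ψ.Holds X (Fin.cons y (Fin.cons x v))) →
    {x : N | ∃ y : N, φ.Holds X (Fin.cons y (Fin.cons x v))} ∈ S

end Axioms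

/-! ### Coding -/

section Coding

variable {N : Type*} [CommSemiring N] [LinearOrder N]

/-- The pairing function. -/
def pair (i j : N) : N := (i + j) ^ 2 + i

/-- `i` is an element of the finite set coded by `c`. The code is a triple `⟨k, m, n⟩`, and the
elements of the coded set are the `i < k` such that `m (i + 1) + 1` divides `n`. -/
def Elem (i c : N) : Prop :=
  ∃ k m n : N, c = pair k (pair m n) ∧ i < k ∧ (m * (i + 1) + 1) ∣ n

open Classical in
/-- The projections of the tupling functions, by Gödel's `β`-function: if `x = ⟨m, n⟩`, then
`proj i x` is the remainder of `n` modulo `m (i + 1) + 1`. Every sequence of length `d` in the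
model is of the form `proj 0 x, …, proj (d - 1) x`. -/
noncomputable def proj (i x : N) : N :=
  if h : ∃ r m n q : N, x = pair m n ∧ n = q * (m * (i + 1) + 1) + r ∧ r < m * (i + 1) + 1
  then h.choose else 0

/-- The function `χ` with domain `V` belongs to the model `(N, S)`: its graph is a set of the
model. -/
def IsFunOn (S : Set (Set N)) (V : Set N) (χ : N → N) : Prop :=
  {p : N | ∃ v ∈ V, p = pair v (χ v)} ∈ S

/-- The function `f : N → N` belongs to the model `(N, S)`. -/
def IsFun (S : Set (Set N)) (f : N → N) : Prop := IsFunOn S Set.univ f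

end Coding

/-! ### Oracle Turing machines -/

section Machines

variable {N : Type*} [CommSemiring N] [LinearOrder N]

/-- A configuration of a machine with one head, which scans the same cell of a one-way infinite
work tape and of the read-only oracle tape. The blank symbol is `0`. -/
@[ext]
structure Config (N : Type*) where
  state : N
  head : N
  tape : N → N

/-- The number `c` codes the configuration `C`; the tape is coded by the finite set of the pairs
`⟨j, a⟩` such that cell `j` holds the symbol `a ≠ 0`. -/
def CodesConfig (c : N) (C : Config N) : Prop :=
  ∃ T : N, c = pair C.state (pair C.head T) ∧
    ∀ j a : N, Elem (pair j a) T ↔ (C.tape j = a ∧ a ≠ 0)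

/-- Initial configuration on input `x`: state `0`, head on cell `0`, `x` ones on the tape. -/
def initConfig (x : N) : Config N where
  state := 0
  head := 0
  tape := fun j => if j < x then 1 else 0

open Classical in
/-- The oracle tape: the characteristic function of the graph of `f`. -/
noncomputable def oracleBit (f : N → N) (n : N) : N :=
  if ∃ a : N, n = pair a (f a) then 1 else 0

/-- `e` codes the instruction table of a (deterministic) machine, a finite function from triples
`⟨state, work symbol, oracle symbol⟩` to triples `⟨new state, new work symbol, move⟩`. -/
def IsMachine (e : N) : Prop :=
  ∀ u v v' : N, Elem (pair u v) e → Elem (pair u v') e → v = v'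

/-- One step of the machine `e` with oracle `f`. Move `0` is to the left (the head stays put if
it is on cell `0`), every other move is to the right. -/
def Step (e : N) (f : N → N) (C C' : Config N) : Prop :=
  ∃ m : N,
    Elem (pair (pair C.state (pair (C.tape C.head) (oracleBit f C.head)))
      (pair C'.state (pair (C'.tape C.head) m))) e ∧
    (∀ j : N, j ≠ C.head → C'.tape j = C.tape j) ∧
    ((m = 0 ∧ (C'.head + 1 = C.head ∨ (C.head = 0 ∧ C'.head = 0))) ∨
      (m ≠ 0 ∧ C'.head = C.head + 1))

/-- `Phi e f x y` is `Φ_e^f(x) = y`: there is a sequence `C 0, …, C s` of configurations of the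
machine `e`, coded by a number `w` of the model, that starts with the initial configuration for
input `x`, follows the rules of the machine with oracle `f`, and ends when no instruction
applies, with a block of exactly `y` ones at the left end of the tape. -/
def Phi (e : N) (f : N → N) (x y : N) : Prop :=
  IsMachine e ∧ ∃ (s w : N) (C : N → Config N),
    (∀ t ≤ s, (∃ c : N, Elem (pair t c) w) ∧ ∀ c : N, Elem (pair t c) w → CodesConfig c (C t)) ∧
    C 0 = initConfig x ∧
    (∀ t < s, Step e f (C t) (C (t + 1))) ∧
    (¬ ∃ C' : Config N, Step e f (C s) C') ∧
    (∀ j < y, (C s).tape j = 1) ∧ (C s).tape y ≠ 1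

end Machines

/-! ### Depth `d` diagonally non-recursive sequences -/

section DNR

variable {N : Type*} [CommSemiring N] [LinearOrder N]

/-- The domain `D_i^f`: all `x` such that `Φ_{p_j(x)}^f(p_j(x))` converges for every `j < i`. -/
def DiagDom (f : N → N) (i : N) : Set N :=
  {x | ∀ j < i, ∃ u : N, Phi (proj j x) f (proj j x) u}

/-- `Diag f i x y` is `Δ_i^f(x) = y`: the value is `Φ_{p_i(x)}^f(p_i(x))` if
`Φ_{p_j(x)}^f(p_j(x))` converges for every `j ≤ i`, and undefined otherwise. -/
def Diag (f : N → N) (i x y : N) : Prop :=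
  x ∈ DiagDom f i ∧ Phi (proj i x) f (proj i x) y

/-- The sequence of partial functions enumerated by the set `H`: `g_i(x) = y` if and only if
`⟨⟨i, x⟩, ⟨y, s⟩⟩ ∈ H` for some `s`. Since the domains `D_i^f` are in general only recursively
enumerable in `f` and need not be sets of the model, a sequence of partial functions of the
model is one whose graph is `Σ⁰₁`, that is, one of this form with `H ∈ S`. -/
def PartialSeq (H : Set N) (i x y : N) : Prop :=
  ∃ s : N, pair (pair i x) (pair y s) ∈ H

/-- `g = (g_i : i < d)` is a `k`-bounded depth `d` diagonally non-recursive sequence relative to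
`f`, where `g i x y` means `g_i(x) = y`. -/
structure IsDNR (d k : N) (f : N → N) (g : N → N → N → Prop) : Prop where
  functional : ∀ i < d, ∀ x y y' : N, g i x y → g i x y' → y = y'
  domain : ∀ i < d, ∀ x : N, (∃ y, g i x y) ↔ x ∈ DiagDom f i
  bounded : ∀ i < d, ∀ x y : N, g i x y → y < k
  diagonal : ∀ x : N, ∃ i < d, ∃ y : N, g i x y ∧ ¬ Diag f i x y

/-- The statement `DNR_d(k, f)` in the model `(N, S)`. -/
def DNR (S : Set (Set N)) (d k : N) (f : N → N) : Prop :=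
  ∃ H ∈ S, IsDNR d k f (PartialSeq H)

end DNR

/-! ### Graphs, natural classes, and the on-line coloring game -/

/-- A set of vertices and an adjacency relation. -/
@[ext]
structure RawGraph (N : Type*) where
  verts : Set N
  Adj : N → N → Prop

section Graphs

variable {N : Type*} [CommSemiring N] [LinearOrder N]

/-- `G` is a graph of the model `(N, S)`. -/
structure IsGraph (S : Set (Set N)) (G : RawGraph N) : Prop where
  verts_mem : G.verts ∈ S
  edges_mem : {p : N | ∃ u v : N, p = pair u v ∧ G.Adj u v} ∈ S
  adj_verts : ∀ u v : N, G.Adj u v → u ∈ G.verts ∧ v ∈ G.verts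
  symm : ∀ u v : N, G.Adj u v → G.Adj v u
  irrefl : ∀ u : N, ¬ G.Adj u u

/-- The induced subgraph on the vertices in `W`. -/
def RawGraph.induce (G : RawGraph N) (W : Set N) : RawGraph N where
  verts := G.verts ∩ W
  Adj := fun u v => G.Adj u v ∧ u ∈ W ∧ v ∈ W

/-- The sum of two graphs. -/
def RawGraph.sum (G₀ G₁ : RawGraph N) : RawGraph N where
  verts := G₀.verts ∪ G₁.verts
  Adj := fun u v => G₀.Adj u v ∨ G₁.Adj u v

/-- The finite graph coded by `c = ⟨a, b⟩`, where `a` codes the set of the vertices and `b` codes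
the set of the pairs of adjacent vertices. -/
def decodeGraph (c : N) : RawGraph N where
  verts := {u | ∃ a b : N, c = pair a b ∧ Elem u a}
  Adj := fun u v => ∃ a b : N, c = pair a b ∧ Elem (pair u v) b

/-- `χ` is a proper coloring of `G` with colors smaller than `k`. -/
def IsColoring (k : N) (G : RawGraph N) (χ : N → N) : Prop :=
  (∀ v ∈ G.verts, χ v < k) ∧ ∀ u v : N, G.Adj u v → χ u ≠ χ v

/-- `G` is (globally) `k`-colorable in the model `(N, S)`. -/
def Colorable (S : Set (Set N)) (k : N) (G : RawGraph N) : Prop :=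
  ∃ χ : N → N, IsFunOn S G.verts χ ∧ IsColoring k G χ

/-- `G` and `G'` are isomorphic in the model `(N, S)`. -/
def Isomorphic (S : Set (Set N)) (G G' : RawGraph N) : Prop :=
  ∃ φ : N → N, IsFunOn S G.verts φ ∧ Set.BijOn φ G.verts G'.verts ∧
    ∀ u ∈ G.verts, ∀ v ∈ G.verts, G.Adj u v ↔ G'.Adj (φ u) (φ v)

/-- `G` belongs to the universal class of graphs determined by the set `K` of codes of finite
graphs: every finite (that is, bounded) induced subgraph of the graph `G` is isomorphic to a graph
in `K`. -/
def InClass (S : Set (Set N)) (K : Set N) (G : RawGraph N) : Prop :=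
  IsGraph S G ∧ ∀ W ∈ S, W ⊆ G.verts → (∃ b : N, ∀ x ∈ W, x < b) →
    ∃ c ∈ K, Isomorphic S (G.induce W) (decodeGraph c)

/-- `K` is a set of codes of finite graphs in the model `(N, S)`, and the universal class of
graphs that it determines is closed under disjoint sums: it is a natural class. -/
structure IsNatural (S : Set (Set N)) (K : Set N) : Prop where
  mem : K ∈ S
  graphs : ∀ c ∈ K, IsGraph S (decodeGraph c)
  sum : ∀ G₀ G₁ : RawGraph N, InClass S K G₀ → InClass S K G₁ → Disjoint G₀.verts G₁.verts →
    InClass S K (G₀.sum G₁)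

/-- The graph `G` on the vertices `0, …, d - 1` arises from legal moves of Player `∀` in `d` rounds
of the on-line coloring game, where in round `i` he adds the vertex `i` and connects it to some
of the vertices `0, …, i - 1` so that the graph remains in the class. -/
def IsPlay (S : Set (Set N)) (K : Set N) (d : N) (G : RawGraph N) : Prop :=
  IsGraph S G ∧ G.verts = {i | i < d} ∧ ∀ i < d, InClass S K (G.induce {j | j ≤ i})

/-- Player `∃` has a winning strategy in the `d`-round on-line `k`-coloring game for the class
determined by `K`. A strategy `σ` belongs to the model as a function on codes of finite graphs;
in round `i` it colors the vertex `i` with a color that depends on the previous moves of Player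
`∀`, which are recorded in the graph on the vertices `0, …, i`. (The previous moves of Player `∃`
are determined by these and by `σ`.) -/
def ExistsWins (S : Set (Set N)) (K : Set N) (d k : N) : Prop :=
  ∃ σ : RawGraph N → N, IsFun S (fun c => σ (decodeGraph c)) ∧
    ∀ G : RawGraph N, IsPlay S K d G → IsColoring k G (fun i => σ (G.induce {j | j ≤ i}))

/-- The class determined by `K` is locally on-line `k`-colorable. -/
def LocallyOnlineColorable (S : Set (Set N)) (K : Set N) (k : N) : Prop :=
  ∀ d : N, ExistsWins S K d k

end Graphs

end RevMath

/-!
Player `∀` has a winning strategy in one of the games, because the game is determined. For every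
`x`, let him play this strategy against the colors `Δ₀(x), Δ₁(x), …`, where the vertex of round `i`
appears as soon as `Δ₀(x), …, Δᵢ₋₁(x)` have been computed. The disjoint sum of these graphs over all
`x` is recursive and belongs to the class. In a proper coloring `χ` of it, let `gᵢ(x)` be the color of
the vertex of round `i` in the component of `x`. If `gᵢ(x) = Δᵢ(x)` for all `i < d`, then `χ` answers
the strategy of Player `∀` for `d` rounds by a proper coloring, although the strategy wins. So `g` is
diagonally non-recursive (`exists_diagonal_graph`). If no number of colors suffices, then the sum is
also taken over `t`, with strategies for `t + 1` colors that are found by an unbounded search. The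
search is possible since `IsStrategy` is a `Σ⁰₁` predicate (`Sig.isStrategy`, `Sig.choice`).

All of this takes place in a model of `RCA₀` that may be nonstandard, so every induction, search and
recursion has to be definable. Definability is handled semantically, without formulas: `Rec S f` says
that the graph of `f` belongs to the model, where a predicate is a function with values in `Prop`, and
`Sig S P` says that `P` is the projection of a recursive predicate. The closure properties of `Rec` and
`Sig` are tagged for `fun_prop`, which then proves that a predicate or function is recursive from its
definition. Finite sets are coded by the divisors of Gödel's `β`-function (`exists_isCodeBound`), which
gives primitive recursion (`Rec.prec`) and bounded `Σ⁰₁` comprehension (`Sig.bounded`).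

Two points need care. Membership of a finite graph in the class is only `Σ⁰₁` (`Sig.inClass`), because
the graphs in `K` are given up to isomorphism. Determinacy (`existsWins_of_forall_not_isStrategy`)
therefore starts from a recursive set of legal positions below a bound, and takes the greatest set of
positions in which each is justified by others (`exists_winning_set`). That the sum over infinitely
many components belongs to the class is proved by induction on the number of components that meet a
finite set of vertices. This is a `Σ⁰₁` induction, again by `Sig.inClass`.
-/

set_option linter.unusedSectionVars false

namespace RevMath

/-! ### Arithmetic in a discretely ordered semiring -/

/-- The order is discrete: `1` is the least positive element. -/
class Discrete (N : Type*) [CommSemiring N] [LinearOrder N] : Prop where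
  one_le : ∀ x : N, 0 < x → 1 ≤ x

section Arithmetic

variable {N : Type*} [CommSemiring N] [LinearOrder N] [IsStrictOrderedRing N]
  [CanonicallyOrderedAdd N] [Discrete N]

theorem add_one_le_iff_lt {x y : N} : x + 1 ≤ y ↔ x < y := by
  constructor
  · exact fun h => lt_of_lt_of_le (lt_add_one x) h
  · intro h
    obtain ⟨z, rfl⟩ := le_iff_exists_add.1 h.le
    have : 0 < z := by
      by_contra h0
      have : z = 0 := by simpa using h0
      simp [this] at h
    gcongr
    exact Discrete.one_le z this

noncomputable instance : SuccOrder N :=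
  SuccOrder.ofSuccLeIff (fun x => x + 1) add_one_le_iff_lt

noncomputable instance : SuccAddOrder N := ⟨fun _ => rfl⟩

theorem lt_add_one_iff' {x y : N} : x < y + 1 ↔ x ≤ y := Order.lt_add_one_iff

theorem le_self_mul {x y : N} (hy : 0 < y) : x ≤ x * y :=
  le_mul_of_one_le_right (zero_le) (Discrete.one_le y hy)

theorem le_mul_self' (x : N) : x ≤ x * x := by
  rcases eq_or_ne x 0 with rfl | h
  · simp
  · exact le_self_mul (pos_of_ne_zero h)

theorem left_le_pair (i j : N) : i ≤ pair i j := le_add_self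

theorem right_le_pair (i j : N) : j ≤ pair i j := by
  calc j ≤ i + j := le_add_self
    _ ≤ (i + j) ^ 2 := by rw [sq]; exact le_mul_self' _
    _ ≤ _ := le_self_add

theorem pair_lt_pair_of_add_lt {i j i' j' : N} (h : i + j < i' + j') : pair i j < pair i' j' := by
  have h1 : i + j + 1 ≤ i' + j' := add_one_le_iff_lt.2 h
  calc pair i j = (i + j) ^ 2 + i := rfl
    _ ≤ (i + j) ^ 2 + (i + j) := by gcongr; exact le_self_add
    _ < (i + j) ^ 2 + (i + j) + ((i + j) + 1) := by
        apply lt_add_of_pos_right; exact lt_of_lt_of_le one_pos le_add_self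
    _ = (i + j + 1) ^ 2 := by ring
    _ ≤ (i' + j') ^ 2 := by gcongr
    _ ≤ _ := le_self_add

theorem pair_inj {i j i' j' : N} : pair i j = pair i' j' ↔ i = i' ∧ j = j' := by
  refine ⟨fun h => ?_, by rintro ⟨rfl, rfl⟩; rfl⟩
  have h1 : i + j = i' + j' := by
    rcases lt_trichotomy (i + j) (i' + j') with h1 | h1 | h1
    · exact absurd h (pair_lt_pair_of_add_lt h1).ne
    · exact h1
    · exact absurd h (pair_lt_pair_of_add_lt h1).ne'
  have h2 : i = i' := by
    unfold pair at h
    rw [h1] at h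
    exact add_left_cancel h
  subst h2
  exact ⟨rfl, add_left_cancel h1⟩

theorem pair_le_pair {i j i' j' : N} (h : i ≤ i') (h' : j ≤ j') : pair i j ≤ pair i' j' := by
  unfold pair; gcongr

end Arithmetic

/-! ### Comprehension -/

/-- A collection of sets that forms a model of `RCA₀`. -/
class Model {N : Type*} [CommSemiring N] [LinearOrder N] (S : Set (Set N)) : Prop where
  models : ModelsRCA₀ S

section Comprehension

variable {N : Type*} [CommSemiring N] [LinearOrder N] [IsStrictOrderedRing N]
  [CanonicallyOrderedAdd N]

/-- The term for the pairing function. -/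
def Tm.pr {n : ℕ} (t u : Tm n) : Tm n := .add (.mul (.add t u) (.add t u)) t

theorem Tm.eval_pr {n : ℕ} (v : Fin n → N) (t u : Tm n) :
    (Tm.pr t u).eval v = pair (t.eval v) (u.eval v) := by
  simp [Tm.pr, Tm.eval, pair, sq]

/-- The variable with index `0`. In the matrix of a comprehension formula, outside of bounded
quantifiers, this is the variable of the unbounded quantifier, and the element of the set is the
variable with index `1`. -/
abbrev x0 {n : ℕ} : Tm (n + 1) := .var 0
/-- The variable with index `1`. -/
abbrev x1 {n : ℕ} : Tm (n + 2) := .var (Fin.succ 0)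
/-- The variable with index `2`. -/
abbrev x2 {n : ℕ} : Tm (n + 3) := .var (Fin.succ (Fin.succ 0))
/-- The variable with index `3`. -/
abbrev x3 {n : ℕ} : Tm (n + 4) := .var (Fin.succ (Fin.succ (Fin.succ 0)))
/-- The variable with index `4`. -/
abbrev x4 {n : ℕ} : Tm (n + 5) :=
  .var (Fin.succ (Fin.succ (Fin.succ (Fin.succ 0))))

theorem comp_delta1 {S : Set (Set N)} [hS : Model S] {P : N → Prop} {m : ℕ} (X : Fin m → Set N)
    (hX : ∀ i, X i ∈ S) (φ ψ : BForm m 2)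
    (h1 : ∀ x, P x ↔ ∃ y, φ.Holds X (Fin.cons y (Fin.cons x Fin.elim0)))
    (h2 : ∀ x, P x ↔ ∀ y, ψ.Holds X (Fin.cons y (Fin.cons x Fin.elim0))) :
    {x | P x} ∈ S := by
  have := hS.models.comprehension m 0 X hX Fin.elim0 φ ψ (fun x => (h1 x).symm.trans (h2 x))
  convert this using 3 with x
  exact h1 x

/-- Comprehension for bounded formulas. The variable of the unbounded quantifier is a dummy, so that
in the formula the element of the set is the variable with index `1`. -/
theorem comp_delta0 {S : Set (Set N)} [hS : Model S] {P : N → Prop} {m : ℕ} (X : Fin m → Set N)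
    (hX : ∀ i, X i ∈ S) (φ : BForm m 2)
    (h : ∀ x y, P x ↔ φ.Holds X (Fin.cons y (Fin.cons x Fin.elim0))) :
    {x | P x} ∈ S :=
  comp_delta1 X hX φ φ (fun x => ⟨fun hx => ⟨0, (h x 0).1 hx⟩, fun ⟨y, hy⟩ => (h x y).2 hy⟩)
    (fun x => ⟨fun hx y => (h x y).1 hx, fun hy => (h x 0).2 (hy 0)⟩)

end Comprehension

section Base

variable {N : Type*} [CommSemiring N] [LinearOrder N] [IsStrictOrderedRing N]
  [CanonicallyOrderedAdd N] [Discrete N] {S : Set (Set N)} [hS : Model S]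

theorem singleton_mem (c : N) : {x : N | x = c} ∈ S := by
  have := hS.models.comprehension 0 1 Fin.elim0 (fun i => i.elim0) (fun _ => c) (.eq x1 x2)
    (.eq x1 x2) (by
      intro x; simp only [BForm.Holds, Tm.eval, Fin.cons_zero, Fin.cons_succ]; simp)
  simp only [BForm.Holds, Tm.eval, Fin.cons_zero, Fin.cons_succ] at this
  simpa using this

theorem inter_mem {A B : Set N} (hA : A ∈ S) (hB : B ∈ S) : {x | x ∈ A ∧ x ∈ B} ∈ S :=
  comp_delta0 ![A, B] (by simp [Fin.forall_fin_succ, hA, hB]) (.and (.mem x1 0) (.mem x1 1))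
    (by intro x y; simp [BForm.Holds, Tm.eval])

theorem diff_mem {A B : Set N} (hA : A ∈ S) (hB : B ∈ S) : {x | x ∈ A ∧ x ∉ B} ∈ S :=
  comp_delta0 ![A, B] (by simp [Fin.forall_fin_succ, hA, hB]) (.and (.mem x1 0) (.neg (.mem x1 1)))
    (by intro x y; simp [BForm.Holds, Tm.eval])

theorem univ_mem : (Set.univ : Set N) ∈ S :=
  comp_delta0 (P := fun _ => True) (m := 0) Fin.elim0 (fun i => i.elim0) (.eq x1 x1)
    (by intro x y; simp [BForm.Holds, Tm.eval])

theorem pair_eq_bounds {z i j : N} (h : z = pair i j) : i < z + 1 ∧ j < z + 1 := by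
  subst h; exact ⟨lt_add_one_iff'.2 (left_le_pair i j), lt_add_one_iff'.2 (right_le_pair i j)⟩

theorem prod_mem {A B : Set N} (hA : A ∈ S) (hB : B ∈ S) :
    {z | ∃ a b, z = pair a b ∧ a ∈ A ∧ b ∈ B} ∈ S :=
  comp_delta0 ![A, B] (by simp [Fin.forall_fin_succ, hA, hB])
    (.bex (.add x1 .one) (.bex (.add x2 .one) (.and (.eq x3 (.pr x1 x0))
      (.and (.mem x1 0) (.mem x0 1)))))
    (by
      intro x y
      simp only [BForm.Holds, Tm.eval, Tm.eval_pr, Fin.cons_zero, Fin.cons_succ]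
      constructor
      · rintro ⟨a, b, h, ha, hb⟩
        exact ⟨a, (pair_eq_bounds h).1, b, (pair_eq_bounds h).2, h, ha, hb⟩
      · rintro ⟨a, -, b, -, h⟩
        exact ⟨a, b, h⟩)

theorem fst_mem {A B : Set N} (hA : A ∈ S) (hB : B ∈ S) :
    {z | ∃ a b, z = pair (pair a b) a ∧ a ∈ A ∧ b ∈ B} ∈ S :=
  comp_delta0 ![A, B] (by simp [Fin.forall_fin_succ, hA, hB])
    (.bex (.add x1 .one) (.bex (.add x2 .one) (.and (.eq x3 (.pr (.pr x1 x0) x1))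
      (.and (.mem x1 0) (.mem x0 1)))))
    (by
      intro x y
      simp only [BForm.Holds, Tm.eval, Tm.eval_pr, Fin.cons_zero, Fin.cons_succ]
      constructor
      · rintro ⟨a, b, h, ha, hb⟩
        refine ⟨a, (pair_eq_bounds h).2, b, ?_, h, ha, hb⟩
        exact lt_of_le_of_lt (right_le_pair a b) (pair_eq_bounds h).1
      · rintro ⟨a, -, b, -, h⟩
        exact ⟨a, b, h⟩)

theorem snd_mem {A B : Set N} (hA : A ∈ S) (hB : B ∈ S) :
    {z | ∃ a b, z = pair (pair a b) b ∧ a ∈ A ∧ b ∈ B} ∈ S :=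
  comp_delta0 ![A, B] (by simp [Fin.forall_fin_succ, hA, hB])
    (.bex (.add x1 .one) (.bex (.add x2 .one) (.and (.eq x3 (.pr (.pr x1 x0) x0))
      (.and (.mem x1 0) (.mem x0 1)))))
    (by
      intro x y
      simp only [BForm.Holds, Tm.eval, Tm.eval_pr, Fin.cons_zero, Fin.cons_succ]
      constructor
      · rintro ⟨a, b, h, ha, hb⟩
        refine ⟨a, ?_, b, (pair_eq_bounds h).2, h, ha, hb⟩
        exact lt_of_le_of_lt (left_le_pair a b) (pair_eq_bounds h).1
      · rintro ⟨a, -, b, -, h⟩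
        exact ⟨a, b, h⟩)

theorem mk_mem {A B : Set N} (hA : A ∈ S) (hB : B ∈ S) :
    {z | ∃ a b c, z = pair a (pair b c) ∧ pair a b ∈ A ∧ pair a c ∈ B} ∈ S :=
  comp_delta0 ![A, B] (by simp [Fin.forall_fin_succ, hA, hB])
    (.bex (.add x1 .one) (.bex (.add x2 .one) (.bex (.add x3 .one)
      (.and (.eq x4 (.pr x2 (.pr x1 x0))) (.and (.mem (.pr x2 x1) 0) (.mem (.pr x2 x0) 1))))))
    (by
      intro x y
      simp only [BForm.Holds, Tm.eval, Tm.eval_pr, Fin.cons_zero, Fin.cons_succ]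
      constructor
      · rintro ⟨a, b, c, h, ha, hb⟩
        refine ⟨a, (pair_eq_bounds h).1, b, ?_, c, ?_, h, ha, hb⟩
        · exact lt_of_le_of_lt (left_le_pair b c) (pair_eq_bounds h).2
        · exact lt_of_le_of_lt (right_le_pair b c) (pair_eq_bounds h).2
      · rintro ⟨a, -, b, -, c, -, h⟩
        exact ⟨a, b, c, h⟩)

theorem add_mem : {z : N | ∃ a b, z = pair (pair a b) (a + b)} ∈ S :=
  comp_delta0 (m := 0) Fin.elim0 (fun i => i.elim0)
    (.bex (.add x1 .one) (.bex (.add x2 .one) (.eq x3 (.pr (.pr x1 x0) (.add x1 x0)))))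
    (by
      intro x y
      simp only [BForm.Holds, Tm.eval, Tm.eval_pr, Fin.cons_zero, Fin.cons_succ]
      constructor
      · rintro ⟨a, b, h⟩
        refine ⟨a, ?_, b, ?_, h⟩
        · exact lt_of_le_of_lt (left_le_pair a b) (pair_eq_bounds h).1
        · exact lt_of_le_of_lt (right_le_pair a b) (pair_eq_bounds h).1
      · rintro ⟨a, -, b, -, h⟩
        exact ⟨a, b, h⟩)

theorem mul_mem : {z : N | ∃ a b, z = pair (pair a b) (a * b)} ∈ S :=
  comp_delta0 (m := 0) Fin.elim0 (fun i => i.elim0)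
    (.bex (.add x1 .one) (.bex (.add x2 .one) (.eq x3 (.pr (.pr x1 x0) (.mul x1 x0)))))
    (by
      intro x y
      simp only [BForm.Holds, Tm.eval, Tm.eval_pr, Fin.cons_zero, Fin.cons_succ]
      constructor
      · rintro ⟨a, b, h⟩
        refine ⟨a, ?_, b, ?_, h⟩
        · exact lt_of_le_of_lt (left_le_pair a b) (pair_eq_bounds h).1
        · exact lt_of_le_of_lt (right_le_pair a b) (pair_eq_bounds h).1
      · rintro ⟨a, -, b, -, h⟩
        exact ⟨a, b, h⟩)

theorem lt_mem : {z : N | ∃ a b, z = pair a b ∧ a < b} ∈ S :=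
  comp_delta0 (m := 0) Fin.elim0 (fun i => i.elim0)
    (.bex (.add x1 .one) (.bex (.add x2 .one) (.and (.eq x3 (.pr x1 x0)) (.lt x1 x0))))
    (by
      intro x y
      simp only [BForm.Holds, Tm.eval, Tm.eval_pr, Fin.cons_zero, Fin.cons_succ]
      constructor
      · rintro ⟨a, b, h⟩
        exact ⟨a, (pair_eq_bounds h.1).1, b, (pair_eq_bounds h.1).2, h⟩
      · rintro ⟨a, -, b, -, h⟩
        exact ⟨a, b, h⟩)

theorem diag_mem {A : Set N} (hA : A ∈ S) : {z : N | ∃ a, z = pair a a ∧ a ∈ A} ∈ S :=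
  comp_delta0 ![A] (by simp [hA])
    (.bex (.add x1 .one) (.and (.eq x2 (.pr x0 x0)) (.mem x0 0)))
    (by
      intro x y
      simp only [BForm.Holds, Tm.eval, Tm.eval_pr, Fin.cons_zero, Fin.cons_succ]
      constructor
      · rintro ⟨a, h⟩
        exact ⟨a, (pair_eq_bounds h.1).1, h⟩
      · rintro ⟨a, -, h⟩
        exact ⟨a, h⟩)

theorem ball_mem {A B : Set N} (hA : A ∈ S) (hB : B ∈ S) :
    {z : N | ∃ a b, z = pair a b ∧ a ∈ A ∧ ∀ y < b, pair a y ∈ B} ∈ S :=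
  comp_delta0 ![A, B] (by simp [Fin.forall_fin_succ, hA, hB])
    (.bex (.add x1 .one) (.bex (.add x2 .one) (.and (.eq x3 (.pr x1 x0))
      (.and (.mem x1 0) (.ball x0 (.mem (.pr x2 x0) 1))))))
    (by
      intro x y
      simp only [BForm.Holds, Tm.eval, Tm.eval_pr, Fin.cons_zero, Fin.cons_succ]
      constructor
      · rintro ⟨a, b, h⟩
        exact ⟨a, (pair_eq_bounds h.1).1, b, (pair_eq_bounds h.1).2, h⟩
      · rintro ⟨a, -, b, -, h⟩
        exact ⟨a, b, h⟩)

/-- The composition of two graphs of functions `A → _` and `_ → C` is `Δ⁰₁`: the intermediate value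
exists and is unique. -/
theorem compose_mem {A C G H : Set N} (hA : A ∈ S) (hC : C ∈ S) (hG : G ∈ S) (hH : H ∈ S)
    (h1 : ∀ a ∈ A, ∃ b, pair a b ∈ G ∧ ∀ b', pair a b' ∈ G → b' = b)
    (h2 : ∀ a b, pair a b ∈ G → a ∈ A) (h3 : ∀ b c, pair b c ∈ H → c ∈ C) :
    {z : N | ∃ a b c, z = pair a c ∧ pair a b ∈ G ∧ pair b c ∈ H} ∈ S :=
  comp_delta1 ![A, C, G, H] (by simp [Fin.forall_fin_succ, hA, hC, hG, hH])
    (.bex (.add x1 .one) (.bex (.add x2 .one) (.and (.eq x3 (.pr x1 x0))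
      (.and (.mem (.pr x1 x2) 2) (.mem (.pr x2 x0) 3)))))
    (.bex (.add x1 .one) (.bex (.add x2 .one) (.and (.eq x3 (.pr x1 x0))
      (.and (.and (.mem x1 0) (.mem x0 1))
        (.or (.neg (.mem (.pr x1 x2) 2)) (.mem (.pr x2 x0) 3))))))
    (by
      intro x
      simp only [BForm.Holds, Tm.eval, Tm.eval_pr, Fin.cons_zero, Fin.cons_succ]
      constructor
      · rintro ⟨a, b, c, h⟩
        exact ⟨b, a, (pair_eq_bounds h.1).1, c, (pair_eq_bounds h.1).2, h⟩
      · rintro ⟨b, a, -, c, -, h⟩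
        exact ⟨a, b, c, h⟩)
    (by
      intro x
      simp only [BForm.Holds, Tm.eval, Tm.eval_pr, Fin.cons_zero, Fin.cons_succ]
      constructor
      · rintro ⟨a, b, c, h, hG', hH'⟩ y
        refine ⟨a, (pair_eq_bounds h).1, c, (pair_eq_bounds h).2, h, ⟨h2 _ _ hG', h3 _ _ hH'⟩, ?_⟩
        by_cases hy : pair a y ∈ G
        · obtain ⟨b', -, hb'⟩ := h1 a (h2 _ _ hG')
          right
          rw [hb' y hy, ← hb' b hG']
          exact hH'
        · exact .inl hy
      · intro h
        obtain ⟨a, -, c, -, hx, ⟨ha, -⟩, -⟩ := h 0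
        obtain ⟨b, hb, -⟩ := h1 a ha
        obtain ⟨a', -, c', -, hx', -, h'⟩ := h b
        obtain ⟨rfl, rfl⟩ := pair_inj.1 (hx.symm.trans hx')
        exact ⟨a, b, c, hx, hb, h'.resolve_left (not_not.2 hb)⟩)

end Base

/-! ### Recursive functions and predicates of a model -/

/-- A type whose elements are coded by numbers: `N`, `Prop`, or an iterated product of such types. -/
class Ctx (N : Type*) [CommSemiring N] [LinearOrder N] (α : Type*) where
  /-- The code of an element. -/
  code : α → N
  code_inj : Function.Injective code
  range_code : ∀ (S : Set (Set N)) [Model S], Set.range code ∈ S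

open Ctx

section Rec

variable {N : Type*} [CommSemiring N] [LinearOrder N] [IsStrictOrderedRing N]
  [CanonicallyOrderedAdd N] [Discrete N]

noncomputable instance : Ctx N N where
  code := id
  code_inj := Function.injective_id
  range_code S _ := by simpa using univ_mem (S := S)

open Classical in
noncomputable instance : Ctx N Prop where
  code p := if p then 1 else 0
  code_inj p q h := by
    by_cases hp : p <;> by_cases hq : q <;> simp_all
  range_code S _ := by
    have := diff_mem (S := S) univ_mem (inter_mem (diff_mem univ_mem (singleton_mem (0 : N)))
      (diff_mem univ_mem (singleton_mem 1)))
    convert this using 1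
    ext x
    simp only [Set.mem_range, Set.mem_univ, Set.mem_ofPred_eq, true_and]
    constructor
    · rintro ⟨p, rfl⟩
      by_cases hp : p <;> simp [hp]
    · intro h
      by_cases hx : x = 1
      · exact ⟨True, by simp [hx]⟩
      · exact ⟨False, by simp only [if_false]; by_contra h0; exact h ⟨fun h => h0 h.symm, hx⟩⟩

variable {α β γ : Type*} [Ctx N α] [Ctx N β] [Ctx N γ]

noncomputable instance : Ctx N (α × β) where
  code p := pair (code p.1) (code p.2)
  code_inj p q h := by
    obtain ⟨h1, h2⟩ := pair_inj.1 h
    exact Prod.ext (code_inj h1) (code_inj h2)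
  range_code S _ := by
    convert prod_mem (S := S) (range_code (α := α) S) (range_code (α := β) S) using 1
    ext x
    simp only [Set.mem_range, Prod.exists, Set.mem_ofPred_eq]
    constructor
    · rintro ⟨a, b, rfl⟩
      exact ⟨_, _, rfl, ⟨a, rfl⟩, ⟨b, rfl⟩⟩
    · rintro ⟨_, _, rfl, ⟨a, rfl⟩, ⟨b, rfl⟩⟩
      exact ⟨a, b, rfl⟩

theorem code_num (a : N) : code a = a := rfl

theorem code_mk (a : α) (b : β) : code (N := N) (a, b) = pair (code a) (code b) := rfl

open Classical in
theorem code_prop (p : Prop) : code (N := N) p = if p then 1 else 0 := rfl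

variable {S : Set (Set N)}

/-- `f` is recursive in the model: its graph, as a set of codes, belongs to the model. A predicate
is recursive as a function with values in `Prop`. -/
@[fun_prop] def Rec (S : Set (Set N)) (f : α → β) : Prop :=
  {z : N | ∃ a, z = pair (code a) (code (f a))} ∈ S

variable [Model S]

@[fun_prop] theorem Rec.id : Rec S (fun a : α => a) := by
  unfold Rec
  convert diag_mem (range_code (α := α) S) using 1
  ext z; simp

@[fun_prop] theorem Rec.const (b : β) : Rec S (fun _ : α => b) := by
  unfold Rec
  convert prod_mem (range_code (α := α) S) (singleton_mem (code b)) using 1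
  ext z; simp

@[fun_prop] theorem Rec.comp {f : β → γ} {g : α → β} (hf : Rec S f) (hg : Rec S g) :
    Rec S (fun a => f (g a)) := by
  unfold Rec at *
  convert compose_mem (range_code (α := α) S) (range_code (α := γ) S) hg hf ?_ ?_ ?_ using 1
  · ext z
    constructor
    · rintro ⟨a, rfl⟩
      exact ⟨_, _, _, rfl, ⟨a, rfl⟩, ⟨g a, rfl⟩⟩
    · rintro ⟨a', b', c', rfl, ⟨a, ha⟩, ⟨b, hb⟩⟩
      obtain ⟨rfl, rfl⟩ := pair_inj.1 ha
      obtain ⟨h, rfl⟩ := pair_inj.1 hb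
      obtain rfl := code_inj h
      exact ⟨a, rfl⟩
  · rintro _ ⟨a, rfl⟩
    refine ⟨code (g a), ⟨a, rfl⟩, ?_⟩
    rintro b' ⟨a', ha'⟩
    obtain ⟨h, rfl⟩ := pair_inj.1 ha'
    obtain rfl := code_inj h
    rfl
  · rintro a b ⟨a', ha'⟩
    obtain ⟨rfl, rfl⟩ := pair_inj.1 ha'
    exact ⟨a', rfl⟩
  · rintro a b ⟨a', ha'⟩
    obtain ⟨rfl, rfl⟩ := pair_inj.1 ha'
    exact ⟨_, rfl⟩

theorem Rec.prod_fst : Rec S (Prod.fst : α × β → α) := by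
  unfold Rec
  convert fst_mem (range_code (α := α) S) (range_code (α := β) S) using 1
  ext z; simp [code_mk]

theorem Rec.prod_snd : Rec S (Prod.snd : α × β → β) := by
  unfold Rec
  convert snd_mem (range_code (α := α) S) (range_code (α := β) S) using 1
  ext z; simp [code_mk]

@[fun_prop] theorem Rec.fst {f : α → β × γ} (hf : Rec S f) : Rec S (fun a => (f a).1) :=
  Rec.prod_fst.comp hf

@[fun_prop] theorem Rec.snd {f : α → β × γ} (hf : Rec S f) : Rec S (fun a => (f a).2) :=
  Rec.prod_snd.comp hf

@[fun_prop] theorem Rec.mk {f : α → β} {g : α → γ} (hf : Rec S f) (hg : Rec S g) :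
    Rec S (fun a => (f a, g a)) := by
  unfold Rec at *
  convert mk_mem hf hg using 1
  ext z
  constructor
  · rintro ⟨a, rfl⟩
    exact ⟨_, _, _, rfl, ⟨a, rfl⟩, ⟨a, rfl⟩⟩
  · rintro ⟨a', b', c', rfl, ⟨a, ha⟩, ⟨b, hb⟩⟩
    obtain ⟨rfl, rfl⟩ := pair_inj.1 ha
    obtain ⟨h, rfl⟩ := pair_inj.1 hb
    obtain rfl := code_inj h
    exact ⟨a, rfl⟩

/-- A predicate is recursive if and only if the set of the codes of its elements belongs to the
model. -/
theorem rec_iff_mem {P : α → Prop} : Rec S P ↔ {z | ∃ a, z = code a ∧ P a} ∈ S := by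
  classical
  constructor
  · intro h
    unfold Rec at h
    have := comp_delta0 (P := fun z => pair z 1 ∈ {z : N | ∃ a, z = pair (code a) (code (P a))})
      ![_] (by simpa using h) (.mem (.pr x1 .one) 0) (by
        intro x y; simp [BForm.Holds, Tm.eval_pr, Tm.eval])
    convert this using 1
    ext z
    constructor
    · rintro ⟨a, rfl, ha⟩
      exact ⟨a, by simp [code_prop, ha]⟩
    · rintro ⟨a, ha⟩
      obtain ⟨rfl, h⟩ := pair_inj.1 ha
      refine ⟨a, rfl, ?_⟩
      by_contra h'
      simp [code_prop, h'] at h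
  · intro h
    have h' := diff_mem (range_code (α := α) S) h
    have h1 := diff_mem (S := S) univ_mem (inter_mem (diff_mem univ_mem
      (prod_mem h (singleton_mem 1))) (diff_mem univ_mem (prod_mem h' (singleton_mem 0))))
    unfold Rec
    convert h1 using 1
    ext z
    simp only [Set.mem_univ, Set.mem_ofPred_eq, true_and, not_and_or, not_not]
    constructor
    · rintro ⟨a, rfl⟩
      by_cases ha : P a
      · exact .inl ⟨_, _, rfl, ⟨a, rfl, ha⟩, by simp [code_prop, ha]⟩
      · refine .inr ⟨_, _, rfl, ⟨⟨a, rfl⟩, ?_⟩, by simp [code_prop, ha]⟩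
        rintro ⟨b, hb, hb'⟩
        obtain rfl := code_inj hb
        exact ha hb'
    · rintro (⟨_, _, rfl, ⟨a, rfl, ha⟩, rfl⟩ | ⟨_, _, rfl, ⟨⟨a, rfl⟩, ha⟩, rfl⟩)
      · exact ⟨a, by simp [code_prop, ha]⟩
      · have : ¬ P a := fun h => ha ⟨a, rfl, h⟩
        exact ⟨a, by simp [code_prop, this]⟩

theorem Rec.setOf_mem {P : N → Prop} (h : Rec S P) : {x | P x} ∈ S := by
  convert rec_iff_mem.1 h using 2 with z
  simp [code_num]

theorem rec_mem {A : Set N} (hA : A ∈ S) : Rec S (fun x => x ∈ A) := by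
  rw [rec_iff_mem]
  convert hA
  simp [code_num]

@[fun_prop] theorem Rec.and {P Q : α → Prop} (hP : Rec S P) (hQ : Rec S Q) :
    Rec S (fun a => P a ∧ Q a) := by
  rw [rec_iff_mem] at *
  convert inter_mem hP hQ using 1
  ext z
  constructor
  · rintro ⟨a, rfl, h1, h2⟩
    exact ⟨⟨a, rfl, h1⟩, ⟨a, rfl, h2⟩⟩
  · rintro ⟨⟨a, rfl, h1⟩, ⟨b, hb, h2⟩⟩
    obtain rfl := code_inj hb
    exact ⟨a, rfl, h1, h2⟩

@[fun_prop] theorem Rec.not {P : α → Prop} (hP : Rec S P) : Rec S (fun a => ¬ P a) := by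
  rw [rec_iff_mem] at *
  convert diff_mem (range_code (α := α) S) hP using 1
  ext z
  constructor
  · rintro ⟨a, rfl, h1⟩
    refine ⟨⟨a, rfl⟩, ?_⟩
    rintro ⟨b, hb, h2⟩
    obtain rfl := code_inj hb
    exact h1 h2
  · rintro ⟨⟨a, rfl⟩, h⟩
    exact ⟨a, rfl, fun h' => h ⟨a, rfl, h'⟩⟩

@[fun_prop] theorem Rec.or {P Q : α → Prop} (hP : Rec S P) (hQ : Rec S Q) :
    Rec S (fun a => P a ∨ Q a) := by
  simp only [or_iff_not_and_not]
  fun_prop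

@[fun_prop] theorem Rec.imp {P Q : α → Prop} (hP : Rec S P) (hQ : Rec S Q) :
    Rec S (fun a => P a → Q a) := by
  simp only [imp_iff_not_or]
  fun_prop

@[fun_prop] theorem Rec.iff {P Q : α → Prop} (hP : Rec S P) (hQ : Rec S Q) :
    Rec S (fun a => P a ↔ Q a) := by
  simp only [iff_iff_implies_and_implies]
  fun_prop

theorem Rec.eq_prod : Rec S (fun p : α × α => p.1 = p.2) := by
  rw [rec_iff_mem]
  convert diag_mem (range_code (α := α) S) using 1
  ext z
  constructor
  · rintro ⟨⟨a, b⟩, rfl, h⟩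
    obtain rfl : a = b := h
    exact ⟨_, rfl, a, rfl⟩
  · rintro ⟨_, rfl, a, rfl⟩
    exact ⟨⟨a, a⟩, rfl, rfl⟩

@[fun_prop] theorem Rec.eq {f g : α → β} (hf : Rec S f) (hg : Rec S g) :
    Rec S (fun a => f a = g a) :=
  Rec.eq_prod.comp (hf.mk hg)

theorem Rec.lt_prod : Rec S (fun p : N × N => p.1 < p.2) := by
  rw [rec_iff_mem]
  convert lt_mem (S := S) using 2 with z
  simp [code_mk, code_num]

@[fun_prop] theorem Rec.lt {f g : α → N} (hf : Rec S f) (hg : Rec S g) :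
    Rec S (fun a => f a < g a) :=
  Rec.lt_prod.comp (hf.mk hg)

@[fun_prop] theorem Rec.le {f g : α → N} (hf : Rec S f) (hg : Rec S g) :
    Rec S (fun a => f a ≤ g a) := by
  simp only [← not_lt]
  fun_prop

theorem Rec.add_prod : Rec S (fun p : N × N => p.1 + p.2) := by
  unfold Rec
  convert add_mem (S := S) using 2 with z
  simp [code_mk, code_num]

theorem Rec.mul_prod : Rec S (fun p : N × N => p.1 * p.2) := by
  unfold Rec
  convert mul_mem (S := S) using 2 with z
  simp [code_mk, code_num]

@[fun_prop] theorem Rec.add {f g : α → N} (hf : Rec S f) (hg : Rec S g) :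
    Rec S (fun a => f a + g a) :=
  Rec.add_prod.comp (hf.mk hg)

@[fun_prop] theorem Rec.mul {f g : α → N} (hf : Rec S f) (hg : Rec S g) :
    Rec S (fun a => f a * g a) :=
  Rec.mul_prod.comp (hf.mk hg)

@[fun_prop] protected theorem Rec.pair {f g : α → N} (hf : Rec S f) (hg : Rec S g) :
    Rec S (fun a => pair (f a) (g a)) := by
  simp only [RevMath.pair, sq]
  fun_prop

/-- Bounded quantification by the last variable. -/
theorem Rec.ball_prod {P : α → N → Prop} (hP : Rec S (fun p : α × N => P p.1 p.2)) :
    Rec S (fun p : α × N => ∀ y < p.2, P p.1 y) := by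
  rw [rec_iff_mem] at *
  convert ball_mem (range_code (α := α) S) hP using 1
  ext z
  constructor
  · rintro ⟨⟨a, b⟩, rfl, h⟩
    exact ⟨_, _, rfl, ⟨a, rfl⟩, fun y hy => ⟨(a, y), rfl, h y hy⟩⟩
  · rintro ⟨_, b, rfl, ⟨a, rfl⟩, h⟩
    refine ⟨(a, b), rfl, fun y hy => ?_⟩
    obtain ⟨⟨a', y'⟩, h1, h2⟩ := h y hy
    obtain ⟨h3, h4⟩ := pair_inj.1 h1
    obtain rfl := code_inj h3
    obtain rfl := h4
    exact h2

/-- Only strict bounds of quantifiers are registered for `fun_prop`; a bound `y ≤ t` has to be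
rewritten as `y < t + 1` first. -/
@[fun_prop] theorem Rec.ball {f : α → N} {P : α → N → Prop} (hf : Rec S f)
    (hP : Rec S (fun p : α × N => P p.1 p.2)) : Rec S (fun a => ∀ y < f a, P a y) :=
  (Rec.ball_prod hP).comp (Rec.id.mk hf)

@[fun_prop] theorem Rec.bex {f : α → N} {P : α → N → Prop} (hf : Rec S f)
    (hP : Rec S (fun p : α × N => P p.1 p.2)) : Rec S (fun a => ∃ y < f a, P a y) := by
  have : Rec S (fun a => ¬ ∀ y < f a, ¬ P a y) := by fun_prop
  convert this using 3
  simp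

theorem Rec.of_graph {f : α → β} (h : Rec S (fun p : α × β => p.2 = f p.1)) : Rec S f := by
  rw [rec_iff_mem] at h
  unfold Rec
  convert h using 2 with z
  simp [code_mk]

@[fun_prop] theorem Rec.ite {P : α → Prop} [∀ a, Decidable (P a)] {f g : α → β} (hP : Rec S P)
    (hf : Rec S f) (hg : Rec S g) : Rec S (fun a => if P a then f a else g a) := by
  apply Rec.of_graph
  have : Rec S (fun p : α × β => (P p.1 → p.2 = f p.1) ∧ (¬ P p.1 → p.2 = g p.1)) := by fun_prop
  convert this using 3 with p
  split_ifs with h <;> simp [h]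

@[fun_prop] theorem Rec.dvd {f g : α → N} (hf : Rec S f) (hg : Rec S g) :
    Rec S (fun a => f a ∣ g a) := by
  have : Rec S (fun a => ∃ q ≤ g a, g a = f a * q) := by simp only [← lt_add_one_iff']; fun_prop
  convert this using 3 with a
  constructor
  · rintro ⟨q, hq⟩
    rcases eq_or_ne (f a) 0 with h0 | h0
    · exact ⟨0, zero_le, by simp [hq, h0]⟩
    · refine ⟨q, ?_, hq⟩
      rw [hq, mul_comm]
      exact le_self_mul (pos_of_ne_zero h0)
  · rintro ⟨q, -, hq⟩
    exact ⟨q, hq⟩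

theorem Elem.lt {i c : N} (h : Elem i c) : i < c := by
  obtain ⟨k, m, n, rfl, h, -⟩ := h
  exact h.trans_le (left_le_pair _ _)

@[fun_prop] theorem Rec.elem {f g : α → N} (hf : Rec S f) (hg : Rec S g) :
    Rec S (fun a => Elem (f a) (g a)) := by
  have : Rec S (fun a => ∃ k ≤ g a, ∃ m ≤ g a, ∃ n ≤ g a, g a = pair k (pair m n) ∧
    f a < k ∧ (m * (f a + 1) + 1) ∣ n) := by simp only [← lt_add_one_iff']; fun_prop
  convert this using 3 with a
  constructor
  · rintro ⟨k, m, n, h, h'⟩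
    refine ⟨k, ?_, m, ?_, n, ?_, h, h'⟩ <;> rw [h]
    · exact left_le_pair _ _
    · exact (left_le_pair _ _).trans (right_le_pair _ _)
    · exact (right_le_pair _ _).trans (right_le_pair _ _)
  · rintro ⟨k, -, m, -, n, -, h⟩
    exact ⟨k, m, n, h⟩

end Rec

/-! ### Recursively enumerable predicates, induction and collection -/

section Sig

variable {N : Type*} [CommSemiring N] [LinearOrder N] [IsStrictOrderedRing N]
  [CanonicallyOrderedAdd N] [Discrete N]
variable {α β γ : Type*} [Ctx N α] [Ctx N β] [Ctx N γ]

/-- The predicate `P` is recursively enumerable (`Σ⁰₁`) in the model. -/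
@[fun_prop] def Sig (S : Set (Set N)) (P : α → Prop) : Prop :=
  ∃ Q : α → N → Prop, Rec S (fun p : α × N => Q p.1 p.2) ∧ ∀ a, P a ↔ ∃ y, Q a y

variable {S : Set (Set N)} [hS : Model S]

theorem Rec.sig {P : α → Prop} (h : Rec S P) : Sig S P :=
  ⟨fun a _ => P a, by fun_prop, by simp⟩

theorem Sig.induction {P : N → Prop} (h : Sig S P) (h0 : P 0) (hs : ∀ x, P x → P (x + 1)) (x : N) :
    P x := by
  obtain ⟨Q, hQ, hPQ⟩ := h
  obtain ⟨A, hA, key⟩ : ∃ A ∈ S, ∀ x y : N, pair x y ∈ A ↔ Q x y := by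
    refine ⟨_, rec_iff_mem.1 hQ, fun x y => ?_⟩
    simp [code_mk, code_num, pair_inj]
  have := hS.models.induction 1 0 ![A] (by simpa using hA) Fin.elim0 (.mem (.pr x1 x0) 0)
  simp only [BForm.Holds, Tm.eval, Tm.eval_pr, Fin.cons_zero, Fin.cons_succ,
    Matrix.cons_val_zero] at this
  simp only [key, ← hPQ] at this
  exact this h0 hs x

theorem Rec.induction {P : N → Prop} (h : Rec S P) (h0 : P 0) (hs : ∀ x, P x → P (x + 1)) (x : N) :
    P x :=
  h.sig.induction h0 hs x

/-- The least number principle. -/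
theorem Rec.exists_least {P : N → Prop} (h : Rec S P) (hP : ∃ x, P x) :
    ∃ x, P x ∧ ∀ y < x, ¬ P y := by
  by_contra! hc
  obtain ⟨x, hx⟩ := hP
  have : ∀ x, ∀ y < x, ¬ P y := by
    refine Rec.induction (S := S) (by fun_prop) (by simp) ?_
    intro x ih y hy hPy
    rcases (lt_add_one_iff'.1 hy).lt_or_eq with h | rfl
    · exact ih y h hPy
    · obtain ⟨z, hz, hz'⟩ := hc y hPy
      exact ih z hz hz'
  exact this (x + 1) x (lt_add_one x) hx

/-- The collection principle for recursive predicates. -/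
theorem Rec.collection {P : N → N → Prop} (h : Rec S (fun p : N × N => P p.1 p.2)) (n : N)
    (hP : ∀ x < n, ∃ y, P x y) : ∃ z, ∀ x < n, ∃ y < z, P x y := by
  have : ∀ m, m ≤ n → ∃ z, ∀ x < m, ∃ y < z, P x y := by
    refine Sig.induction (S := S) ⟨fun m z => m ≤ n → ∀ x < m, ∃ y < z, P x y, by fun_prop, ?_⟩
      ?_ ?_
    · intro m
      by_cases hm : m ≤ n <;> simp [hm]
    · simp
    · intro m ih hm
      obtain ⟨z, hz⟩ := ih ((lt_add_one m).le.trans hm)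
      obtain ⟨y, hy⟩ := hP m ((lt_add_one m).trans_le hm)
      refine ⟨z + y + 1, fun x hx => ?_⟩
      rcases (lt_add_one_iff'.1 hx).lt_or_eq with h | rfl
      · obtain ⟨y', hy', hy''⟩ := hz x h
        exact ⟨y', hy'.trans_le (le_self_add.trans le_self_add), hy''⟩
      · exact ⟨y, lt_add_one_iff'.2 le_add_self, hy⟩
  exact this n le_rfl

@[fun_prop] theorem Sig.comp {P : β → Prop} {f : α → β} (hP : Sig S P) (hf : Rec S f) :
    Sig S (fun a => P (f a)) := by
  obtain ⟨Q, hQ, h⟩ := hP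
  exact ⟨fun a y => Q (f a) y, hQ.comp (f := fun p : β × N => Q p.1 p.2)
    (g := fun p : α × N => (f p.1, p.2)) (by fun_prop), fun a => h (f a)⟩

@[fun_prop] theorem Sig.exist {P : α → N → Prop} (hP : Sig S (fun p : α × N => P p.1 p.2)) :
    Sig S (fun a => ∃ x, P a x) := by
  obtain ⟨Q, hQ, h⟩ := hP
  refine ⟨fun a z => ∃ x < z, ∃ y < z, Q (a, x) y, by fun_prop, fun a => ?_⟩
  constructor
  · rintro ⟨x, hx⟩
    obtain ⟨y, hy⟩ := (h (a, x)).1 hx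
    exact ⟨max x y + 1, x, lt_add_one_iff'.2 (le_max_left _ _), y,
      lt_add_one_iff'.2 (le_max_right _ _), hy⟩
  · rintro ⟨z, x, -, y, -, hy⟩
    exact ⟨x, (h (a, x)).2 ⟨y, hy⟩⟩

@[fun_prop] theorem Sig.and {P Q : α → Prop} (hP : Sig S P) (hQ : Sig S Q) :
    Sig S (fun a => P a ∧ Q a) := by
  obtain ⟨P', hP', h⟩ := hP
  obtain ⟨Q', hQ', h'⟩ := hQ
  refine ⟨fun a z => (∃ y < z, P' a y) ∧ ∃ y < z, Q' a y, by fun_prop, fun a => ?_⟩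
  simp only [h, h']
  constructor
  · rintro ⟨⟨x, hx⟩, ⟨y, hy⟩⟩
    exact ⟨max x y + 1, ⟨x, lt_add_one_iff'.2 (le_max_left _ _), hx⟩, y,
      lt_add_one_iff'.2 (le_max_right _ _), hy⟩
  · rintro ⟨z, ⟨x, -, hx⟩, ⟨y, -, hy⟩⟩
    exact ⟨⟨x, hx⟩, ⟨y, hy⟩⟩

@[fun_prop] theorem Sig.or {P Q : α → Prop} (hP : Sig S P) (hQ : Sig S Q) :
    Sig S (fun a => P a ∨ Q a) := by
  obtain ⟨P', hP', h⟩ := hP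
  obtain ⟨Q', hQ', h'⟩ := hQ
  refine ⟨fun a z => P' a z ∨ Q' a z, by fun_prop, fun a => ?_⟩
  simp only [h, h', exists_or]

@[fun_prop] theorem Sig.imp {P Q : α → Prop} (hP : Rec S P) (hQ : Sig S Q) :
    Sig S (fun a => P a → Q a) := by
  simp only [imp_iff_not_or]
  have := (Rec.not hP).sig
  fun_prop

@[fun_prop] theorem Sig.bex {f : α → N} {P : α → N → Prop} (hf : Rec S f)
    (hP : Sig S (fun p : α × N => P p.1 p.2)) : Sig S (fun a => ∃ y < f a, P a y) := by
  have : Sig S (fun p : α × N => p.2 < f p.1) := Rec.sig (by fun_prop)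
  fun_prop

@[fun_prop] theorem Sig.ball {f : α → N} {P : α → N → Prop} (hf : Rec S f)
    (hP : Sig S (fun p : α × N => P p.1 p.2)) : Sig S (fun a => ∀ y < f a, P a y) := by
  obtain ⟨Q, hQ, h⟩ := hP
  refine ⟨fun a z => ∀ x < f a, ∃ y < z, Q (a, x) y, by fun_prop, fun a => ?_⟩
  constructor
  · intro h'
    exact Rec.collection (S := S) (P := fun x y => Q (a, x) y) (by fun_prop) (f a)
      fun x hx => (h (a, x)).1 (h' x hx)
  · rintro ⟨z, hz⟩ x hx
    obtain ⟨y, -, hy⟩ := hz x hx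
    exact (h (a, x)).2 ⟨y, hy⟩

/-- A predicate is recursive if it and its negation are recursively enumerable. -/
theorem Rec.of_sig {P : α → Prop} (h1 : Sig S P) (h2 : Sig S (fun a => ¬ P a)) : Rec S P := by
  obtain ⟨Q, hQ, h1⟩ := h1
  obtain ⟨R, hR, h2⟩ := h2
  rw [rec_iff_mem] at *
  refine comp_delta1 ![_, _, _]
    (by simp only [Fin.forall_fin_succ]; exact ⟨range_code (α := α) S, hQ, hR, fun i => i.elim0⟩)
    (.mem (.pr x1 x0) 1) (.and (.mem x1 0) (.neg (.mem (.pr x1 x0) 2))) ?_ ?_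
  · intro z
    simp only [BForm.Holds, Tm.eval, Tm.eval_pr, Fin.cons_zero, Fin.cons_succ]
    constructor
    · rintro ⟨a, rfl, ha⟩
      obtain ⟨y, hy⟩ := (h1 a).1 ha
      exact ⟨y, (a, y), rfl, hy⟩
    · rintro ⟨y, ⟨a, y'⟩, h, hy⟩
      obtain ⟨rfl, rfl⟩ := pair_inj.1 h
      exact ⟨a, rfl, (h1 a).2 ⟨_, hy⟩⟩
  · intro z
    simp only [BForm.Holds, Tm.eval, Tm.eval_pr, Fin.cons_zero, Fin.cons_succ]
    constructor
    · rintro ⟨a, rfl, ha⟩ y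
      refine ⟨⟨a, rfl⟩, ?_⟩
      rintro ⟨⟨b, y'⟩, h, hb⟩
      obtain ⟨h, h'⟩ := pair_inj.1 h
      obtain rfl := code_inj h
      exact (h2 a).2 ⟨_, hb⟩ ha
    · intro h
      obtain ⟨a, rfl⟩ := (h 0).1
      refine ⟨a, rfl, ?_⟩
      by_contra ha
      obtain ⟨y, hy⟩ := (h2 a).1 ha
      exact (h y).2 ⟨(a, y), rfl, hy⟩

/-- A function with a recursively enumerable graph is recursive. -/
theorem Rec.of_sig_graph {f : α → N} (h : Sig S (fun p : α × N => p.2 = f p.1)) : Rec S f := by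
  apply Rec.of_graph
  apply Rec.of_sig h
  have : Sig S (fun p : α × N => ∃ y, (y = f p.1) ∧ y ≠ p.2) := by
    apply Sig.exist
    apply Sig.and
    · exact h.comp (f := fun q : (α × N) × N => (q.1.1, q.2)) (by fun_prop)
    · exact Rec.sig (by fun_prop)
  convert this using 3 with p
  simp [eq_comm]

/-- The least number with the property `P`, and `0` if there is none. In a nonstandard model a
nonempty set that is not recursive may have no least element. -/
noncomputable def mu (P : N → Prop) : N :=
  open Classical in if h : ∃ x, P x ∧ ∀ y < x, ¬ P y then h.choose else 0

theorem mu_eq {P : N → Prop} {x : N} (hx : P x) (h : ∀ y < x, ¬ P y) : mu P = x := by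
  have h' : ∃ x, P x ∧ ∀ y < x, ¬ P y := ⟨x, hx, h⟩
  unfold mu
  rw [dif_pos h']
  obtain ⟨h1, h2⟩ := h'.choose_spec
  rcases lt_trichotomy h'.choose x with h3 | h3 | h3
  · exact absurd h1 (h _ h3)
  · exact h3
  · exact absurd hx (h2 _ h3)

theorem mu_spec {P : N → Prop} (hr : Rec S P) (h : ∃ x, P x) : P (mu P) := by
  obtain ⟨x, hx, hx'⟩ := hr.exists_least h
  rw [mu_eq hx hx']
  exact hx

theorem mu_min {P : N → Prop} (hr : Rec S P) {x : N} (h : P x) : mu P ≤ x := by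
  obtain ⟨z, hz, hz'⟩ := hr.exists_least ⟨x, h⟩
  rw [mu_eq hz hz']
  by_contra! hc
  exact hz' x hc h

protected theorem Rec.mu {P : α → N → Prop} (h : Rec S (fun p : α × N => P p.1 p.2))
    (hP : ∀ a, ∃ y, P a y) :
    Rec S (fun a => mu (P a)) := by
  apply Rec.of_graph
  have : Rec S (fun p : α × N => P p.1 p.2 ∧ ∀ y < p.2, ¬ P p.1 y) := by fun_prop
  convert this using 3 with p
  constructor
  · rintro h'
    obtain ⟨z, hz, hz'⟩ := Rec.exists_least (S := S) (P := P p.1) (by fun_prop) (hP p.1)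
    rw [h', mu_eq hz hz']
    exact ⟨hz, hz'⟩
  · rintro ⟨h1, h2⟩
    rw [mu_eq h1 h2]

/-- The least number below `b` with the property `P`, and `b` if there is none. -/
noncomputable def muB (b : N) (P : N → Prop) : N := mu (fun x => x = b ∨ P x)

@[fun_prop] protected theorem Rec.muB {f : α → N} {P : α → N → Prop} (hf : Rec S f)
    (h : Rec S (fun p : α × N => P p.1 p.2)) : Rec S (fun a => muB (f a) (P a)) :=
  Rec.mu (by fun_prop) (fun a => ⟨f a, .inl rfl⟩)

theorem muB_spec {b : N} {P : N → Prop} (hr : Rec S P) (h : ∃ x < b, P x) :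
    muB b P < b ∧ P (muB b P) := by
  obtain ⟨x, hx, hx'⟩ := h
  have h0 : Rec S (fun x => x = b ∨ P x) := by fun_prop
  have h1 := mu_min h0 (.inr hx')
  have h2 := mu_spec h0 ⟨x, .inr hx'⟩
  have h3 : muB b P < b := h1.trans_lt hx
  exact ⟨h3, h2.resolve_left h3.ne⟩

/-- A total recursively enumerable relation contains a recursive function. -/
theorem Sig.choice {P : N → N → Prop} (h : Sig S (fun p : N × N => P p.1 p.2))
    (hP : ∀ a, ∃ z, P a z) : ∃ f : N → N, Rec S f ∧ ∀ a, P a (f a) := by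
  obtain ⟨Q, hQ, h⟩ := h
  have h1 : Rec S (fun p : N × N => ∃ z < p.2, ∃ y < p.2, Q (p.1, z) y) := by fun_prop
  have h2 : ∀ a : N, ∃ b, ∃ z < b, ∃ y < b, Q (a, z) y := by
    intro a
    obtain ⟨z, hz⟩ := hP a
    obtain ⟨y, hy⟩ := (h (a, z)).1 hz
    exact ⟨max z y + 1, z, lt_add_one_iff'.2 (le_max_left _ _), y,
      lt_add_one_iff'.2 (le_max_right _ _), hy⟩
  have h3 := Rec.mu h1 h2
  set b := fun a => mu (fun b : N => ∃ z < b, ∃ y < b, Q (a, z) y) with hb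
  have h4 : ∀ a, ∃ z < b a, ∃ y < b a, Q (a, z) y := fun a => mu_spec (S := S) (by fun_prop) (h2 a)
  refine ⟨fun a => muB (b a) (fun z => ∃ y < b a, Q (a, z) y), by fun_prop, fun a => ?_⟩
  obtain ⟨-, y, -, hy⟩ := muB_spec (S := S) (P := fun z => ∃ y < b a, Q (a, z) y) (by fun_prop) (h4 a)
  exact (h (a, _)).2 ⟨y, hy⟩

end Sig

/-! ### Codes of finite sets -/

section Coding

variable {N : Type*} [CommSemiring N] [LinearOrder N] [IsStrictOrderedRing N]
  [CanonicallyOrderedAdd N] [Discrete N]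

theorem dvd_of_dvd_add {a b c : N} (h : a ∣ b) (h' : a ∣ b + c) : a ∣ c := by
  obtain ⟨u, rfl⟩ := h
  obtain ⟨v, hv⟩ := h'
  rcases le_total u v with huv | huv
  · obtain ⟨w, rfl⟩ := le_iff_exists_add.1 huv
    exact ⟨w, by rw [mul_add] at hv; exact add_left_cancel hv⟩
  · have h1 : a * v ≤ a * u := by gcongr
    have h2 : c = 0 := by
      have : a * u + c ≤ a * u + 0 := by rw [hv, add_zero]; exact h1
      simpa using le_of_add_le_add_left this
    simp [h2]

/-- The remainder of a division is unique. -/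
theorem mod_unique {p q r q' r' : N} (hr : r < p) (hr' : r' < p)
    (h : q * p + r = q' * p + r') : r = r' := by
  have key : ∀ {q r q' r' : N}, r < p → q * p + r = q' * p + r' → q' ≤ q := by
    intro q r q' r' hr h
    by_contra! hq
    have h1 : q * p + r < q * p + p := by gcongr
    have h2 : q * p + p ≤ q' * p := by
      calc q * p + p = (q + 1) * p := by ring
        _ ≤ q' * p := by gcongr; exact add_one_le_iff_lt.2 hq
    exact absurd (h1.trans_le (h2.trans le_self_add)) (by rw [h]; exact lt_irrefl _)
  obtain rfl := le_antisymm (key hr' h.symm) (key hr h)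
  exact add_left_cancel h

/-- If every number from `1` to `b` divides `m`, then the moduli `m (i + 1) + 1` for `i < b` are
pairwise coprime. -/
theorem dvd_of_dvd_mul_modulus {b m n i j : N} (hm : ∀ l < b, (l + 1) ∣ m) (hi : i < b)
    (hj : j < b) (hij : i ≠ j) (h : (m * (i + 1) + 1) ∣ n * (m * (j + 1) + 1)) :
    (m * (i + 1) + 1) ∣ n := by
  -- it suffices that the modulus divides `n m l` for some positive `l ≤ b`
  have key : ∀ l, l + 1 < b → (m * (i + 1) + 1) ∣ n * (m * (l + 1)) → (m * (i + 1) + 1) ∣ n := by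
    intro l hl h
    obtain ⟨m', hm'⟩ := hm l ((lt_add_one l).trans hl)
    have h1 : (m * (i + 1) + 1) ∣ n * (m * (i + 1)) * (m * (i + 1)) := by
      have : n * (m * (i + 1)) * (m * (i + 1)) = n * (m * (l + 1)) * (m' * (i + 1) * (i + 1)) := by
        calc n * (m * (i + 1)) * (m * (i + 1)) = n * m * m * ((i + 1) * (i + 1)) := by ring
          _ = n * m * ((l + 1) * m') * ((i + 1) * (i + 1)) := by rw [← hm']
          _ = _ := by ring
      rw [this]
      exact h.mul_right _
    have h2 : (m * (i + 1) + 1) ∣ n * (m * (i + 1)) :=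
      dvd_of_dvd_add h1 ⟨n * (m * (i + 1)), by ring⟩
    exact dvd_of_dvd_add h2 ⟨n, by ring⟩
  rcases hij.lt_or_gt with hlt | hlt
  · obtain ⟨l, rfl⟩ := le_iff_exists_add.1 (add_one_le_iff_lt.2 hlt)
    refine key l (lt_of_le_of_lt ?_ hj) ?_
    · calc l + 1 ≤ l + 1 + i := le_self_add
        _ = _ := by ring
    · have h1 : n * (m * (i + 1 + l + 1) + 1) = (m * (i + 1) + 1) * n + n * (m * (l + 1)) := by ring
      rw [h1] at h
      exact dvd_of_dvd_add ⟨n, rfl⟩ h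
  · obtain ⟨l, rfl⟩ := le_iff_exists_add.1 (add_one_le_iff_lt.2 hlt)
    refine key l (lt_of_le_of_lt ?_ hi) ?_
    · calc l + 1 ≤ l + 1 + j := le_self_add
        _ = _ := by ring
    · refine dvd_of_dvd_add h ⟨n, ?_⟩
      ring

theorem elem_pair_iff {i k m n : N} :
    Elem i (pair k (pair m n)) ↔ i < k ∧ (m * (i + 1) + 1) ∣ n := by
  constructor
  · rintro ⟨k', m', n', h, h'⟩
    simp only [pair_inj] at h
    obtain ⟨rfl, rfl, rfl⟩ := h
    exact h'
  · intro h
    exact ⟨k, m, n, rfl, h⟩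

variable {S : Set (Set N)} [hS : Model S]

theorem exists_div_mod (S : Set (Set N)) [Model S] {p : N} (hp : 0 < p) (n : N) :
    ∃ q, ∃ r < p, n = q * p + r := by
  have : ∃ q ≤ n, ∃ r < p, n = q * p + r := by
    refine Rec.induction (S := S) (P := fun n => ∃ q ≤ n, ∃ r < p, n = q * p + r) ?_ ?_ ?_ n
    · simp only [← lt_add_one_iff']; fun_prop
    · exact ⟨0, le_rfl, 0, hp, by simp⟩
    · rintro n ⟨q, hq, r, hr, hn⟩
      rcases (add_one_le_iff_lt.2 hr).lt_or_eq with h | h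
      · exact ⟨q, hq.trans (lt_add_one n).le, r + 1, h, by conv_lhs => rw [hn]
                                                           ring⟩
      · refine ⟨q + 1, by gcongr, 0, hp, ?_⟩
        conv_lhs => rw [hn]
        rw [add_assoc, h]; ring
  obtain ⟨q, -, h⟩ := this
  exact ⟨q, h⟩

theorem exists_common_multiple (S : Set (Set N)) [Model S] (b : N) :
    ∃ m : N, 0 < m ∧ ∀ i < b, (i + 1) ∣ m := by
  refine Sig.induction (S := S) (P := fun b => ∃ m : N, 0 < m ∧ ∀ i < b, (i + 1) ∣ m)
    ⟨fun b m => 0 < m ∧ ∀ i < b, (i + 1) ∣ m, by fun_prop, fun b => Iff.rfl⟩ ?_ ?_ b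
  · exact ⟨1, one_pos, by simp⟩
  · rintro b ⟨m, hm, h⟩
    refine ⟨m * (b + 1), mul_pos hm (lt_of_lt_of_le one_pos le_add_self), fun i hi => ?_⟩
    rcases (lt_add_one_iff'.1 hi).lt_or_eq with h' | rfl
    · exact (h i h').mul_right _
    · exact dvd_mul_left _ _

/-- The moduli for `i < b` are coprime, so the product of those with `P i` is divisible by no others.
The product is built by `Σ⁰₁` induction. -/
theorem exists_code_aux {b m : N} (hm0 : 0 < m) (hm : ∀ i < b, (i + 1) ∣ m) {P : N → Prop}
    (hP : Rec S P) : ∃ n, 0 < n ∧ ∀ i < b, (m * (i + 1) + 1) ∣ n ↔ P i := by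
  have : ∀ a, a ≤ b → ∃ n, 0 < n ∧ ∀ i < b, (m * (i + 1) + 1) ∣ n ↔ i < a ∧ P i := by
    refine Sig.induction (S := S) ⟨fun a n => a ≤ b → 0 < n ∧
      ∀ i < b, (m * (i + 1) + 1) ∣ n ↔ i < a ∧ P i, by fun_prop, ?_⟩ ?_ ?_
    · intro a
      by_cases h : a ≤ b <;> simp [h]
    · refine fun _ => ⟨1, one_pos, fun i hi => ?_⟩
      simp only [not_lt_zero, false_and, iff_false]
      rintro ⟨q, hq⟩
      rcases eq_or_ne q 0 with rfl | hq0
      · simp at hq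
      · have h1 : m * (i + 1) + 1 ≤ 1 := by
          conv_rhs => rw [hq]
          exact le_self_mul (pos_of_ne_zero hq0)
        have h2 : 0 < m * (i + 1) := mul_pos hm0 (lt_of_lt_of_le one_pos le_add_self)
        exact absurd h1 (not_le.2 (lt_add_of_pos_left 1 h2))
    · intro a ih ha
      obtain ⟨n, hn, h⟩ := ih ((lt_add_one a).le.trans ha)
      have hab : a < b := (lt_add_one a).trans_le ha
      by_cases hPa : P a
      · refine ⟨n * (m * (a + 1) + 1), mul_pos hn (lt_of_lt_of_le one_pos le_add_self),
          fun i hi => ?_⟩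
        rcases eq_or_ne i a with rfl | hia
        · simp [hPa]
        · have h1 : (i < a + 1 ∧ P i) ↔ (i < a ∧ P i) := by
            rw [lt_add_one_iff', le_iff_lt_or_eq]; simp [hia]
          rw [h1, ← h i hi]
          exact ⟨dvd_of_dvd_mul_modulus hm hi hab hia, fun h => h.mul_right _⟩
      · refine ⟨n, hn, fun i hi => ?_⟩
        rw [h i hi, lt_add_one_iff', le_iff_lt_or_eq]
        constructor
        · exact fun h => ⟨.inl h.1, h.2⟩
        · rintro ⟨h1 | rfl, h2⟩
          · exact ⟨h1, h2⟩
          · exact absurd h2 hPa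
  obtain ⟨n, hn, h⟩ := this b le_rfl
  exact ⟨n, hn, fun i hi => by simp [h i hi, hi]⟩

/-- All subsets of `{0, …, b - 1}` in the model have codes below `B`: their codes can be taken with a
common modulus `m`, and with a third component below a common multiple `Q` of the moduli. -/
def IsCodeBound (b B : N) : Prop :=
  ∃ m < B, ∃ Q < B, B = pair b (pair m Q) + 1 ∧ 0 < m ∧ 0 < Q ∧
    ∀ i < b, (i + 1) ∣ m ∧ (m * (i + 1) + 1) ∣ Q

theorem Rec.isCodeBound : Rec S (fun p : N × N => IsCodeBound p.1 p.2) := by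
  unfold IsCodeBound; fun_prop

theorem exists_isCodeBound (S : Set (Set N)) [Model S] (b : N) : ∃ B, IsCodeBound b B := by
  obtain ⟨m, hm0, hm⟩ := exists_common_multiple S b
  obtain ⟨Q, hQ, hQ'⟩ := exists_code_aux (S := S) (P := fun _ => True) hm0 hm (by fun_prop)
  refine ⟨_, m, ?_, Q, ?_, rfl, hm0, hQ, fun i hi => ⟨hm i hi, (hQ' i hi).2 trivial⟩⟩ <;>
    rw [lt_add_one_iff']
  · exact (left_le_pair _ _).trans (right_le_pair _ _)
  · exact (right_le_pair _ _).trans (right_le_pair _ _)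

/-- The third component of a code can be replaced by its remainder modulo `Q`. -/
theorem IsCodeBound.exists_code_lt {b B : N} (h : IsCodeBound b B) {P : N → Prop} (hP : Rec S P) :
    ∃ c < B, ∀ i, Elem i c ↔ i < b ∧ P i := by
  obtain ⟨m, -, Q, -, rfl, hm0, hQ, h⟩ := h
  obtain ⟨n, -, hn⟩ := exists_code_aux hm0 (fun i hi => (h i hi).1) hP
  obtain ⟨q, r, hr, rfl⟩ := exists_div_mod S hQ n
  refine ⟨pair b (pair m r), lt_add_one_iff'.2 (pair_le_pair le_rfl (pair_le_pair le_rfl hr.le)),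
    fun i => ?_⟩
  rw [elem_pair_iff]
  refine and_congr_right fun hi => ?_
  rw [← hn i hi]
  have h1 : (m * (i + 1) + 1) ∣ q * Q := (h i hi).2.mul_left q
  exact ⟨fun h => dvd_add h1 h, dvd_of_dvd_add h1⟩

theorem exists_code_lt (S : Set (Set N)) [Model S] (b : N) :
    ∃ B : N, ∀ P : N → Prop, Rec S P → ∃ c < B, ∀ i, Elem i c ↔ i < b ∧ P i := by
  obtain ⟨B, hB⟩ := exists_isCodeBound S b
  exact ⟨B, fun P hP => hB.exists_code_lt hP⟩

/-- The bound of `exists_code_lt` can be chosen as a recursive function of `b`. -/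
theorem exists_code_bound (S : Set (Set N)) [Model S] : ∃ β : N → N, Rec S β ∧
    ∀ b, ∀ P : N → Prop, Rec S P → ∃ c < β b, ∀ i, Elem i c ↔ i < b ∧ P i := by
  obtain ⟨β, hβ, h⟩ := Sig.choice (S := S) (P := IsCodeBound) (Rec.isCodeBound.sig)
    (exists_isCodeBound S)
  exact ⟨β, hβ, fun b P hP => (h b).exists_code_lt hP⟩

theorem exists_code (b : N) {P : N → Prop} (hP : Rec S P) :
    ∃ c, ∀ i, Elem i c ↔ i < b ∧ P i := by
  obtain ⟨B, hB⟩ := exists_code_lt S b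
  obtain ⟨c, -, hc⟩ := hB P hP
  exact ⟨c, hc⟩

end Coding

/-! ### Primitive recursion -/

section Prec

variable {N : Type*} [CommSemiring N] [LinearOrder N] [IsStrictOrderedRing N]
  [CanonicallyOrderedAdd N] [Discrete N] {S : Set (Set N)} [hS : Model S]
variable {α : Type*} [Ctx N α]

/-- Functions of a model are closed under primitive recursion. -/
theorem Rec.prec {g : α → N} {h : (α × N) × N → N} (hg : Rec S g)
    (hh : Rec S h) :
    ∃ f : α × N → N, Rec S f ∧ (∀ a, f (a, 0) = g a) ∧
      ∀ a n, f (a, n + 1) = h ((a, n), f (a, n)) := by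
  -- every element `⟨i, y⟩` of `w` is justified by the recursion
  let Good : α → N → Prop := fun a w => ∀ i < w, ∀ y < w, Elem (pair i y) w →
    (i = 0 ∧ y = g a) ∨ ∃ j < w, i = j + 1 ∧ ∃ v < w, Elem (pair j v) w ∧ y = h ((a, j), v)
  have hGood : Rec S (fun p : α × N => Good p.1 p.2) := by simp only [Good]; fun_prop
  -- the value at `n` is `y`
  let Val : α → N → N → Prop := fun a n y => ∃ w, Good a w ∧ Elem (pair n y) w
  have hVal : Sig S (fun p : (α × N) × N => Val p.1.1 p.1.2 p.2) :=
    ⟨fun p w => Good p.1.1 w ∧ Elem (pair p.1.2 p.2) w, by fun_prop, fun _ => Iff.rfl⟩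
  have hlt : ∀ {i y w : N}, Elem (pair i y) w → i < w ∧ y < w := fun h =>
    ⟨(left_le_pair _ _).trans_lt h.lt, (right_le_pair _ _).trans_lt h.lt⟩
  have huniq : ∀ a n y y', Val a n y → Val a n y' → y = y' := by
    rintro a n y y' ⟨w, hw, hy⟩ ⟨w', hw', hy'⟩
    have : ∀ n, ∀ y < w, ∀ y' < w', Elem (pair n y) w → Elem (pair n y') w' → y = y' := by
      refine Rec.induction (S := S) (by fun_prop) ?_ ?_
      · intro y hy y' hy' h1 h2
        rcases hw 0 (hlt h1).1 y hy h1 with ⟨-, rfl⟩ | ⟨j, -, hj, -⟩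
        · rcases hw' 0 (hlt h2).1 y' hy' h2 with ⟨-, rfl⟩ | ⟨j, -, hj, -⟩
          · rfl
          · exact absurd hj.symm (lt_of_lt_of_le one_pos le_add_self).ne'
        · exact absurd hj.symm (lt_of_lt_of_le one_pos le_add_self).ne'
      · intro n ih y hy y' hy' h1 h2
        have h0 : n + 1 ≠ 0 := (lt_of_lt_of_le one_pos le_add_self).ne'
        obtain ⟨j, -, hj, v, hv, hjv, rfl⟩ := (hw _ (hlt h1).1 y hy h1).resolve_left
          (fun h => h0 h.1)
        obtain ⟨j', -, hj', v', hv', hjv', rfl⟩ := (hw' _ (hlt h2).1 y' hy' h2).resolve_left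
          (fun h => h0 h.1)
        obtain rfl := add_right_cancel hj
        obtain rfl := add_right_cancel hj'
        rw [ih v hv v' hv' hjv hjv']
    exact this n y (hlt hy).2 y' (hlt hy').2 hy hy'
  have hzero : ∀ a, Val a 0 (g a) := by
    intro a
    obtain ⟨w, hw⟩ := exists_code (S := S) (pair 0 (g a) + 1) (P := fun z => z = pair 0 (g a))
      (by fun_prop)
    refine ⟨w, fun i _ y _ hiy => .inl ?_, (hw _).2 ⟨lt_add_one _, rfl⟩⟩
    exact pair_inj.1 ((hw _).1 hiy).2
  have hsucc : ∀ a n y, Val a n y → Val a (n + 1) (h ((a, n), y)) := by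
    rintro a n y ⟨w, hw, hy⟩
    obtain ⟨w', hw'⟩ := exists_code (S := S) (w + (pair (n + 1) (h ((a, n), y)) + 1))
      (P := fun z => Elem z w ∨ z = pair (n + 1) (h ((a, n), y))) (by fun_prop)
    have hsub : ∀ z, Elem z w → Elem z w' := fun z hz =>
      (hw' z).2 ⟨hz.lt.trans_le le_self_add, .inl hz⟩
    refine ⟨w', fun i _ v _ hiv => ?_, (hw' _).2
      ⟨lt_of_lt_of_le (lt_add_one _) le_add_self, .inr rfl⟩⟩
    rcases ((hw' _).1 hiv).2 with h1 | h1
    · refine (hw i (hlt h1).1 v (hlt h1).2 h1).imp_right ?_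
      rintro ⟨j, -, hj, u, -, hu, hv⟩
      have := hlt (hsub _ hu)
      exact ⟨j, this.1, hj, u, this.2, hsub _ hu, hv⟩
    · obtain ⟨rfl, rfl⟩ := pair_inj.1 h1
      have := hlt (hsub _ hy)
      exact .inr ⟨n, this.1, rfl, y, this.2, hsub _ hy, rfl⟩
  have htotal : ∀ a n, ∃ y, Val a n y := by
    intro a
    refine Sig.induction (S := S) (Sig.exist ?_) ⟨_, hzero a⟩
      fun n ⟨y, hy⟩ => ⟨_, hsucc a n y hy⟩
    exact hVal.comp (f := fun p : N × N => ((a, p.1), p.2)) (by fun_prop)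
  choose f hf using htotal
  refine ⟨fun p => f p.1 p.2, ?_, fun a => huniq a 0 _ _ (hf a 0) (hzero a),
    fun a n => huniq a (n + 1) _ _ (hf a (n + 1)) (hsucc a n _ (hf a n))⟩
  apply Rec.of_sig_graph
  convert hVal using 2 with p
  exact ⟨fun h => h ▸ hf _ _, fun h => huniq _ _ _ _ h (hf _ _)⟩

/-- Recursively enumerable predicates are recursive below every bound. Among the coded sets of
elements of `P` below `b` there is one of maximal cardinality, and it contains all of them. -/
theorem Sig.bounded {P : N → Prop} (hP : Sig S P) (b : N) : Rec S (fun x => x < b ∧ P x) := by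
  classical
  -- the number of elements below `i` of the set coded by `c`
  obtain ⟨card, hcard, hcard0, hcards⟩ := Rec.prec (S := S) (g := fun _ : N => 0)
    (h := fun q => if Elem q.1.2 q.1.1 then q.2 + 1 else q.2) (by fun_prop) (by fun_prop)
  have hle : ∀ c i, card (c, i) ≤ i := by
    intro c
    refine Rec.induction (S := S) (by fun_prop) (by simp [hcard0]) fun i hi => ?_
    rw [hcards]
    split_ifs
    · gcongr
    · exact hi.trans (lt_add_one i).le
  obtain ⟨B, hB⟩ := exists_code_lt S b
  -- there is a set of at least `j` elements of `P` below `b`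
  let W : N → Prop := fun j => ∃ c < B, (∀ x < b, Elem x c → P x) ∧ j ≤ card (c, b)
  have hW : Sig S W := by
    have h1 : Sig S (fun p : N × N => ∀ x < b, Elem x p.2 → P x) := by fun_prop
    have h2 : Sig S (fun p : N × N => p.1 ≤ card (p.2, b)) := Rec.sig (by fun_prop)
    fun_prop
  have hmax : ∃ j, W j ∧ ¬ W (j + 1) := by
    by_contra! hc
    obtain ⟨c, -, -, h⟩ : W (b + 1) := by
      refine hW.induction ?_ hc _
      obtain ⟨c, hc, h⟩ := hB (fun _ => False) (by fun_prop)
      exact ⟨c, hc, fun x _ hx => ((h x).1 hx).2.elim, zero_le⟩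
    exact absurd (h.trans (hle c b)) (not_le.2 (lt_add_one b))
  obtain ⟨j, ⟨c, -, hcP, hj⟩, hmax⟩ := hmax
  have key : ∀ x, x < b ∧ P x ↔ x < b ∧ Elem x c := by
    refine fun x => and_congr_right fun hx => ⟨fun hPx => ?_, hcP x hx⟩
    by_contra hxc
    obtain ⟨c', hc'B, hc'⟩ := hB (fun y => Elem y c ∨ y = x) (by fun_prop)
    refine hmax ⟨c', hc'B, fun y hy hyc => ?_, ?_⟩
    · rcases ((hc' y).1 hyc).2 with h | rfl
      · exact hcP y hy h
      · exact hPx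
    · have : ∀ i, i ≤ b → card (c', i) = if x < i then card (c, i) + 1 else card (c, i) := by
        refine Rec.induction (S := S) (by fun_prop) (by simp [hcard0]) fun i ih hi => ?_
        have hib : i < b := (lt_add_one i).trans_le hi
        rw [hcards, hcards, ih hib.le]
        simp only [hc', lt_add_one_iff']
        rcases lt_trichotomy x i with h | rfl | h
        · simp only [h, h.ne', or_false, hib, true_and, if_true, h.le]
          split_ifs <;> rfl
        · simp [hib, hxc]
        · simp [h.not_gt, h.not_ge, h.ne, hib]
      rw [this b le_rfl, if_pos hx]
      gcongr
  simp only [key]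
  fun_prop

@[fun_prop] protected theorem Rec.proj {f g : α → N} (hf : Rec S f) (hg : Rec S g) :
    Rec S (fun a => proj (f a) (g a)) := by
  classical
  -- `r` is the remainder in the definition of `proj i x`
  let T : N → N → N → Prop := fun i x r => ∃ m < x + 1, ∃ n < x + 1, ∃ q < x + 1, x = pair m n ∧
    n = q * (m * (i + 1) + 1) + r ∧ r < m * (i + 1) + 1
  have hT : Rec S (fun p : (N × N) × N => T p.1.1 p.1.2 p.2) := by simp only [T]; fun_prop
  have hT' : ∀ i x r, T i x r ↔ ∃ m n q : N, x = pair m n ∧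
    n = q * (m * (i + 1) + 1) + r ∧ r < m * (i + 1) + 1 := by
    intro i x r
    constructor
    · rintro ⟨m, -, n, -, q, -, h⟩
      exact ⟨m, n, q, h⟩
    · rintro ⟨m, n, q, rfl, rfl, h⟩
      refine ⟨m, ?_, _, ?_, q, ?_, rfl, rfl, h⟩ <;> rw [lt_add_one_iff']
      · exact left_le_pair _ _
      · exact right_le_pair _ _
      · exact le_trans (le_trans (le_self_mul (lt_of_lt_of_le one_pos le_add_self)) le_self_add)
          (right_le_pair _ _)
  have hu : ∀ i x r r', T i x r → T i x r' → r = r' := by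
    intro i x r r' h h'
    obtain ⟨m, n, q, rfl, rfl, hr⟩ := (hT' _ _ _).1 h
    obtain ⟨m', n', q', h1, h2, hr'⟩ := (hT' _ _ _).1 h'
    obtain ⟨rfl, rfl⟩ := pair_inj.1 h1
    exact mod_unique hr hr' h2
  have key : ∀ i x, proj i x =
      if ∃ r < x + 1, T i x r then muB (x + 1) (T i x) else 0 := by
    intro i x
    have hlt : ∀ r, T i x r → r < x + 1 := by
      intro r hr
      obtain ⟨m, n, q, rfl, rfl, hr⟩ := (hT' _ _ _).1 hr
      exact lt_add_one_iff'.2 (le_add_self.trans (right_le_pair _ _))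
    unfold proj
    simp only [← hT']
    by_cases h : ∃ r, T i x r
    · have h1 : ∃ r < x + 1, T i x r := h.imp fun r hr => ⟨hlt r hr, hr⟩
      rw [dif_pos h, if_pos h1]
      exact hu _ _ _ _ h.choose_spec (muB_spec (S := S) (P := T i x)
        (hT.comp (f := fun p : (N × N) × N => T p.1.1 p.1.2 p.2)
          (g := fun r => ((i, x), r)) (by fun_prop)) h1).2
    · have h1 : ¬ ∃ r < x + 1, T i x r := fun ⟨r, _, hr⟩ => h ⟨r, hr⟩
      rw [dif_neg h, if_neg h1]
  simp only [key]
  fun_prop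

end Prec

/-! ### Definability and determinism of computations -/

section Machines

variable {N : Type*} [CommSemiring N] [LinearOrder N] [IsStrictOrderedRing N]
  [CanonicallyOrderedAdd N] [Discrete N] {S : Set (Set N)} [hS : Model S]
variable {α : Type*} [Ctx N α]

/-- The first component of a pair. -/
noncomputable def pfst (z : N) : N := muB (z + 1) fun i => ∃ j < z + 1, z = pair i j

/-- The second component of a pair. -/
noncomputable def psnd (z : N) : N := muB (z + 1) fun j => ∃ i < z + 1, z = pair i j

theorem muB_eq {b : N} {P : N → Prop} {x : N} (hx : P x) (hb : x < b) (h : ∀ y, P y → y = x) :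
    muB b P = x :=
  mu_eq (.inr hx) fun y hy hy' =>
    hy'.elim (fun h' => absurd (h' ▸ hy) hb.not_gt) (fun h' => hy.ne (h y h'))

theorem pfst_pair (i j : N) : pfst (pair i j) = i := by
  have h1 := pair_eq_bounds (rfl : pair i j = pair i j)
  refine muB_eq ⟨j, h1.2, rfl⟩ h1.1 ?_
  rintro y ⟨j', -, h⟩
  exact (pair_inj.1 h).1.symm

theorem psnd_pair (i j : N) : psnd (pair i j) = j := by
  have h1 := pair_eq_bounds (rfl : pair i j = pair i j)
  refine muB_eq ⟨i, h1.1, rfl⟩ h1.2 ?_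
  rintro y ⟨j', -, h⟩
  exact (pair_inj.1 h).2.symm

@[fun_prop] protected theorem Rec.pfst {f : α → N} (hf : Rec S f) : Rec S (fun a => pfst (f a)) := by
  unfold pfst; fun_prop

@[fun_prop] protected theorem Rec.psnd {f : α → N} (hf : Rec S f) : Rec S (fun a => psnd (f a)) := by
  unfold psnd; fun_prop

open Classical in
/-- The value at `j` of the partial function coded by the finite set `T` of pairs, and `0` if there
is none. -/
noncomputable def lookup (T j : N) : N :=
  if ∃ a < T, Elem (pair j a) T then muB T fun a => Elem (pair j a) T else 0

@[fun_prop] protected theorem Rec.lookup {f g : α → N} (hf : Rec S f) (hg : Rec S g) :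
    Rec S (fun a => lookup (f a) (g a)) := by
  unfold lookup; fun_prop

theorem elem_pair_bounds {i j w : N} (h : Elem (pair i j) w) : i < w ∧ j < w :=
  ⟨(left_le_pair _ _).trans_lt h.lt, (right_le_pair _ _).trans_lt h.lt⟩

theorem lookup_eq {T j a : N} (h : Elem (pair j a) T) (hu : ∀ b, Elem (pair j b) T → b = a) :
    lookup T j = a := by
  unfold lookup
  rw [if_pos ⟨a, (elem_pair_bounds h).2, h⟩]
  exact muB_eq h (elem_pair_bounds h).2 hu

theorem lookup_eq_zero {T j : N} (h : ∀ b, ¬ Elem (pair j b) T) : lookup T j = 0 := by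
  unfold lookup
  rw [if_neg (fun ⟨a, _, h'⟩ => h a h')]

theorem elem_lookup (S : Set (Set N)) [Model S] {T j : N} (h : lookup T j ≠ 0) :
    Elem (pair j (lookup T j)) T := by
  unfold lookup at h ⊢
  by_cases h' : ∃ a < T, Elem (pair j a) T
  · rw [if_pos h']
    exact (muB_spec (S := S) (P := fun a => Elem (pair j a) T) (by fun_prop) h').2
  · rw [if_neg h'] at h
    exact absurd rfl h

theorem lookup_of_le (S : Set (Set N)) [Model S] {T j : N} (h : T ≤ j) : lookup T j = 0 := by
  by_contra h'
  exact absurd (elem_pair_bounds (elem_lookup S h')).1 h.not_gt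

/-- The configuration coded by `c`. -/
noncomputable def cfg (c : N) : Config N where
  state := pfst c
  head := pfst (psnd c)
  tape := lookup (psnd (psnd c))

theorem CodesConfig.cfg_eq {c : N} {C : Config N} (h : CodesConfig c C) : cfg c = C := by
  obtain ⟨T, rfl, hT⟩ := h
  ext j
  · exact pfst_pair _ _
  · simp [cfg, psnd_pair, pfst_pair]
  · simp only [cfg, psnd_pair]
    by_cases h0 : C.tape j = 0
    · rw [h0]
      exact lookup_eq_zero fun b hb => ((hT j b).1 hb).2 (((hT j b).1 hb).1 ▸ h0)
    · exact lookup_eq ((hT j _).2 ⟨rfl, h0⟩) fun b hb => ((hT j b).1 hb).1.symm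

/-- A form of `CodesConfig` in which all quantifiers are bounded. -/
theorem codesConfig_iff (S : Set (Set N)) [Model S] {c d : N} : CodesConfig c (cfg d) ↔
    c = pair (pfst d) (pair (pfst (psnd d)) (psnd (psnd c))) ∧
      ∀ j < c + psnd (psnd d), ∀ a < c + psnd (psnd d),
        Elem (pair j a) (psnd (psnd c)) ↔ lookup (psnd (psnd d)) j = a ∧ a ≠ 0 := by
  constructor
  · rintro ⟨T, rfl, hT⟩
    simp only [psnd_pair]
    exact ⟨rfl, fun j _ a _ => hT j a⟩
  · rintro ⟨h1, h2⟩
    refine ⟨psnd (psnd c), h1, fun j a => ?_⟩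
    have hle : psnd (psnd c) ≤ c := by
      conv_rhs => rw [h1]
      exact (right_le_pair _ _).trans (right_le_pair _ _)
    constructor
    · intro h
      have hb := elem_pair_bounds h
      refine (h2 j ?_ a ?_).1 h
      · exact hb.1.trans_le (hle.trans le_self_add)
      · exact hb.2.trans_le (hle.trans le_self_add)
    · rintro ⟨rfl, h⟩
      have hb := elem_pair_bounds (elem_lookup S h)
      refine (h2 j ?_ _ ?_).2 ⟨rfl, h⟩
      · exact hb.1.trans_le le_add_self
      · exact hb.2.trans_le le_add_self

@[fun_prop] theorem Rec.codesConfig {f g : α → N} (hf : Rec S f) (hg : Rec S g) :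
    Rec S (fun a => CodesConfig (f a) (cfg (g a))) := by
  simp only [codesConfig_iff S]
  fun_prop

@[fun_prop] theorem Rec.isMachine {f : α → N} (hf : Rec S f) : Rec S (fun a => IsMachine (f a)) := by
  have : Rec S (fun a => ∀ u < f a, ∀ v < f a, ∀ v' < f a, Elem (pair u v) (f a) →
    Elem (pair u v') (f a) → v = v') := by fun_prop
  convert this using 3 with a
  constructor
  · exact fun h u _ v _ v' _ => h u v v'
  · exact fun h u v v' hv hv' => h u (elem_pair_bounds hv).1 v (elem_pair_bounds hv).2 v'
      (elem_pair_bounds hv').2 hv hv'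

theorem IsFun.rec {f : N → N} (h : IsFun S f) : Rec S f := by
  unfold IsFun IsFunOn at h
  unfold Rec
  convert h using 1
  ext z
  simp [code_num]

theorem Rec.isFun {f : N → N} (h : Rec S f) : IsFun S f := by
  unfold IsFun IsFunOn
  unfold Rec at h
  convert h using 1
  ext z
  simp [code_num]

protected theorem Rec.oracleBit {f : N → N} (hf : Rec S f) : Rec S (oracleBit f) := by
  classical
  have : Rec S (fun n => if ∃ a < n + 1, n = pair a (f a) then (1 : N) else 0) := by fun_prop
  convert this using 1
  ext n
  unfold oracleBit
  congr 1
  exact propext ⟨fun ⟨a, ha⟩ => ⟨a, (pair_eq_bounds ha).1, ha⟩, fun ⟨a, _, ha⟩ => ⟨a, ha⟩⟩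

/-- Both tapes are blank beyond the codes, so it suffices to compare finitely many cells. -/
theorem initConfig_iff (S : Set (Set N)) [Model S] {c x : N} : cfg c = initConfig x ↔
    pfst c = 0 ∧ pfst (psnd c) = 0 ∧ ∀ j < psnd (psnd c) + x, lookup (psnd (psnd c)) j =
      if j < x then 1 else 0 := by
  constructor
  · intro h
    exact ⟨congrArg Config.state h, congrArg Config.head h,
      fun j _ => congrFun (congrArg Config.tape h) j⟩
  · rintro ⟨h1, h2, h3⟩
    ext j
    · exact h1
    · exact h2
    · by_cases hj : j < psnd (psnd c) + x
      · exact h3 j hj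
      · push Not at hj
        simp only [cfg, initConfig]
        rw [lookup_of_le S (le_self_add.trans hj), if_neg (le_add_self.trans hj).not_gt]

theorem step_iff (S : Set (Set N)) [Model S] {e c c' : N} {f : N → N} : Step e f (cfg c) (cfg c') ↔
    ∃ m < e, Elem (pair (pair (pfst c) (pair (lookup (psnd (psnd c)) (pfst (psnd c)))
      (oracleBit f (pfst (psnd c))))) (pair (pfst c')
        (pair (lookup (psnd (psnd c')) (pfst (psnd c))) m))) e ∧
    (∀ j < psnd (psnd c) + psnd (psnd c'), j ≠ pfst (psnd c) →
      lookup (psnd (psnd c')) j = lookup (psnd (psnd c)) j) ∧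
    ((m = 0 ∧ (pfst (psnd c') + 1 = pfst (psnd c) ∨ (pfst (psnd c) = 0 ∧ pfst (psnd c') = 0))) ∨
      (m ≠ 0 ∧ pfst (psnd c') = pfst (psnd c) + 1)) := by
  constructor
  · rintro ⟨m, h1, h2, h3⟩
    refine ⟨m, ?_, h1, fun j _ => h2 j, h3⟩
    refine lt_of_le_of_lt ?_ (elem_pair_bounds h1).2
    exact (right_le_pair _ _).trans (right_le_pair _ _)
  · rintro ⟨m, -, h1, h2, h3⟩
    refine ⟨m, h1, fun j hj => ?_, h3⟩
    by_cases h : j < psnd (psnd c) + psnd (psnd c')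
    · exact h2 j h hj
    · push Not at h
      simp only [cfg]
      rw [lookup_of_le S (le_self_add.trans h), lookup_of_le S (le_add_self.trans h)]

/-- The machine can make a step if and only if some instruction applies. -/
theorem exists_step_iff {e : N} {f : N → N} {C : Config N} : (∃ C', Step e f C C') ↔
    ∃ q < e, ∃ a < e, ∃ m < e, Elem (pair (pair C.state (pair (C.tape C.head)
      (oracleBit f C.head))) (pair q (pair a m))) e := by
  classical
  constructor
  · rintro ⟨C', m, h, -⟩
    have h1 := (elem_pair_bounds h).2
    refine ⟨_, (left_le_pair _ _).trans_lt h1, _, ?_, m, ?_, h⟩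
    · exact ((left_le_pair _ _).trans (right_le_pair _ _)).trans_lt h1
    · exact ((right_le_pair _ _).trans (right_le_pair _ _)).trans_lt h1
  · rintro ⟨q, -, a, -, m, -, h⟩
    have hmove : ∃ h', (m = 0 ∧ (h' + 1 = C.head ∨ (C.head = 0 ∧ h' = 0))) ∨
        (m ≠ 0 ∧ h' = C.head + 1) := by
      by_cases hm : m = 0
      · by_cases h0 : C.head = 0
        · exact ⟨0, .inl ⟨hm, .inr ⟨h0, rfl⟩⟩⟩
        · obtain ⟨z, hz⟩ := le_iff_exists_add.1 (Discrete.one_le _ (pos_of_ne_zero h0))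
          exact ⟨z, .inl ⟨hm, .inl (by rw [hz, add_comm])⟩⟩
      · exact ⟨_, .inr ⟨hm, rfl⟩⟩
    obtain ⟨h', hh'⟩ := hmove
    refine ⟨⟨q, h', Function.update C.tape C.head a⟩, m, ?_, ?_, hh'⟩
    · simpa using h
    · intro j hj
      simp [hj]

/-- The code of the configuration at time `t` of the computation coded by `w`. -/
noncomputable def cfgCode (w t : N) : N := muB w fun c => Elem (pair t c) w

@[fun_prop] protected theorem Rec.cfgCode {f g : α → N} (hf : Rec S f) (hg : Rec S g) :
    Rec S (fun a => cfgCode (f a) (g a)) := by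
  unfold cfgCode; fun_prop

/-- The number `w` codes a halting computation of `s` steps with value `y`. -/
def Computes (f : N → N) (e x y s w : N) : Prop :=
  (∀ t < s + 1, (∃ c < w, Elem (pair t c) w) ∧
    ∀ c < w, Elem (pair t c) w → CodesConfig c (cfg (cfgCode w t))) ∧
  cfg (cfgCode w 0) = initConfig x ∧
  (∀ t < s, Step e f (cfg (cfgCode w t)) (cfg (cfgCode w (t + 1)))) ∧
  (¬ ∃ C' : Config N, Step e f (cfg (cfgCode w s)) C') ∧
  (∀ j < y, (cfg (cfgCode w s)).tape j = 1) ∧ (cfg (cfgCode w s)).tape y ≠ 1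

/-- The configurations of a computation can be read off from its code. -/
theorem phi_iff (S : Set (Set N)) [Model S] {e x y : N} {f : N → N} :
    Phi e f x y ↔ IsMachine e ∧ ∃ s w, Computes f e x y s w := by
  refine and_congr_right fun _ => exists_congr fun s => exists_congr fun w => ?_
  constructor
  · rintro ⟨C, h1, h2, h3, h4, h5, h6⟩
    have hC : ∀ t ≤ s, cfg (cfgCode w t) = C t := by
      intro t ht
      obtain ⟨⟨c, hc⟩, h⟩ := h1 t ht
      refine CodesConfig.cfg_eq (h _ (muB_spec (S := S) (P := fun c => Elem (pair t c) w)
        (by fun_prop) ⟨c, (elem_pair_bounds hc).2, hc⟩).2)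
    refine ⟨fun t ht => ?_, ?_, fun t ht => ?_, ?_⟩
    · rw [lt_add_one_iff'] at ht
      obtain ⟨⟨c, hc⟩, h⟩ := h1 t ht
      refine ⟨⟨c, (elem_pair_bounds hc).2, hc⟩, fun c' _ hc' => ?_⟩
      rw [hC t ht]
      exact h c' hc'
    · rw [hC 0 zero_le, h2]
    · rw [hC t ht.le, hC _ (add_one_le_iff_lt.2 ht)]
      exact h3 t ht
    · rw [hC s le_rfl]
      exact ⟨h4, h5, h6⟩
  · rintro ⟨h1, h2⟩
    refine ⟨fun t => cfg (cfgCode w t), fun t ht => ?_, h2⟩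
    obtain ⟨⟨c, -, hc⟩, h⟩ := h1 t (lt_add_one_iff'.2 ht)
    exact ⟨⟨c, hc⟩, fun c' hc' => h c' (elem_pair_bounds hc').2 hc'⟩

theorem Rec.computes {f : N → N} (hf : Rec S f) :
    Rec S (fun p : (((N × N) × N) × N) × N =>
      Computes f p.1.1.1.1 p.1.1.1.2 p.1.1.2 p.1.2 p.2) := by
  have hb := Rec.oracleBit hf
  unfold Computes
  simp only [initConfig_iff S, step_iff S, exists_step_iff]
  simp only [cfg]
  refine .and ?_ (.and ?_ (.and ?_ (.and ?_ (.and ?_ ?_))))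
  · fun_prop
  · fun_prop
  · fun_prop
  · fun_prop
  · fun_prop
  · fun_prop

/-- The universal function is recursively enumerable in the oracle. -/
theorem Sig.phi {f : N → N} (hf : Rec S f) :
    Sig S (fun p : (N × N) × N => Phi p.1.1 f p.1.2 p.2) := by
  simp only [phi_iff S]
  have h : Rec S (fun p : (N × N) × N => IsMachine p.1.1) := by fun_prop
  exact h.sig.and (.exist (.exist (Rec.computes hf).sig))

theorem Step.unique {e : N} {f : N → N} (he : IsMachine e) {C C₁ C₂ : Config N}
    (h1 : Step e f C C₁) (h2 : Step e f C C₂) : C₁ = C₂ := by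
  obtain ⟨m, h1, h1', h1''⟩ := h1
  obtain ⟨m', h2, h2', h2''⟩ := h2
  have h := he _ _ _ h1 h2
  simp only [pair_inj] at h
  obtain ⟨hs, ht, rfl⟩ := h
  ext j
  · exact hs
  · rcases h1'' with ⟨hm, ha⟩ | ⟨hm, ha⟩
    · have hb := (h2''.resolve_right fun h => h.1 hm).2
      rcases ha with ha | ⟨ha, ha'⟩
      · rcases hb with hb | ⟨hb, -⟩
        · exact add_right_cancel (ha.trans hb.symm)
        · rw [hb] at ha
          exact absurd ha (lt_of_lt_of_le one_pos le_add_self).ne'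
      · rcases hb with hb | ⟨-, hb⟩
        · rw [ha] at hb
          exact absurd hb (lt_of_lt_of_le one_pos le_add_self).ne'
        · rw [ha', hb]
    · rw [ha, (h2''.resolve_left fun h => hm h.1).2]
  · by_cases hj : j = C.head
    · rw [hj]; exact ht
    · rw [h1' j hj, h2' j hj]

theorem cfg_eq_iff (S : Set (Set N)) [Model S] {c c' : N} : cfg c = cfg c' ↔ pfst c = pfst c' ∧
    pfst (psnd c) = pfst (psnd c') ∧ ∀ j < psnd (psnd c) + psnd (psnd c'),
      lookup (psnd (psnd c)) j = lookup (psnd (psnd c')) j := by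
  constructor
  · intro h
    exact ⟨congrArg Config.state h, congrArg Config.head h,
      fun j _ => congrFun (congrArg Config.tape h) j⟩
  · rintro ⟨h1, h2, h3⟩
    ext j
    · exact h1
    · exact h2
    · by_cases hj : j < psnd (psnd c) + psnd (psnd c')
      · exact h3 j hj
      · push Not at hj
        simp only [cfg]
        rw [lookup_of_le S (le_self_add.trans hj), lookup_of_le S (le_add_self.trans hj)]

/-- Computations are deterministic. -/
theorem Phi.unique (S : Set (Set N)) [Model S] {e x y y' : N} {f : N → N} (h : Phi e f x y)
    (h' : Phi e f x y') : y = y' := by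
  obtain ⟨he, s, w, hw⟩ := (phi_iff S).1 h
  obtain ⟨-, s', w', hw'⟩ := (phi_iff S).1 h'
  have key : ∀ {y y' s w s' w'}, s ≤ s' → Computes f e x y s w → Computes f e x y' s' w' →
      y ≤ y' ∧ y' ≤ y := by
    rintro y y' s w s' w' hs ⟨-, h2, h3, h4, h5, h6⟩ ⟨-, h2', h3', h4', h5', h6'⟩
    have heq : ∀ t, t ≤ s → cfg (cfgCode w t) = cfg (cfgCode w' t) := by
      refine Rec.induction (S := S) ?_ (fun _ => h2.trans h2'.symm) fun t ih ht => ?_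
      · simp only [cfg_eq_iff S]; fun_prop
      · have hts : t < s := (lt_add_one t).trans_le ht
        have h7 := h3 t hts
        rw [ih hts.le] at h7
        exact h7.unique he (h3' t (hts.trans_le hs))
    have hss : s = s' := by
      by_contra hne
      exact h4 ⟨_, heq s le_rfl ▸ h3' s (lt_of_le_of_ne hs hne)⟩
    subst hss
    rw [heq s le_rfl] at h5 h6
    constructor
    · by_contra! hlt
      exact h6' (h5 _ hlt)
    · by_contra! hlt
      exact h6 (h5' _ hlt)
  rcases le_total s s' with hs | hs
  · exact le_antisymm (key hs hw hw').1 (key hs hw hw').2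
  · exact le_antisymm (key hs hw' hw).2 (key hs hw' hw).1

end Machines

/-! ### Graphs and classes of graphs -/

section Graphs

variable {N : Type*} [CommSemiring N] [LinearOrder N] [IsStrictOrderedRing N]
  [CanonicallyOrderedAdd N] [Discrete N] {S : Set (Set N)} [hS : Model S]
variable {α : Type*} [Ctx N α]

theorem IsGraph.rec_verts {G : RawGraph N} (h : IsGraph S G) : Rec S (fun u => u ∈ G.verts) :=
  rec_mem h.verts_mem

theorem IsGraph.rec_adj {G : RawGraph N} (h : IsGraph S G) :
    Rec S (fun p : N × N => G.Adj p.1 p.2) := by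
  have := (rec_mem h.edges_mem).comp (g := fun p : N × N => pair p.1 p.2) (by fun_prop)
  convert this using 2 with p
  constructor
  · exact fun h => ⟨_, _, rfl, h⟩
  · rintro ⟨u, v, h, h'⟩
    obtain ⟨h1, h2⟩ := pair_inj.1 h
    rwa [h1, h2]

theorem isGraph_of_rec {G : RawGraph N} (hV : Rec S (fun u => u ∈ G.verts))
    (hE : Rec S (fun p : N × N => G.Adj p.1 p.2))
    (h1 : ∀ u v : N, G.Adj u v → u ∈ G.verts ∧ v ∈ G.verts)
    (h2 : ∀ u v : N, G.Adj u v → G.Adj v u) (h3 : ∀ u : N, ¬ G.Adj u u) : IsGraph S G where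
  verts_mem := hV.setOf_mem
  edges_mem := by
    have : Rec S (fun z => ∃ u < z + 1, ∃ v < z + 1, z = pair u v ∧ G.Adj u v) := by fun_prop
    convert this.setOf_mem using 1
    ext z
    constructor
    · rintro ⟨u, v, h, h'⟩
      exact ⟨u, (pair_eq_bounds h).1, v, (pair_eq_bounds h).2, h, h'⟩
    · rintro ⟨u, -, v, -, h⟩
      exact ⟨u, v, h⟩
  adj_verts := h1
  symm := h2
  irrefl := h3

theorem IsGraph.induce {G : RawGraph N} (h : IsGraph S G) {W : Set N} (hW : W ∈ S) :
    IsGraph S (G.induce W) := by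
  have h1 := h.rec_verts
  have h2 := h.rec_adj
  have h3 := rec_mem hW
  refine isGraph_of_rec ?_ ?_ ?_ ?_ ?_
  · have : Rec S (fun u => u ∈ G.verts ∧ u ∈ W) := by fun_prop
    exact this
  · have h4 : Rec S (fun p : N × N => p.1 ∈ W) := h3.comp (g := fun p : N × N => p.1) (by fun_prop)
    have h5 : Rec S (fun p : N × N => p.2 ∈ W) := h3.comp (g := fun p : N × N => p.2) (by fun_prop)
    exact h2.and (h4.and h5)
  · rintro u v ⟨ha, hu, hv⟩
    exact ⟨⟨(h.adj_verts u v ha).1, hu⟩, ⟨(h.adj_verts u v ha).2, hv⟩⟩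
  · rintro u v ⟨ha, hu, hv⟩
    exact ⟨h.symm u v ha, hv, hu⟩
  · rintro u ⟨ha, -⟩
    exact h.irrefl u ha

theorem induce_induce (G : RawGraph N) {W W' : Set N} (h : W' ⊆ W) :
    (G.induce W).induce W' = G.induce W' := by
  ext u
  · exact ⟨fun ⟨⟨h1, _⟩, h2⟩ => ⟨h1, h2⟩, fun ⟨h1, h2⟩ => ⟨⟨h1, h h2⟩, h2⟩⟩
  · exact ⟨fun ⟨⟨h1, _⟩, h2⟩ => ⟨h1, h2⟩, fun ⟨h1, h2⟩ => ⟨⟨h1, h h2.1, h h2.2⟩, h2⟩⟩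

/-- A graph belongs to the class if all its finite induced subgraphs do. -/
theorem inClass_of_bounded {K : Set N} {G : RawGraph N} (hG : IsGraph S G)
    (h : ∀ W ∈ S, W ⊆ G.verts → (∃ b : N, ∀ x ∈ W, x < b) → InClass S K (G.induce W)) :
    InClass S K G := by
  refine ⟨hG, fun W hW hsub hb => ?_⟩
  rw [← induce_induce G (subset_refl W)]
  exact (h W hW hsub hb).2 W hW (fun x hx => ⟨hsub hx, hx⟩) hb

/-- The finite function coded by `t` is an isomorphism. -/
def IsoVia (t : N) (G G' : RawGraph N) : Prop :=
  Set.BijOn (lookup t) G.verts G'.verts ∧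
    ∀ u ∈ G.verts, ∀ v ∈ G.verts, G.Adj u v ↔ G'.Adj (lookup t u) (lookup t v)

/-- An isomorphism from a finite graph is coded by a number, since its values are bounded by
collection. -/
theorem isomorphic_iff {G G' : RawGraph N} (hV : G.verts ∈ S) (hb : ∃ b, ∀ u ∈ G.verts, u < b) :
    Isomorphic S G G' ↔ ∃ t, IsoVia t G G' := by
  have hV' := rec_mem hV
  obtain ⟨b, hb⟩ := hb
  constructor
  · rintro ⟨φ, hφ, hbij, hadj⟩
    have hφ' := rec_mem hφ
    obtain ⟨z, hz⟩ := Rec.collection (S := S) (P := fun x y => x ∈ G.verts →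
      pair x y ∈ {p : N | ∃ v ∈ G.verts, p = pair v (φ v)})
      ((hV'.comp (g := fun p : N × N => p.1) (by fun_prop)).imp
        (hφ'.comp (g := fun p : N × N => pair p.1 p.2) (by fun_prop))) b
        (fun x _ => ⟨φ x, fun hx => ⟨x, hx, rfl⟩⟩)
    obtain ⟨t, ht⟩ := exists_code (pair b z) hφ'
    have key : ∀ u ∈ G.verts, lookup t u = φ u := by
      intro u hu
      refine lookup_eq ((ht _).2 ⟨?_, u, hu, rfl⟩) ?_
      · obtain ⟨y, hy, hy'⟩ := hz u (hb u hu)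
        obtain ⟨v, -, hv⟩ := hy' hu
        obtain ⟨rfl, rfl⟩ := pair_inj.1 hv
        exact pair_lt_pair_of_add_lt (add_lt_add (hb u hu) hy)
      · rintro y hy
        obtain ⟨v, -, hv⟩ := ((ht _).1 hy).2
        obtain ⟨rfl, rfl⟩ := pair_inj.1 hv
        rfl
    refine ⟨t, hbij.congr fun u hu => (key u hu).symm, fun u hu v hv => ?_⟩
    rw [key u hu, key v hv]
    exact hadj u hu v hv
  · rintro ⟨t, hbij, hadj⟩
    refine ⟨lookup t, ?_, hbij, hadj⟩
    have : Rec S (fun z => ∃ v < z + 1, v ∈ G.verts ∧ z = pair v (lookup t v)) := by fun_prop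
    unfold IsFunOn
    convert this.setOf_mem using 1
    ext z
    constructor
    · rintro ⟨v, hv, h⟩
      exact ⟨v, (pair_eq_bounds h).1, hv, h⟩
    · rintro ⟨v, -, h⟩
      exact ⟨v, h⟩

theorem mem_decodeGraph {a b u : N} : u ∈ (decodeGraph (pair a b)).verts ↔ Elem u a := by
  constructor
  · rintro ⟨a', b', h, h'⟩
    obtain ⟨rfl, rfl⟩ := pair_inj.1 h
    exact h'
  · exact fun h => ⟨a, b, rfl, h⟩

theorem adj_decodeGraph {a b u v : N} :
    (decodeGraph (pair a b)).Adj u v ↔ Elem (pair u v) b := by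
  constructor
  · rintro ⟨a', b', h, h'⟩
    obtain ⟨rfl, rfl⟩ := pair_inj.1 h
    exact h'
  · exact fun h => ⟨a, b, rfl, h⟩

/-- Vertices of a coded graph, as a relation. -/
def CVert (c u : N) : Prop := u ∈ (decodeGraph c).verts

/-- Adjacency in a coded graph, as a relation. -/
def CAdj (c u v : N) : Prop := (decodeGraph c).Adj u v

theorem CVert.lt {c u : N} (h : CVert c u) : u < c := by
  obtain ⟨a, b, rfl, h⟩ := h
  exact h.lt.trans_le (left_le_pair _ _)

@[fun_prop] protected theorem Rec.cVert {f g : α → N} (hf : Rec S f) (hg : Rec S g) :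
    Rec S (fun a => CVert (f a) (g a)) := by
  have : Rec S (fun p => ∃ a < f p + 1, ∃ b < f p + 1, f p = pair a b ∧ Elem (g p) a) := by fun_prop
  convert this using 3 with p
  constructor
  · rintro ⟨a, b, h, h'⟩
    exact ⟨a, (pair_eq_bounds h).1, b, (pair_eq_bounds h).2, h, h'⟩
  · rintro ⟨a, -, b, -, h⟩
    exact ⟨a, b, h⟩

@[fun_prop] protected theorem Rec.cAdj {f g h : α → N} (hf : Rec S f) (hg : Rec S g)
    (hh : Rec S h) : Rec S (fun a => CAdj (f a) (g a) (h a)) := by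
  have : Rec S (fun p => ∃ a < f p + 1, ∃ b < f p + 1, f p = pair a b ∧
    Elem (pair (g p) (h p)) b) := by fun_prop
  convert this using 3 with p
  constructor
  · rintro ⟨a, b, h, h'⟩
    exact ⟨a, (pair_eq_bounds h).1, b, (pair_eq_bounds h).2, h, h'⟩
  · rintro ⟨a, -, b, -, h⟩
    exact ⟨a, b, h⟩

/-- Every finite graph of the model has a code. -/
theorem exists_decodeGraph_eq {G : RawGraph N} (hG : IsGraph S G) {b : N}
    (hb : ∀ u ∈ G.verts, u < b) : ∃ c, decodeGraph c = G := by
  obtain ⟨a, ha⟩ := exists_code b hG.rec_verts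
  obtain ⟨e, he⟩ := exists_code (pair b b) (rec_mem hG.edges_mem)
  refine ⟨pair a e, ?_⟩
  ext u v
  · rw [mem_decodeGraph, ha]
    exact ⟨fun h => h.2, fun h => ⟨hb u h, h⟩⟩
  · rw [adj_decodeGraph, he]
    constructor
    · rintro ⟨-, u', v', h, h'⟩
      obtain ⟨rfl, rfl⟩ := pair_inj.1 h
      exact h'
    · intro h
      have := hG.adj_verts u v h
      exact ⟨pair_lt_pair_of_add_lt (add_lt_add (hb u this.1) (hb v this.2)), u, v, rfl, h⟩

/-- Membership of finite graphs in the class is recursively enumerable, uniformly for recursive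
families of graphs on recursively bounded sets of vertices. -/
theorem Sig.inClass {K : Set N} (hK : K ∈ S) {G : α → RawGraph N} {b : α → N} (hb : Rec S b)
    (hG : ∀ a, IsGraph S (G a)) (hlt : ∀ a, ∀ u ∈ (G a).verts, u < b a)
    (hV : Rec S (fun p : α × N => p.2 ∈ (G p.1).verts))
    (hE : Rec S (fun p : (α × N) × N => (G p.1.1).Adj p.1.2 p.2)) :
    Sig S (fun a => InClass S K (G a)) := by
  obtain ⟨β, hβ, hcode⟩ := exists_code_bound S
  have hK' := rec_mem hK
  -- the finite function `t` is an isomorphism from the subgraph induced on `W` to the graph `c`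
  let I : (α × N) × N → N → Prop := fun p t =>
    (∀ u < b p.1.1, Elem u p.1.2 → CVert p.2 (lookup t u)) ∧
    (∀ u < b p.1.1, Elem u p.1.2 → ∀ v < b p.1.1, Elem v p.1.2 → lookup t u = lookup t v → u = v) ∧
    (∀ v < p.2, CVert p.2 v → ∃ u < b p.1.1, Elem u p.1.2 ∧ lookup t u = v) ∧
    (∀ u < b p.1.1, Elem u p.1.2 → ∀ v < b p.1.1, Elem v p.1.2 →
      ((G p.1.1).Adj u v ↔ CAdj p.2 (lookup t u) (lookup t v)))
  have hI : Rec S (fun q : ((α × N) × N) × N => I q.1 q.2) := by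
    have h4 : Rec S (fun q : ((((α × N) × N) × N) × N) × N =>
        (G q.1.1.1.1.1).Adj q.1.2 q.2) :=
      hE.comp (g := fun q : ((((α × N) × N) × N) × N) × N => ((q.1.1.1.1.1, q.1.2), q.2))
        (by fun_prop)
    simp only [I]
    refine .and ?_ (.and ?_ (.and ?_ ?_))
    · fun_prop
    · fun_prop
    · fun_prop
    · refine .ball (by fun_prop) (.imp (by fun_prop) (.ball (by fun_prop) (.imp (by fun_prop)
        (.iff h4 (by fun_prop)))))
  have key : ∀ a, InClass S K (G a) ↔ ∀ W < β (b a), (∀ x < W, Elem x W → x ∈ (G a).verts) →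
      ∃ c, c ∈ K ∧ ∃ t, I ((a, W), c) t := by
    intro a
    have hiso : ∀ W c, (∀ x, Elem x W → x ∈ (G a).verts) →
        (Isomorphic S ((G a).induce {x | Elem x W}) (decodeGraph c) ↔ ∃ t, I ((a, W), c) t) := by
      intro W c hW
      have hWS : {x | Elem x W} ∈ S := Rec.setOf_mem (by fun_prop)
      rw [isomorphic_iff ((hG a).induce hWS).verts_mem ⟨b a, fun u hu => hlt a u hu.1⟩]
      refine exists_congr fun t => ?_
      constructor
      · rintro ⟨⟨h1, h2, h3⟩, h4⟩
        have hmem : ∀ {u}, Elem u W → u ∈ ((G a).induce {x | Elem x W}).verts := fun {u} hu =>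
          ⟨hW u hu, hu⟩
        refine ⟨fun u _ hu => h1 (hmem hu), fun u _ hu v _ hv h => h2 (hmem hu) (hmem hv) h,
          fun v _ hv => ?_, fun u _ hu v _ hv => ?_⟩
        · obtain ⟨u, hu, hu'⟩ := h3 hv
          exact ⟨u, hlt a u hu.1, hu.2, hu'⟩
        · rw [CAdj, ← h4 u (hmem hu) v (hmem hv)]
          exact ⟨fun h => ⟨h, hu, hv⟩, fun h => h.1⟩
      · rintro ⟨h1, h2, h3, h4⟩
        refine ⟨⟨fun u hu => h1 u (hlt a u hu.1) hu.2, fun u hu v hv h =>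
          h2 u (hlt a u hu.1) hu.2 v (hlt a v hv.1) hv.2 h, fun v hv => ?_⟩, fun u hu v hv => ?_⟩
        · obtain ⟨u, -, hu, hu'⟩ := h3 v (CVert.lt hv) hv
          exact ⟨u, ⟨hW u hu, hu⟩, hu'⟩
        · refine Iff.trans ?_ (h4 u (hlt a u hu.1) hu.2 v (hlt a v hv.1) hv.2)
          exact ⟨fun h => h.1, fun h => ⟨h, hu.2, hv.2⟩⟩
    constructor
    · intro h W _ hW
      have hW' : ∀ x, Elem x W → x ∈ (G a).verts := fun x hx => hW x hx.lt hx
      obtain ⟨c, hc, hc'⟩ := h.2 {x | Elem x W} (Rec.setOf_mem (by fun_prop)) hW'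
        ⟨b a, fun x hx => hlt a x (hW' x hx)⟩
      exact ⟨c, hc, (hiso W c hW').1 hc'⟩
    · intro h
      refine ⟨hG a, fun W hW hsub _ => ?_⟩
      obtain ⟨w, hw, hw'⟩ := hcode (b a) _ (rec_mem hW)
      have hWw : W = {x | Elem x w} := by
        ext x
        simp only [Set.mem_ofPred_eq, hw']
        exact ⟨fun hx => ⟨hlt a x (hsub hx), hx⟩, fun hx => hx.2⟩
      have hsub' : ∀ x, Elem x w → x ∈ (G a).verts := fun x hx => hsub ((hw' x).1 hx).2
      obtain ⟨c, hc, hc'⟩ := h w hw fun x _ => hsub' x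
      rw [hWw]
      exact ⟨c, hc, (hiso w c hsub').2 hc'⟩
  simp only [key]
  refine .ball (by fun_prop) (.imp ?_ (.exist (.and ?_ (.exist hI.sig))))
  · refine .ball (by fun_prop) (.imp (by fun_prop) ?_)
    exact hV.comp (g := fun q : (α × N) × N => (q.1.1, q.2)) (by fun_prop)
  · exact (hK'.comp (g := fun q : (α × N) × N => q.2) (by fun_prop)).sig

/-- The class is closed under embeddings that belong to the model. -/
theorem InClass.of_embedding {K : Set N} {G G' : RawGraph N} (hG' : InClass S K G')
    (hG : IsGraph S G) {ψ : N → N} (hψ : Rec S ψ) (hmaps : ∀ u ∈ G.verts, ψ u ∈ G'.verts)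
    (hinj : ∀ u ∈ G.verts, ∀ v ∈ G.verts, ψ u = ψ v → u = v)
    (hadj : ∀ u ∈ G.verts, ∀ v ∈ G.verts, G.Adj u v ↔ G'.Adj (ψ u) (ψ v)) : InClass S K G := by
  refine ⟨hG, fun W hW hsub ⟨b, hb⟩ => ?_⟩
  have hW' := rec_mem hW
  have himage : Rec S (fun y => ∃ x < b, x ∈ W ∧ ψ x = y) := by fun_prop
  obtain ⟨z, hz⟩ := Rec.collection (S := S) (P := fun x y => y = ψ x) (by fun_prop) b
    fun x _ => ⟨_, rfl⟩
  have hzlt : ∀ x < b, ψ x < z := by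
    intro x hx
    obtain ⟨y, hy, rfl⟩ := hz x hx
    exact hy
  obtain ⟨c, hc, hiso⟩ := hG'.2 {y | ∃ x < b, x ∈ W ∧ ψ x = y} himage.setOf_mem
    (by rintro _ ⟨x, -, hx, rfl⟩; exact hmaps x (hsub hx))
    ⟨z, by rintro _ ⟨x, hx, -, rfl⟩; exact hzlt x hx⟩
  refine ⟨c, hc, ?_⟩
  rw [isomorphic_iff (hG'.1.induce himage.setOf_mem).verts_mem
    ⟨z, by rintro _ ⟨-, x, hx, -, rfl⟩; exact hzlt x hx⟩] at hiso
  obtain ⟨t, ⟨h1, h2, h3⟩, h4⟩ := hiso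
  have hmem : ∀ u ∈ W, ψ u ∈ (G'.induce {y | ∃ x < b, x ∈ W ∧ ψ x = y}).verts := fun u hu =>
    ⟨hmaps u (hsub hu), u, hb u hu, hu, rfl⟩
  refine ⟨fun u => lookup t (ψ u), ?_, ⟨fun u hu => h1 (hmem u hu.2), fun u hu v hv h => ?_,
    fun v hv => ?_⟩, fun u hu v hv => ?_⟩
  · have hV := hG.rec_verts
    have : Rec S (fun z => ∃ v < z + 1, (v ∈ G.verts ∧ v ∈ W) ∧ z = pair v (lookup t (ψ v))) := by
      fun_prop
    unfold IsFunOn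
    convert this.setOf_mem using 1
    ext z
    constructor
    · rintro ⟨v, hv, h⟩
      exact ⟨v, (pair_eq_bounds h).1, hv, h⟩
    · rintro ⟨v, -, h⟩
      exact ⟨v, h⟩
  · exact hinj u hu.1 v hv.1 (h2 (hmem u hu.2) (hmem v hv.2) h)
  · obtain ⟨_, ⟨-, x, hx, hxW, rfl⟩, rfl⟩ := h3 hv
    exact ⟨x, ⟨hsub hxW, hxW⟩, rfl⟩
  · rw [← h4 _ (hmem u hu.2) _ (hmem v hv.2)]
    constructor
    · rintro ⟨h, -⟩
      exact ⟨(hadj u hu.1 v hv.1).1 h, (hmem u hu.2).2, (hmem v hv.2).2⟩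
    · rintro ⟨h, -⟩
      exact ⟨(hadj u hu.1 v hv.1).2 h, hu.2, hv.2⟩

end Graphs

/-! ### Strategies in the coloring game -/

section Game

variable {N : Type*} [CommSemiring N] [LinearOrder N] [IsStrictOrderedRing N]
  [CanonicallyOrderedAdd N] [Discrete N] {S : Set (Set N)} [hS : Model S]
variable {α : Type*} [Ctx N α]

/-- Adjacency in the graph with the set `E` of edges, made symmetric and irreflexive. -/
def SEdge (E u v : N) : Prop := u ≠ v ∧ (Elem (pair u v) E ∨ Elem (pair v u) E)

theorem SEdge.symm {E u v : N} (h : SEdge E u v) : SEdge E v u := ⟨h.1.symm, h.2.symm⟩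

@[fun_prop] protected theorem Rec.sEdge {f g h : α → N} (hf : Rec S f) (hg : Rec S g)
    (hh : Rec S h) : Rec S (fun a => SEdge (f a) (g a) (h a)) := by
  unfold SEdge; fun_prop

/-- The graph on `0, …, i` with the set `E` of edges. -/
def gameGraph (i E : N) : RawGraph N where
  verts := {u | u ≤ i}
  Adj := fun u v => u ≤ i ∧ v ≤ i ∧ SEdge E u v

theorem isGraph_gameGraph (i E : N) : IsGraph S (gameGraph i E) := by
  refine isGraph_of_rec ?_ ?_ (fun u v h => ⟨h.1, h.2.1⟩) (fun u v h => ⟨h.2.1, h.1, h.2.2.symm⟩)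
    (fun u h => h.2.2.1 rfl)
  · have : Rec S (fun u => u ≤ i) := by fun_prop
    exact this
  · have : Rec S (fun p : N × N => p.1 ≤ i ∧ p.2 ≤ i ∧ SEdge E p.1 p.2) := by fun_prop
    exact this

/-- A position `⟨i, E, C⟩` of the game, after the move of Player `∀` in round `i`: the edges of the
graph on `0, …, i` are coded by `E`, and the colors of the vertices `0, …, i - 1` by `C`. This is
the number `i` of the round. -/
noncomputable def lev (r : N) : N := pfst r
/-- The code of the edges in a position. -/
noncomputable def edg (r : N) : N := pfst (psnd r)
/-- The code of the coloring in a position. -/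
noncomputable def clr (r : N) : N := psnd (psnd r)

theorem lev_pair (i E C : N) : lev (pair i (pair E C)) = i := pfst_pair _ _
theorem edg_pair (i E C : N) : edg (pair i (pair E C)) = E := by simp [edg, psnd_pair, pfst_pair]
theorem clr_pair (i E C : N) : clr (pair i (pair E C)) = C := by simp [clr, psnd_pair]

@[fun_prop] protected theorem Rec.lev {f : α → N} (hf : Rec S f) : Rec S (fun a => lev (f a)) := by
  unfold RevMath.lev; fun_prop
@[fun_prop] protected theorem Rec.edg {f : α → N} (hf : Rec S f) : Rec S (fun a => edg (f a)) := by
  unfold RevMath.edg; fun_prop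
@[fun_prop] protected theorem Rec.clr {f : α → N} (hf : Rec S f) : Rec S (fun a => clr (f a)) := by
  unfold RevMath.clr; fun_prop

/-- The position `r'` arises from `r` if Player `∃` plays the color `c` and Player `∀` adds one more
vertex. -/
def Ext (k r c r' : N) : Prop :=
  lev r' = lev r + 1 ∧
  (∀ u < lev r + 1, ∀ v < lev r + 1, SEdge (edg r) u v ↔ SEdge (edg r') u v) ∧
  (∀ u < lev r, ∀ a < k, Elem (pair u a) (clr r) ↔ Elem (pair u a) (clr r')) ∧
  ∀ a < k, Elem (pair (lev r) a) (clr r') ↔ a = c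

/-- In the position `r` continued by the color `c`, the vertex `u` has color `a`. -/
def HasColor (r c u a : N) : Prop := (u < lev r ∧ Elem (pair u a) (clr r)) ∨ (u = lev r ∧ a = c)

/-- The coloring in the position `r` continued by the color `c` is not proper. -/
def BadEnd (k r c : N) : Prop :=
  ∃ u < lev r + 1, ∃ v < lev r + 1, SEdge (edg r) u v ∧ ∃ a < k, HasColor r c u a ∧ HasColor r c v a

@[fun_prop] protected theorem Rec.ext {f g h l : α → N} (hf : Rec S f) (hg : Rec S g)
    (hh : Rec S h) (hl : Rec S l) : Rec S (fun a => Ext (f a) (g a) (h a) (l a)) := by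
  unfold Ext; fun_prop

@[fun_prop] protected theorem Rec.badEnd {f g h : α → N} (hf : Rec S f) (hg : Rec S g)
    (hh : Rec S h) : Rec S (fun a => BadEnd (f a) (g a) (h a)) := by
  unfold BadEnd HasColor; fun_prop

/-- The graph of the position `r` belongs to the class. -/
def Legal (S : Set (Set N)) (K : Set N) (r : N) : Prop := InClass S K (gameGraph (lev r) (edg r))

theorem Sig.legal {K : Set N} (hK : K ∈ S) : Sig S (Legal S K) := by
  have : Sig S (fun r => InClass S K (gameGraph (lev r) (edg r))) := by
    refine Sig.inClass hK (b := fun r => lev r + 1) (by fun_prop) (fun r => isGraph_gameGraph _ _)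
      (fun r u hu => lt_add_one_iff'.2 hu) ?_ ?_
    · have : Rec S (fun p : N × N => p.2 ≤ lev p.1) := by fun_prop
      exact this
    · have : Rec S (fun p : (N × N) × N => p.1.2 ≤ lev p.1.1 ∧ p.2 ≤ lev p.1.1 ∧
        SEdge (edg p.1.1) p.1.2 p.2) := by fun_prop
      exact this
  exact this

/-- The finite set coded by `w` is a winning strategy of Player `∀` in the game with `d` rounds and
`k` colors, as the set of the positions that occur if he follows the strategy. The coloring that is
stored in the initial position is irrelevant, as there are no vertices before the first. -/
def IsStrategy (S : Set (Set N)) (K : Set N) (d k w : N) : Prop :=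
  (∃ r < w, Elem r w ∧ lev r = 0) ∧ ∀ r < w, Elem r w → lev r < d ∧ Legal S K r ∧
    ∀ c < k, (lev r + 1 = d ∧ BadEnd k r c) ∨ ∃ r' < w, Elem r' w ∧ Ext k r c r'

theorem Sig.isStrategy {K : Set N} (hK : K ∈ S) {f g h : α → N} (hf : Rec S f) (hg : Rec S g)
    (hh : Rec S h) : Sig S (fun a => IsStrategy S K (f a) (g a) (h a)) := by
  unfold IsStrategy
  refine .and (Rec.sig (by fun_prop)) (.ball (by fun_prop) (.imp (by fun_prop) (.and
    (Rec.sig (by fun_prop)) (.and ((Sig.legal hK).comp (by fun_prop)) (Rec.sig (by fun_prop))))))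

theorem existsWins_zero (K : Set N) (k : N) : ExistsWins S K 0 k := by
  have h : Rec S (fun _ : N => (0 : N)) := by fun_prop
  refine ⟨fun _ => 0, h.isFun, fun G hG => ⟨fun v hv => ?_, fun u v huv => ?_⟩⟩
  · rw [hG.2.1] at hv
    exact (not_lt_zero hv).elim
  · have := (hG.1.adj_verts u v huv).1
    rw [hG.2.1] at this
    exact (not_lt_zero this).elim

/-- The set of the positions below `R` from which Player `∀` wins: a recursive set that satisfies
the recursive definition of the winning positions. It is the union of all coded sets of positions
in which every position is justified by others. -/
theorem exists_winning_set {K : Set N} (hK : K ∈ S) (d k R : N) : ∃ Win : N → Prop, Rec S Win ∧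
    ∀ r, Win r ↔ r < R ∧ lev r < d ∧ Legal S K r ∧
      ∀ c < k, (lev r + 1 = d ∧ BadEnd k r c) ∨ ∃ r' < R, Win r' ∧ Ext k r c r' := by
  obtain ⟨B, hB⟩ := exists_code_lt S R
  have hL := (Sig.legal hK).bounded R
  -- every position in `w` is justified by others
  let Just : N → Prop := fun w => ∀ r < R, Elem r w → lev r < d ∧ (r < R ∧ Legal S K r) ∧
    ∀ c < k, (lev r + 1 = d ∧ BadEnd k r c) ∨ ∃ r' < R, Elem r' w ∧ Ext k r c r'
  have hJust : Rec S Just := by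
    have : Rec S (fun p : N × N => p.2 < R ∧ Legal S K p.2) :=
      hL.comp (g := fun p : N × N => p.2) (by fun_prop)
    exact .ball (by fun_prop) (.imp (by fun_prop) (.and (by fun_prop) (.and this (by fun_prop))))
  let Win : N → Prop := fun r => r < R ∧ ∃ w < B, Just w ∧ Elem r w
  have hWin : Rec S Win := by simp only [Win]; fun_prop
  refine ⟨Win, hWin, fun r => ⟨?_, ?_⟩⟩
  · rintro ⟨hr, w, hwB, hw, hrw⟩
    obtain ⟨h1, h2, h3⟩ := hw r hr hrw
    refine ⟨hr, h1, h2.2, fun c hc => (h3 c hc).imp_right ?_⟩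
    rintro ⟨r', hr', hr'w, h⟩
    exact ⟨r', hr', ⟨hr', w, hwB, hw, hr'w⟩, h⟩
  · rintro ⟨hr, h1, h2, h3⟩
    obtain ⟨w, hwB, hw⟩ := hB (fun q => q = r ∨ Win q) (by fun_prop)
    refine ⟨hr, w, hwB, fun q hq hqw => ?_, (hw r).2 ⟨hr, .inl rfl⟩⟩
    rcases ((hw q).1 hqw).2 with rfl | ⟨-, v, hvB, hv, hqv⟩
    · refine ⟨h1, ⟨hr, h2⟩, fun c hc => (h3 c hc).imp_right ?_⟩
      rintro ⟨r', hr', hr'w, h⟩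
      exact ⟨r', hr', (hw r').2 ⟨hr', .inr hr'w⟩, h⟩
    · obtain ⟨h4, h5, h6⟩ := hv q hq hqv
      refine ⟨h4, h5, fun c hc => (h6 c hc).imp_right ?_⟩
      rintro ⟨r', hr', hr'v, h⟩
      exact ⟨r', hr', (hw r').2 ⟨hr', .inr ⟨hr', v, hvB, hv, hr'v⟩⟩, h⟩

/-- The game is determined. If Player `∀` has no winning strategy, then Player `∃` wins by playing
the least color that avoids the winning positions of Player `∀`. -/
theorem existsWins_of_forall_not_isStrategy {K : Set N} (hK : K ∈ S) {d k : N}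
    (h : ∀ w, ¬ IsStrategy S K d k w) : ExistsWins S K d k := by
  rcases eq_or_ne d 0 with rfl | hd
  · exact existsWins_zero K k
  obtain ⟨m, rfl⟩ : ∃ m, d = m + 1 := by
    obtain ⟨m, hm⟩ := le_iff_exists_add.1 (Discrete.one_le _ (pos_of_ne_zero hd))
    exact ⟨m, by rw [hm, add_comm]⟩
  set d := m + 1 with hdm
  -- all edges of graphs on `0, …, d - 1` and all pairs of a vertex and a color are below `b`
  let b : N := pair (d + k) (d + k)
  have hbE : ∀ {u v}, u < d → v < d → pair u v < b := fun hu hv =>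
    pair_lt_pair_of_add_lt (add_lt_add (hu.trans_le le_self_add) (hv.trans_le le_self_add))
  have hbC : ∀ {u a}, u < d → a < k → pair u a < b := fun hu ha =>
    pair_lt_pair_of_add_lt (add_lt_add (hu.trans_le le_self_add) (ha.trans_le le_add_self))
  obtain ⟨B, hB⟩ := exists_code_lt S b
  have hB0 : 0 < B := by
    obtain ⟨c, hc, -⟩ := hB (fun _ => False) (by fun_prop)
    exact lt_of_le_of_lt zero_le hc
  let R : N := pair d (pair B B) + 1
  obtain ⟨Win, hWin, hWin'⟩ := exists_winning_set hK d k R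
  -- otherwise the winning positions would form a strategy
  have hWin0 : ∀ r, lev r = 0 → ¬ Win r := by
    intro r hr hrW
    obtain ⟨w, hw⟩ := exists_code R hWin
    have hmem : ∀ q, Win q → Elem q w := fun q hq => (hw q).2 ⟨((hWin' q).1 hq).1, hq⟩
    refine h w ⟨⟨r, (hmem r hrW).lt, hmem r hrW, hr⟩, fun q _ hq => ?_⟩
    obtain ⟨-, h1, h2, h3⟩ := (hWin' q).1 ((hw q).1 hq).2
    refine ⟨h1, h2, fun c hc => (h3 c hc).imp_right ?_⟩
    rintro ⟨r', -, hr', h4⟩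
    exact ⟨r', (hmem r' hr').lt, hmem r' hr', h4⟩
  -- the code of the edges of the graph `g` on `0, …, j`
  let cE : N × N → N := fun p => muB B fun E => ∀ z < b, Elem z E ↔
    ∃ u < p.2 + 1, ∃ v < p.2 + 1, z = pair u v ∧ CAdj p.1 u v
  have hcE : Rec S cE := by simp only [cE]; fun_prop
  have hcE' : ∀ p, cE p < B ∧ ∀ z < b, Elem z (cE p) ↔
      ∃ u < p.2 + 1, ∃ v < p.2 + 1, z = pair u v ∧ CAdj p.1 u v := by
    intro p
    refine muB_spec (S := S) (by fun_prop) ?_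
    obtain ⟨c, hc, hc'⟩ := hB (fun z => ∃ u < p.2 + 1, ∃ v < p.2 + 1, z = pair u v ∧ CAdj p.1 u v)
      (by fun_prop)
    exact ⟨c, hc, fun z hz => (hc' z).trans (by simp only [hz, true_and])⟩
  -- the color played at the position that is given by `g`, the round, and the previous colors
  let pos : (N × N) × N → N := fun p => pair p.1.2 (pair (cE p.1) p.2)
  have hpos : Rec S pos := by simp only [pos]; fun_prop
  let col : (N × N) × N → N := fun p => muB k fun c =>
    ¬ (lev (pos p) + 1 = d ∧ BadEnd k (pos p) c) ∧ ¬ ∃ r' < R, Win r' ∧ Ext k (pos p) c r'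
  have hcol : Rec S col := by simp only [col]; fun_prop
  -- the code of the colors after this round
  let nxt : (N × N) × N → N := fun p => muB B fun C => ∀ z < b, Elem z C ↔
    (∃ u < p.1.2, ∃ a < k, z = pair u a ∧ Elem z p.2) ∨ z = pair p.1.2 (col p)
  have hnxt : Rec S nxt := by simp only [nxt]; fun_prop
  have hnxt' : ∀ p, nxt p < B ∧ ∀ z < b, Elem z (nxt p) ↔
      (∃ u < p.1.2, ∃ a < k, z = pair u a ∧ Elem z p.2) ∨ z = pair p.1.2 (col p) := by
    intro p
    refine muB_spec (S := S) (by fun_prop) ?_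
    obtain ⟨c, hc, hc'⟩ := hB (fun z => (∃ u < p.1.2, ∃ a < k, z = pair u a ∧ Elem z p.2) ∨
      z = pair p.1.2 (col p)) (by fun_prop)
    exact ⟨c, hc, fun z hz => (hc' z).trans (by simp only [hz, true_and])⟩
  obtain ⟨f, hf, hf0, hfs⟩ := Rec.prec (S := S) (g := fun _ : N => 0) (by fun_prop) hnxt
  let color : N → N → N := fun g j => col ((g, j), f (g, j))
  let P : N → N → N := fun g j => pos ((g, j), f (g, j))
  -- the colors depend only on the graph on the vertices played so far
  have hcongr : ∀ g g' j, (∀ u < j + 1, ∀ v < j + 1, CAdj g u v ↔ CAdj g' u v) →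
      color g j = color g' j := by
    intro g g' j hgg
    have hcE_eq : ∀ i ≤ j, cE (g, i) = cE (g', i) := by
      intro i hi
      have : ∀ z, (∃ u < i + 1, ∃ v < i + 1, z = pair u v ∧ CAdj g u v) ↔
          ∃ u < i + 1, ∃ v < i + 1, z = pair u v ∧ CAdj g' u v := by
        refine fun z => exists_congr fun u => and_congr_right fun hu => exists_congr fun v =>
          and_congr_right fun hv => and_congr_right fun _ => hgg u (hu.trans_le ?_) v
            (hv.trans_le ?_) <;> gcongr
      simp only [cE, this]
    have hcol_eq : ∀ i ≤ j, ∀ C, col ((g, i), C) = col ((g', i), C) := by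
      intro i hi C
      simp only [col, pos, hcE_eq i hi]
    have hf_eq : ∀ i, i ≤ j → f (g, i) = f (g', i) := by
      refine Rec.induction (S := S) (by fun_prop) (fun _ => by rw [hf0, hf0]) fun i ih hi => ?_
      have hij : i ≤ j := (lt_add_one i).le.trans hi
      rw [hfs, hfs, ih hij]
      simp only [nxt, hcol_eq i hij]
    simp only [color, hf_eq j le_rfl, hcol_eq j le_rfl]
  -- a run of the game
  have hrun : ∀ G, IsPlay S K d G → ∀ g, decodeGraph g = G → (∀ j < d, color g j < k) ∧
      ∀ u v, G.Adj u v → color g u ≠ color g v := by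
    rintro G hG g rfl
    have hlt : ∀ {u v}, CAdj g u v → u < d ∧ v < d := by
      intro u v huv
      have := hG.1.adj_verts u v huv
      rwa [hG.2.1] at this
    have hedge : ∀ j < d, ∀ u < j + 1, ∀ v < j + 1, SEdge (cE (g, j)) u v ↔ CAdj g u v := by
      intro j hj u hu v hv
      have hud : u < d := (lt_add_one_iff'.1 hu).trans_lt hj
      have hvd : v < d := (lt_add_one_iff'.1 hv).trans_lt hj
      have h1 : ∀ {u v}, u < j + 1 → v < j + 1 → u < d → v < d →
          (Elem (pair u v) (cE (g, j)) ↔ CAdj g u v) := by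
        intro u v hu hv hud hvd
        rw [(hcE' (g, j)).2 _ (hbE hud hvd)]
        constructor
        · rintro ⟨u', -, v', -, h, h'⟩
          obtain ⟨rfl, rfl⟩ := pair_inj.1 h
          exact h'
        · exact fun h => ⟨u, hu, v, hv, rfl, h⟩
      rw [SEdge, h1 hu hv hud hvd, h1 hv hu hvd hud]
      constructor
      · rintro ⟨-, h | h⟩
        · exact h
        · exact hG.1.symm _ _ h
      · intro h
        refine ⟨?_, .inl h⟩
        rintro rfl
        exact hG.1.irrefl _ h
    have hP : ∀ j, P g j = pair j (pair (cE (g, j)) (f (g, j))) := fun j => rfl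
    have hfB : ∀ j, f (g, j) < B := by
      refine Rec.induction (S := S) (by fun_prop) (by rw [hf0]; exact hB0) fun j _ => ?_
      rw [hfs]
      exact (hnxt' _).1
    have hPR : ∀ j < d, P g j < R := fun j hj => lt_add_one_iff'.2
      (pair_le_pair hj.le (pair_le_pair (hcE' _).1.le (hfB j).le))
    have hlegal : ∀ j < d, Legal S K (P g j) := by
      intro j hj
      have h1 := hG.2.2 j hj
      rw [Legal, hP, lev_pair, edg_pair]
      convert h1 using 1
      ext u v
      · simp only [gameGraph, RawGraph.induce, hG.2.1]
        exact ⟨fun h => ⟨lt_of_le_of_lt h hj, h⟩, fun h => h.2⟩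
      · constructor
        · rintro ⟨hu, hv, h⟩
          exact ⟨(hedge j hj u (lt_add_one_iff'.2 hu) v (lt_add_one_iff'.2 hv)).1 h, hu, hv⟩
        · rintro ⟨h, hu, hv⟩
          exact ⟨hu, hv, (hedge j hj u (lt_add_one_iff'.2 hu) v (lt_add_one_iff'.2 hv)).2 h⟩
    have hcolor : ∀ j < d, ¬ Win (P g j) → color g j < k ∧
        ¬ (lev (P g j) + 1 = d ∧ BadEnd k (P g j) (color g j)) ∧
        ¬ ∃ r' < R, Win r' ∧ Ext k (P g j) (color g j) r' := by
      intro j hj hW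
      refine muB_spec (S := S) (P := fun c => ¬ (lev (P g j) + 1 = d ∧ BadEnd k (P g j) c) ∧
        ¬ ∃ r' < R, Win r' ∧ Ext k (P g j) c r') (by fun_prop) ?_
      by_contra! hc
      refine hW ((hWin' _).2 ⟨hPR j hj, by rwa [hP, lev_pair], hlegal j hj, fun c hck => ?_⟩)
      by_cases h1 : lev (P g j) + 1 = d ∧ BadEnd k (P g j) c
      · exact .inl h1
      · exact .inr (hc c hck fun h2 h3 => h1 ⟨h2, h3⟩)
    have hnext : ∀ j, ∀ u a, u < d → a < k → j + 1 < d →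
        (Elem (pair u a) (f (g, j + 1)) ↔ (u < j ∧ Elem (pair u a) (f (g, j))) ∨
          (u = j ∧ a = color g j)) := by
      intro j u a hu ha hj
      rw [hfs, (hnxt' _).2 _ (hbC hu ha), pair_inj]
      refine or_congr_left ⟨?_, fun h => ⟨u, h.1, a, ha, rfl, h.2⟩⟩
      rintro ⟨u', hu', a', -, h, h'⟩
      obtain ⟨rfl, rfl⟩ := pair_inj.1 h
      exact ⟨hu', h'⟩
    -- Player `∃` avoids the winning positions
    have hnotWin : ∀ j, j < d → ¬ Win (P g j) := by
      refine Rec.induction (S := S) ?_ (fun _ => hWin0 _ (by rw [hP, lev_pair])) fun j ih hj => ?_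
      · simp only [hP]; fun_prop
      · have hjd : j < d := (lt_add_one j).trans hj
        obtain ⟨h1, h2, h3⟩ := hcolor j hjd (ih hjd)
        intro hW
        refine h3 ⟨P g (j + 1), hPR _ hj, hW, ?_⟩
        simp only [hP, Ext, lev_pair, edg_pair, clr_pair]
        refine ⟨trivial, fun u hu v hv => ?_, fun u hu a ha => ?_, fun a ha => ?_⟩
        · rw [hedge j hjd u hu v hv, hedge (j + 1) hj u (hu.trans (lt_add_one _)) v
            (hv.trans (lt_add_one _))]
        · rw [hnext j u a (hu.trans hjd) ha hj]
          simp [hu, hu.ne]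
        · rw [hnext j j a hjd ha hj]
          simp
    have hstored : ∀ j, j < d → ∀ u < j, ∀ a < k, Elem (pair u a) (f (g, j)) ↔ a = color g u := by
      refine Rec.induction (S := S) (by fun_prop) (by simp) fun j ih hj u hu a ha => ?_
      have hjd : j < d := (lt_add_one j).trans hj
      rw [hnext j u a (hu.trans hj) ha hj]
      rcases (lt_add_one_iff'.1 hu).lt_or_eq with h | rfl
      · rw [ih hjd u h a ha]
        simp [h, h.ne]
      · simp
    have hk : ∀ j < d, color g j < k := fun j hj => (hcolor j hj (hnotWin j hj)).1
    refine ⟨hk, fun u v huv heq => ?_⟩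
    have hmd : m < d := lt_add_one m
    refine (hcolor m hmd (hnotWin m hmd)).2.1 ⟨by rw [hP, lev_pair], u, ?_, v, ?_, ?_⟩
    · rw [hP, lev_pair]; exact (hlt huv).1
    · rw [hP, lev_pair]; exact (hlt huv).2
    · have hcol' : ∀ w < d, HasColor (P g m) (color g m) w (color g w) := by
        intro w hw
        rw [HasColor, hP, lev_pair, clr_pair]
        rcases (lt_add_one_iff'.1 hw).lt_or_eq with h | rfl
        · exact .inl ⟨h, (hstored m hmd w h _ (hk w hw)).2 rfl⟩
        · exact .inr ⟨rfl, rfl⟩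
      refine ⟨?_, color g u, hk u (hlt huv).1, hcol' u (hlt huv).1, heq ▸ hcol' v (hlt huv).2⟩
      rw [hP, edg_pair]
      exact (hedge m hmd u (hlt huv).1 v (hlt huv).2).2 huv
  -- the strategy as a function of the graph
  let top : N → N := fun g => mu fun i => ¬ CVert g (i + 1)
  have htop : Rec S top := Rec.mu (by fun_prop) fun g => ⟨g, fun h =>
    absurd h.lt (not_lt.2 le_self_add)⟩
  have hdec : ∀ g g', decodeGraph g = decodeGraph g' → color g (top g) = color g' (top g') := by
    intro g g' hgg
    have h1 : top g = top g' := by simp only [top, CVert, hgg]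
    rw [h1]
    exact hcongr g g' _ fun u _ v _ => by rw [CAdj, CAdj, hgg]
  classical
  let σ : RawGraph N → N := fun G =>
    if h : ∃ g, decodeGraph g = G then color h.choose (top h.choose) else 0
  have hσ : ∀ g, σ (decodeGraph g) = color g (top g) := by
    intro g
    have h : ∃ g', decodeGraph g' = decodeGraph g := ⟨g, rfl⟩
    simp only [σ, dif_pos h]
    exact hdec _ _ h.choose_spec
  refine ⟨σ, ?_, fun G hG => ?_⟩
  · simp only [hσ]
    have : Rec S (fun g => color g (top g)) := by simp only [color]; fun_prop
    exact this.isFun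
  · obtain ⟨g, rfl⟩ := exists_decodeGraph_eq hG.1 (b := d) (by rw [hG.2.1]; exact fun u hu => hu)
    obtain ⟨h1, h2⟩ := hrun _ hG g rfl
    have key : ∀ v < d, σ ((decodeGraph g).induce {j | j ≤ v}) = color g v := by
      intro v hv
      have hle : {j | j ≤ v} ∈ S := Rec.setOf_mem (by fun_prop)
      obtain ⟨g', hg'⟩ := exists_decodeGraph_eq (hG.1.induce hle) (b := d)
        (fun u hu => by have := hu.1; rwa [hG.2.1] at this)
      have hvert : ∀ u, CVert g' u ↔ u < d ∧ u ≤ v := by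
        intro u
        rw [CVert, hg', RawGraph.induce, hG.2.1]
        exact Iff.rfl
      have htop' : top g' = v := by
        refine mu_eq ?_ fun y hy => ?_
        · rw [hvert]
          exact fun h => absurd (lt_add_one v) h.2.not_gt
        · rw [hvert, not_not]
          have : y + 1 ≤ v := add_one_le_iff_lt.2 hy
          exact ⟨this.trans_lt hv, this⟩
      rw [← hg', hσ, htop']
      refine hcongr g' g v fun u hu w hw => ?_
      rw [CAdj, hg']
      exact ⟨fun h => h.1, fun h => ⟨h, lt_add_one_iff'.1 hu, lt_add_one_iff'.1 hw⟩⟩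
    have hverts : ∀ v ∈ (decodeGraph g).verts, v < d := by
      rw [hG.2.1]; exact fun v hv => hv
    refine ⟨fun v hv => ?_, fun u v huv => ?_⟩
    · simp only [key v (hverts v hv)]
      exact h1 v (hverts v hv)
    · have := hG.1.adj_verts u v huv
      simp only [key u (hverts u this.1), key v (hverts v this.2)]
      exact h2 u v huv

end Game

/-! ### The graph of all games against diagonal computations -/

section Diagonal

variable {N : Type*} [CommSemiring N] [LinearOrder N] [IsStrictOrderedRing N]
  [CanonicallyOrderedAdd N] [Discrete N] {S : Set (Set N)} [hS : Model S]
variable {α : Type*} [Ctx N α]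

/-- The domains of the diagonal functions are enumerated in recursive stages, and at a stage `s`
where `x` has entered the `i`-th domain the first `i` diagonal values are recursive in `x`, `s`. -/
theorem exists_stages {f : N → N} (hf : Rec S f) :
    ∃ (Stage : N → N → N → Prop) (val : (N × N) × N → N),
      Rec S (fun p : (N × N) × N => Stage p.1.1 p.1.2 p.2) ∧ Rec S val ∧
      (∀ i x s i' s', Stage i x s → i' ≤ i → s ≤ s' → Stage i' x s') ∧
      (∀ i x, x ∈ DiagDom f i ↔ ∃ s, Stage i x s) ∧
      ∀ i x s, Stage i x s → ∀ j < i, Phi (proj j x) f (proj j x) (val ((j, x), s)) := by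
  obtain ⟨Q, hQ, hphi⟩ := Sig.phi hf
  have hQ' : Rec S (fun p : ((((N × N) × N) × N) × N) × N =>
      Q ((proj p.1.1.2 p.1.1.1.1.2, proj p.1.1.2 p.1.1.1.1.2), p.1.2) p.2) :=
    hQ.comp (g := fun p : ((((N × N) × N) × N) × N) × N =>
      (((proj p.1.1.2 p.1.1.1.1.2, proj p.1.1.2 p.1.1.1.1.2), p.1.2), p.2)) (by fun_prop)
  have hQ'' : Rec S (fun p : (((N × N) × N) × N) × N =>
      Q ((proj p.1.1.1.1 p.1.1.1.2, proj p.1.1.1.1 p.1.1.1.2), p.1.2) p.2) :=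
    hQ.comp (g := fun p : (((N × N) × N) × N) × N =>
      (((proj p.1.1.1.1 p.1.1.1.2, proj p.1.1.1.1 p.1.1.1.2), p.1.2), p.2)) (by fun_prop)
  refine ⟨fun i x s => ∀ j < i, ∃ u < s, ∃ z < s, Q ((proj j x, proj j x), u) z,
    fun p => muB p.2 fun u => ∃ z < p.2, Q ((proj p.1.1 p.1.2, proj p.1.1 p.1.2), u) z,
    .ball (by fun_prop) (.bex (by fun_prop) (.bex (by fun_prop) hQ')),
    .muB (by fun_prop) (.bex (by fun_prop) hQ''), ?_, fun i x => ⟨fun h => ?_, ?_⟩, ?_⟩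
  · intro i x s i' s' h hi hs j hj
    obtain ⟨u, hu, z, hz, h'⟩ := h j (hj.trans_le hi)
    exact ⟨u, hu.trans_le hs, z, hz.trans_le hs, h'⟩
  · have hQx : Rec S (fun p : ((N × N) × N) × N =>
        Q ((proj p.1.1.1 x, proj p.1.1.1 x), p.1.2) p.2) :=
      hQ.comp (g := fun p : ((N × N) × N) × N =>
        (((proj p.1.1.1 x, proj p.1.1.1 x), p.1.2), p.2)) (by fun_prop)
    obtain ⟨s, hs⟩ := Rec.collection (S := S) (P := fun j s => ∃ u < s, ∃ z < s,
      Q ((proj j x, proj j x), u) z) (.bex (by fun_prop) (.bex (by fun_prop) hQx)) i (by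
        intro j hj
        obtain ⟨u, hu⟩ := h j hj
        obtain ⟨z, hz⟩ := (hphi ((proj j x, proj j x), u)).1 hu
        exact ⟨max u z + 1, u, lt_add_one_iff'.2 (le_max_left _ _), z,
          lt_add_one_iff'.2 (le_max_right _ _), hz⟩)
    refine ⟨s, fun j hj => ?_⟩
    obtain ⟨s', hs', u, hu, z, hz, h'⟩ := hs j hj
    exact ⟨u, hu.trans hs', z, hz.trans hs', h'⟩
  · rintro ⟨s, hs⟩ j hj
    obtain ⟨u, -, z, -, h⟩ := hs j hj
    exact ⟨u, (hphi ((proj j x, proj j x), u)).2 ⟨z, h⟩⟩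
  · intro i x s h j hj
    have hQx : Rec S (fun p : N × N => Q ((proj j x, proj j x), p.1) p.2) :=
      hQ.comp (g := fun p : N × N => (((proj j x, proj j x), p.1), p.2)) (by fun_prop)
    obtain ⟨-, z, -, hz⟩ := muB_spec (S := S)
      (P := fun u => ∃ z < s, Q ((proj j x, proj j x), u) z) (.bex (by fun_prop) hQx) (h j hj)
    exact (hphi ((proj j x, proj j x), _)).2 ⟨z, hz⟩

theorem IsStrategy.pos {K : Set N} {d k w : N} (h : IsStrategy S K d k w) : 0 < d := by
  obtain ⟨⟨r, hr, hrw, -⟩, h⟩ := h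
  exact lt_of_le_of_lt zero_le (h r hr hrw).1

/-- The graphs on `0, …, i` that arise when Player `∀` plays the strategy `w a` against the colors
`c (a, 0), c (a, 1), …`. They belong to the class, extend each other, end with an edge between
vertices of the same color, and the graph on `0, …, i` depends only on the colors before round `i`. -/
theorem exists_run {K : Set N} {d k w : α → N} {c : α × N → N} (hk : Rec S k)
    (hw : Rec S w) (hc : Rec S c) (hst : ∀ a, IsStrategy S K (d a) (k a) (w a))
    (hck : ∀ a i, c (a, i) < k a) :
    ∃ E : α × N → N, Rec S E ∧ (∀ a, ∀ i < d a, InClass S K (gameGraph i (E (a, i)))) ∧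
      (∀ a i j u v, j ≤ i → i < d a → u ≤ j → v ≤ j →
        (SEdge (E (a, j)) u v ↔ SEdge (E (a, i)) u v)) ∧
      (∀ a m, d a = m + 1 → ∃ u ≤ m, ∃ v ≤ m, SEdge (E (a, m)) u v ∧ c (a, u) = c (a, v)) ∧
      ∀ a a' i, k a = k a' → w a = w a' → (∀ j < i, c (a, j) = c (a', j)) →
        E (a, i) = E (a', i) := by
  obtain ⟨pos, hpos, hpos0, hposs⟩ := Rec.prec (S := S)
    (g := fun a : α => muB (w a) fun r => Elem r (w a) ∧ lev r = 0)
    (h := fun q : (α × N) × N => muB (w q.1.1) fun r' => Elem r' (w q.1.1) ∧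
      Ext (k q.1.1) q.2 (c q.1) r') (by fun_prop) (by fun_prop)
  have hmem : ∀ a i, i < d a → Elem (pos (a, i)) (w a) ∧ lev (pos (a, i)) = i := by
    intro a
    refine Rec.induction (S := S) (by fun_prop) (fun _ => ?_) fun i ih hi => ?_
    · rw [hpos0]
      obtain ⟨r, hr, h⟩ := (hst a).1
      exact (muB_spec (S := S) (P := fun r => Elem r (w a) ∧ lev r = 0) (by fun_prop)
        ⟨r, hr, h⟩).2
    · obtain ⟨h1, h2⟩ := ih ((lt_add_one i).trans hi)
      obtain ⟨-, -, h3⟩ := (hst a).2 _ h1.lt h1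
      have h4 := (h3 _ (hck a i)).resolve_left fun h => by rw [h2] at h; exact hi.ne h.1
      rw [hposs]
      have h5 := (muB_spec (S := S) (P := fun r' => Elem r' (w a) ∧ Ext (k a) (pos (a, i))
        (c (a, i)) r') (by fun_prop) h4).2
      exact ⟨h5.1, by rw [h5.2.1, h2]⟩
  have hext : ∀ a i, i + 1 < d a → Ext (k a) (pos (a, i)) (c (a, i)) (pos (a, i + 1)) := by
    intro a i hi
    obtain ⟨h1, h2⟩ := hmem a i ((lt_add_one i).trans hi)
    obtain ⟨-, -, h3⟩ := (hst a).2 _ h1.lt h1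
    have h4 := (h3 _ (hck a i)).resolve_left fun h => by rw [h2] at h; exact hi.ne h.1
    rw [hposs]
    exact (muB_spec (S := S) (P := fun r' => Elem r' (w a) ∧ Ext (k a) (pos (a, i))
      (c (a, i)) r') (by fun_prop) h4).2.2
  have hcolors : ∀ a i, i < d a → ∀ u < i, ∀ b < k a,
      (Elem (pair u b) (clr (pos (a, i))) ↔ b = c (a, u)) := by
    intro a
    refine Rec.induction (S := S) (by fun_prop) (by simp) fun i ih hi u hu b hb => ?_
    obtain ⟨-, -, h1, h2⟩ := hext a i hi
    have hid := (lt_add_one i).trans hi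
    rw [(hmem a i hid).2] at h1 h2
    rcases (lt_add_one_iff'.1 hu).lt_or_eq with h | rfl
    · rw [← h1 u h b hb, ih hid u h b hb]
    · exact h2 b hb
  refine ⟨fun p => edg (pos p), by fun_prop, ?_, ?_, ?_, ?_⟩
  · intro a i hi
    obtain ⟨h1, h2⟩ := hmem a i hi
    have := ((hst a).2 _ h1.lt h1).2.1
    rwa [Legal, h2] at this
  · intro a i j u v hji hi hu hv
    obtain ⟨l, rfl⟩ := le_iff_exists_add.1 hji
    have : ∀ l, j + l < d a → (SEdge (edg (pos (a, j))) u v ↔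
        SEdge (edg (pos (a, j + l))) u v) := by
      refine Rec.induction (S := S) (by fun_prop) (by simp) fun l ih hl => ?_
      rw [← add_assoc] at hl ⊢
      have hld := (lt_add_one _).trans hl
      rw [ih hld]
      have h1 := (hext a (j + l) hl).2.1
      rw [(hmem a _ hld).2] at h1
      exact h1 u (lt_add_one_iff'.2 (hu.trans le_self_add)) v
        (lt_add_one_iff'.2 (hv.trans le_self_add))
    exact this l hi
  · intro a m hm
    have hmd : m < d a := by rw [hm]; exact lt_add_one m
    obtain ⟨h1, h2⟩ := hmem a m hmd
    obtain ⟨-, -, h3⟩ := (hst a).2 _ h1.lt h1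
    have h4 : BadEnd (k a) (pos (a, m)) (c (a, m)) := by
      rcases h3 _ (hck a m) with h | ⟨r', hr', hr'w, h⟩
      · exact h.2
      · have h5 := ((hst a).2 r' hr' hr'w).1
        rw [h.1, h2, hm] at h5
        exact (lt_irrefl _ h5).elim
    obtain ⟨u, hu, v, hv, huv, b, hb, hub, hvb⟩ := h4
    have hcol : ∀ u, HasColor (pos (a, m)) (c (a, m)) u b → b = c (a, u) := by
      rintro u (⟨h, h'⟩ | ⟨rfl, rfl⟩)
      · rw [h2] at h
        exact (hcolors a m hmd u h b hb).1 h'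
      · rw [h2]
    rw [h2, lt_add_one_iff'] at hu hv
    exact ⟨u, hu, v, hv, huv, (hcol u hub).symm.trans (hcol v hvb)⟩
  · intro a a' i hk' hw' hcc
    have : ∀ j, j ≤ i → pos (a, j) = pos (a', j) := by
      refine Rec.induction (S := S) (by fun_prop) (fun _ => by rw [hpos0, hpos0, hw'])
        fun j ih hj => ?_
      rw [hposs, hposs, ih ((lt_add_one j).le.trans hj), hk', hw',
        hcc j ((lt_add_one j).trans_le hj)]
    simp only [this i le_rfl]

end Diagonal

section Graph

variable {N : Type*} [CommSemiring N] [LinearOrder N] [IsStrictOrderedRing N]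
  [CanonicallyOrderedAdd N] [Discrete N] {S : Set (Set N)} [hS : Model S]
variable {α : Type*} [Ctx N α]

@[fun_prop] protected theorem Rec.max {f g : α → N} (hf : Rec S f) (hg : Rec S g) :
    Rec S (fun a => max (f a) (g a)) := by
  simp only [max_def]
  fun_prop

/-- The disjoint sum, over all `t` and `x`, of the graphs that arise when Player `∀` plays the
strategy `w t` for `d t` rounds and `k t` colors against the diagonal values at `x`. A coloring of
this graph with at most `k t` colors is, on the components with index `t`, a diagonally
non-recursive sequence. -/
theorem exists_diagonal_graph {K : Set N} (hK : IsNatural S K) {d k w : N → N}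
    (hd : Rec S d) (hk : Rec S k) (hw : Rec S w) (hst : ∀ t, IsStrategy S K (d t) (k t) (w t))
    (hk0 : ∀ t, 0 < k t) {f : N → N} (hf : Rec S f) :
    ∃ G, InClass S K G ∧ ∀ t k', k' ≤ k t → Colorable S k' G → DNR S (d t) (k t) f := by
  obtain ⟨Stage, val, hStage, hval, hmono, hdom, hphi⟩ := exists_stages hf
  -- the color that the strategy sees in round `i`, for the component `⟨t, x⟩` at stage `s`; values
  -- that are not colors are replaced by `0`, so that the play continues for all `d t` rounds
  let c : ((N × N) × N) × N → N := fun q =>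
    if val ((q.2, q.1.1.2), q.1.2) < k q.1.1.1 then val ((q.2, q.1.1.2), q.1.2) else 0
  have hc : Rec S c := by simp only [c]; fun_prop
  obtain ⟨E, hE, hclass, hcoh, hend, hloc⟩ := exists_run (S := S) (K := K)
    (d := fun a : (N × N) × N => d a.1.1) (k := fun a : (N × N) × N => k a.1.1)
    (w := fun a : (N × N) × N => w a.1.1) (c := c) (by fun_prop) (by fun_prop) hc
    (fun a => hst _) (by
      intro a i
      simp only [c]
      split_ifs with h
      · exact h
      · exact hk0 _)
  have hdm : ∀ t, ∃ m, d t = m + 1 := by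
    intro t
    obtain ⟨m, hm⟩ := le_iff_exists_add.1 (Discrete.one_le _ (hst t).pos)
    exact ⟨m, by rw [hm, add_comm]⟩
  -- the least stage at which `x` has entered the `i`-th domain
  let Least : N → N → N → Prop := fun i x s => Stage i x s ∧ ∀ s' < s, ¬ Stage i x s'
  have hLeast : Rec S (fun p : (N × N) × N => Least p.1.1 p.1.2 p.2) := by
    have : Rec S (fun p : ((N × N) × N) × N => Stage p.1.1.1 p.1.1.2 p.2) :=
      hStage.comp (g := fun p : ((N × N) × N) × N => ((p.1.1.1, p.1.1.2), p.2)) (by fun_prop)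
    exact hStage.and (.ball (by fun_prop) (.not this))
  have hLeast_unique : ∀ {i x s s'}, Least i x s → Least i x s' → s = s' := by
    intro i x s s' h h'
    rcases lt_trichotomy s s' with hlt | heq | hlt
    · exact absurd h.1 (h'.2 s hlt)
    · exact heq
    · exact absurd h'.1 (h.2 s' hlt)
  have hLeast_exists : ∀ i x, (∃ s, Stage i x s) → ∃ s, Least i x s := fun i x h =>
    Rec.exists_least (S := S) (P := fun s => Stage i x s)
      (hStage.comp (g := fun s : N => ((i, x), s)) (by fun_prop)) h
  -- the vertex of round `i` in the component `⟨t, x⟩` carries the least stage at which it appears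
  let vtx : N → N → N → N → N := fun t x i s => pair (pair t x) (pair i s)
  let V : N → Prop := fun p => p = vtx (pfst (pfst p)) (psnd (pfst p)) (pfst (psnd p))
    (psnd (psnd p)) ∧ pfst (psnd p) < d (pfst (pfst p)) ∧
    Least (pfst (psnd p)) (psnd (pfst p)) (psnd (psnd p))
  have hV : Rec S V := by
    have : Rec S (fun p => Least (pfst (psnd p)) (psnd (pfst p)) (psnd (psnd p))) :=
      hLeast.comp (g := fun p : N => ((pfst (psnd p), psnd (pfst p)), psnd (psnd p))) (by fun_prop)
    exact .and (by simp only [vtx]; fun_prop) (.and (by fun_prop) this)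
  have hVvtx : ∀ t x i s, V (vtx t x i s) ↔ i < d t ∧ Least i x s := by
    intro t x i s
    simp only [V, vtx, pfst_pair, psnd_pair, true_and]
  have hVex : ∀ p, V p → ∃ t x i s, p = vtx t x i s ∧ i < d t ∧ Least i x s := fun p hp =>
    ⟨_, _, _, _, hp⟩
  let A : N → N → Prop := fun p q => SEdge (E (((pfst (pfst p), psnd (pfst p)),
    max (psnd (psnd p)) (psnd (psnd q))), max (pfst (psnd p)) (pfst (psnd q))))
    (pfst (psnd p)) (pfst (psnd q))
  let G : RawGraph N := ⟨{p | V p}, fun p q => V p ∧ V q ∧ pfst p = pfst q ∧ A p q⟩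
  have hGV : ∀ p, p ∈ G.verts ↔ V p := fun p => Iff.rfl
  have hGE : ∀ p q, G.Adj p q ↔ V p ∧ V q ∧ pfst p = pfst q ∧ A p q := fun p q => Iff.rfl
  have hG : IsGraph S G := by
    refine isGraph_of_rec (by simpa only [hGV] using hV) ?_ (fun u v h => ⟨h.1, h.2.1⟩) ?_ ?_
    · simp only [hGE, A]
      fun_prop
    · rintro u v ⟨hu, hv, h1, h2⟩
      refine ⟨hv, hu, h1.symm, ?_⟩
      simp only [A] at h2 ⊢
      rw [max_comm (psnd (psnd v)), max_comm (pfst (psnd v)), ← h1]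
      exact h2.symm
    · rintro u ⟨-, -, -, h⟩
      exact h.1 rfl
  -- the strategy plays the same graph at all later stages
  have hlater : ∀ t x i i' s s' s'' m, d t = m + 1 → i ≤ m → i' ≤ m → Stage i x s →
      Stage i' x s' → s ≤ s'' → s' ≤ s'' →
      (A (vtx t x i s) (vtx t x i' s') ↔ SEdge (E (((t, x), s''), m)) i i') := by
    intro t x i i' s s' s'' m hm hi hi' hs hs' hss hss'
    have h1 : Stage (max i i') x (max s s') := by
      rcases le_total i i' with h | h
      · rw [max_eq_right h]
        exact hmono _ _ _ _ _ hs' le_rfl (le_max_right _ _)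
      · rw [max_eq_left h]
        exact hmono _ _ _ _ _ hs le_rfl (le_max_left _ _)
    have h2 : Stage (max i i') x s'' := hmono _ _ _ _ _ h1 le_rfl (max_le hss hss')
    have h3 : E (((t, x), max s s'), max i i') = E (((t, x), s''), max i i') := by
      refine hloc _ _ _ rfl rfl fun j hj => ?_
      have := Phi.unique S (hphi _ _ _ h1 j hj) (hphi _ _ _ h2 j hj)
      simp only [c, this]
    simp only [A, vtx, pfst_pair, psnd_pair, h3]
    exact hcoh _ _ _ _ _ (max_le hi hi') (by simp only [hm]; exact lt_add_one m)
      (le_max_left _ _) (le_max_right _ _)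
  refine ⟨G, inClass_of_bounded hG fun W hW hsub ⟨b, hb⟩ => ?_, ?_⟩
  · -- the finite subgraphs are sums of induced subgraphs of graphs of the game
    have hW' := rec_mem hW
    have hGadj := hG.rec_adj
    have hbelow : ∀ n, {p | p ∈ W ∧ pfst p < n} ∈ S := fun n => Rec.setOf_mem (by fun_prop)
    have hat : ∀ n, {p | p ∈ W ∧ pfst p = n} ∈ S := fun n => Rec.setOf_mem (by fun_prop)
    have hcomp : ∀ n, InClass S K (G.induce {p | p ∈ W ∧ pfst p = n}) := by
      intro n
      obtain ⟨m, hm⟩ := hdm (pfst n)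
      -- the stages of all vertices in `W` are below `b`
      refine InClass.of_embedding (G' := gameGraph m (E (((pfst n, psnd n), b), m)))
        (hclass _ m (by simp only [hm]; exact lt_add_one m)) (hG.induce (hat n))
        (ψ := fun p => pfst (psnd p)) (by fun_prop) ?_ ?_ ?_
      · rintro p ⟨hp, -, rfl⟩
        obtain ⟨t, x, i, s, rfl, hi, -⟩ := hVex p hp
        simp only [vtx, pfst_pair, psnd_pair] at hm ⊢
        rw [hm, lt_add_one_iff'] at hi
        exact hi
      · rintro p ⟨hp, -, rfl⟩ q ⟨hq, -, hpq⟩ h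
        obtain ⟨t, x, i, s, rfl, -, hs⟩ := hVex p hp
        obtain ⟨t', x', i', s', rfl, -, hs'⟩ := hVex q hq
        simp only [vtx, pfst_pair, psnd_pair, pair_inj] at hpq h
        obtain ⟨rfl, rfl⟩ := hpq
        subst h
        rw [hLeast_unique hs hs']
      · rintro p ⟨hp, hpW, rfl⟩ q ⟨hq, hqW, hpq⟩
        have hpb := hb p hpW
        have hqb := hb q hqW
        obtain ⟨t, x, i, s, rfl, hi, hs⟩ := hVex p hp
        obtain ⟨t', x', i', s', rfl, hi', hs'⟩ := hVex q hq
        have hsb : ∀ t x i s : N, vtx t x i s < b → s ≤ b := fun t x i s h =>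
          (((right_le_pair _ _).trans (right_le_pair _ _)).trans_lt h).le
        have hpq' := hpq
        simp only [vtx, pfst_pair, pair_inj] at hpq'
        obtain ⟨rfl, rfl⟩ := hpq'
        simp only [vtx, pfst_pair, psnd_pair] at hm ⊢
        rw [hm, lt_add_one_iff'] at hi hi'
        have := hlater _ _ _ _ _ _ b m hm hi hi' hs.1 hs'.1 (hsb _ _ _ _ hpb) (hsb _ _ _ _ hqb)
        constructor
        · rintro ⟨h, -⟩
          exact ⟨hi, hi', this.1 h.2.2.2⟩
        · rintro ⟨-, -, h⟩
          exact ⟨⟨hp, hq, hpq.symm, this.2 h⟩, ⟨hpW, pfst_pair _ _⟩, ⟨hqW, pfst_pair _ _⟩⟩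
    have hall : ∀ n, InClass S K (G.induce {p | p ∈ W ∧ pfst p < n}) := by
      refine Sig.induction (S := S) (Sig.inClass hK.mem (b := fun _ => b) (by fun_prop)
        (fun n => hG.induce (hbelow n)) (fun n u hu => hb u hu.2.1) ?_ ?_) ?_ fun n ih => ?_
      · have : Rec S (fun p : N × N => V p.2 ∧ p.2 ∈ W ∧ pfst p.2 < p.1) := by fun_prop
        exact this
      · have : Rec S (fun p : (N × N) × N => G.Adj p.1.2 p.2 ∧ (p.1.2 ∈ W ∧ pfst p.1.2 < p.1.1) ∧
            (p.2 ∈ W ∧ pfst p.2 < p.1.1)) := by fun_prop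
        exact this
      · refine (hcomp 0).of_embedding (hG.induce (hbelow 0)) (ψ := fun p => p) (by fun_prop) ?_ ?_ ?_
          <;> rintro u ⟨-, -, hu⟩ <;> exact (not_lt_zero hu).elim
      · have := hK.sum _ _ ih (hcomp n) (by
          rw [Set.disjoint_left]
          rintro p ⟨-, -, hp⟩ ⟨-, -, hp'⟩
          exact hp.ne hp')
        convert this using 1
        ext p q
        · simp only [RawGraph.induce, RawGraph.sum, Set.mem_inter_iff, Set.mem_union,
            Set.mem_ofPred_eq, lt_add_one_iff', le_iff_lt_or_eq]
          tauto
        · simp only [RawGraph.induce, RawGraph.sum, Set.mem_ofPred_eq, lt_add_one_iff', hGE]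
          constructor
          · rintro ⟨⟨h1, h2, h3, h4⟩, ⟨h5, h6⟩, h7, h8⟩
            rcases h6.lt_or_eq with h | h
            · exact .inl ⟨⟨h1, h2, h3, h4⟩, ⟨h5, h⟩, h7, h3 ▸ h⟩
            · exact .inr ⟨⟨h1, h2, h3, h4⟩, ⟨h5, h⟩, h7, h3 ▸ h⟩
          · rintro (⟨h1, ⟨h2, h3⟩, h4, h5⟩ | ⟨h1, ⟨h2, h3⟩, h4, h5⟩)
            · exact ⟨h1, ⟨h2, h3.le⟩, h4, h5.le⟩
            · exact ⟨h1, ⟨h2, h3.le⟩, h4, h5.le⟩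
    convert hall b using 2
    ext p
    refine ⟨fun hp => ⟨hp, ?_⟩, fun hp => hp.1⟩
    refine lt_of_le_of_lt ?_ (hb p hp)
    obtain ⟨t, x, i, s, rfl, -⟩ := hVex p (hsub hp)
    simp only [vtx, pfst_pair]
    exact left_le_pair _ _
  · -- a coloring of the graph is a diagonally non-recursive sequence
    rintro t k' hk' ⟨χ, hχ, hχk, hχadj⟩
    obtain ⟨m, hm⟩ := hdm t
    obtain ⟨Γ, hΓ, hΓ'⟩ : ∃ Γ : N → Prop, Rec S Γ ∧ ∀ p, Γ p ↔ ∃ v ∈ G.verts, p = pair v (χ v) :=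
      ⟨_, rec_mem hχ, fun p => Iff.rfl⟩
    let H : N → Prop := fun z => ∃ i < z + 1, ∃ x < z + 1, ∃ y < z + 1, ∃ s < z + 1,
      z = pair (pair i x) (pair y s) ∧ V (vtx t x i s) ∧ Γ (pair (vtx t x i s) y)
    have hH : Rec S H := by simp only [H, vtx]; fun_prop
    have hg : ∀ i x y, PartialSeq {z | H z} i x y ↔ ∃ s, (i < d t ∧ Least i x s) ∧
        y = χ (vtx t x i s) := by
      intro i x y
      constructor
      · rintro ⟨s, i', -, x', -, y', -, s', -, h, h1, h2⟩
        simp only [pair_inj] at h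
        obtain ⟨⟨rfl, rfl⟩, rfl, rfl⟩ := h
        obtain ⟨v, -, h2⟩ := (hΓ' _).1 h2
        obtain ⟨h3, rfl⟩ := pair_inj.1 h2
        exact ⟨s, (hVvtx _ _ _ _).1 h1, by rw [h3]⟩
      · rintro ⟨s, h1, rfl⟩
        have hb := pair_eq_bounds (rfl : pair (pair i x) (pair (χ (vtx t x i s)) s) = _)
        refine ⟨s, i, ?_, x, ?_, _, ?_, s, ?_, rfl, (hVvtx _ _ _ _).2 h1,
          (hΓ' _).2 ⟨_, (hVvtx _ _ _ _).2 h1, rfl⟩⟩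
        · exact (left_le_pair _ _).trans_lt hb.1
        · exact (right_le_pair _ _).trans_lt hb.1
        · exact (left_le_pair _ _).trans_lt hb.2
        · exact (right_le_pair _ _).trans_lt hb.2
    refine ⟨{z | H z}, hH.setOf_mem, ?_, ?_, ?_, ?_⟩
    · intro i hi x y y' hy hy'
      obtain ⟨s, h1, rfl⟩ := (hg _ _ _).1 hy
      obtain ⟨s', h2, rfl⟩ := (hg _ _ _).1 hy'
      rw [hLeast_unique h1.2 h2.2]
    · intro i hi x
      rw [hdom]
      constructor
      · rintro ⟨y, hy⟩
        obtain ⟨s, h1, -⟩ := (hg _ _ _).1 hy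
        exact ⟨s, h1.2.1⟩
      · intro h
        obtain ⟨s, hs⟩ := hLeast_exists i x h
        exact ⟨_, (hg _ _ _).2 ⟨s, ⟨hi, hs⟩, rfl⟩⟩
    · intro i hi x y hy
      obtain ⟨s, h1, rfl⟩ := (hg _ _ _).1 hy
      exact (hχk _ ((hVvtx _ _ _ _).2 h1)).trans_le hk'
    · intro x
      by_contra! hdiag
      -- if the coloring agrees with all diagonal values, then all of these converge
      have hconv : ∀ i, i ≤ d t → ∃ s, Stage i x s := by
        have hStx : Rec S (fun p : N × N => Stage p.1 x p.2) :=
          hStage.comp (g := fun p : N × N => ((p.1, x), p.2)) (by fun_prop)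
        refine Sig.induction (S := S) (.imp (by fun_prop) (.exist hStx.sig)) (fun _ => ?_)
          fun i ih hi => ?_
        · rw [← hdom]
          exact fun j hj => (not_lt_zero hj).elim
        · have hid : i < d t := (lt_add_one i).trans_le hi
          obtain ⟨s, hs⟩ := hLeast_exists i x (ih hid.le)
          obtain ⟨h1, h2⟩ := hdiag i hid _ ((hg _ _ _).2 ⟨s, ⟨hid, hs⟩, rfl⟩)
          rw [← hdom]
          intro j hj
          rcases (lt_add_one_iff'.1 hj).lt_or_eq with h | rfl
          · exact h1 j h
          · exact ⟨_, h2⟩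
      obtain ⟨s, hs⟩ := hconv _ le_rfl
      have hcolor : ∀ u ≤ m, ∃ s' ≤ s, Least u x s' ∧ c (((t, x), s), u) = χ (vtx t x u s') := by
        intro u hu
        have hud : u < d t := by rw [hm, lt_add_one_iff']; exact hu
        have hus : Stage u x s := hmono _ _ _ _ _ hs hud.le le_rfl
        obtain ⟨s', hs'⟩ := hLeast_exists u x ⟨s, hus⟩
        refine ⟨s', not_lt.1 fun h => hs'.2 s h hus, hs', ?_⟩
        have h1 := (hdiag u hud _ ((hg _ _ _).2 ⟨s', ⟨hud, hs'⟩, rfl⟩)).2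
        have h2 := Phi.unique S (hphi _ _ _ hs u hud) h1
        simp only [c, h2]
        rw [if_pos ((hχk _ ((hVvtx _ _ _ _).2 ⟨hud, hs'⟩)).trans_le hk')]
      -- the strategy wins, so two adjacent vertices have the same color
      obtain ⟨u, hu, v, hv, huv, heq⟩ := hend ((t, x), s) m hm
      obtain ⟨su, hsu, hsu', hcu⟩ := hcolor u hu
      obtain ⟨sv, hsv, hsv', hcv⟩ := hcolor v hv
      refine hχadj (vtx t x u su) (vtx t x v sv) ⟨(hVvtx _ _ _ _).2 ⟨?_, hsu'⟩,
        (hVvtx _ _ _ _).2 ⟨?_, hsv'⟩, ?_, ?_⟩ ?_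
      · rw [hm, lt_add_one_iff']; exact hu
      · rw [hm, lt_add_one_iff']; exact hv
      · simp only [vtx, pfst_pair]
      · exact (hlater t x u v su sv s m hm hu hv hsu'.1 hsv'.1 hsu hsv).2 huv
      · rw [← hcu, ← hcv, heq]

end Graph

end RevMath

theorem mainTheorem9 {N : Type*} [CommSemiring N] [LinearOrder N] [IsStrictOrderedRing N]
    [CanonicallyOrderedAdd N] (S : Set (Set N)) (hS : RevMath.ModelsRCA₀ S)
    (K : Set N) (hK : RevMath.IsNatural S K) :
    (∀ k : N, ¬ RevMath.LocallyOnlineColorable S K k →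
      (∀ G : RevMath.RawGraph N, RevMath.InClass S K G → RevMath.Colorable S k G) →
      ∃ d : N, 1 ≤ d ∧ ∀ f : N → N, RevMath.IsFun S f → RevMath.DNR S d k f) ∧
    ((∀ k : N, ¬ RevMath.LocallyOnlineColorable S K k) →
      (∀ G : RevMath.RawGraph N, RevMath.InClass S K G → ∃ k : N, RevMath.Colorable S k G) →
      ∀ f : N → N, RevMath.IsFun S f → ∃ d k : N, 1 ≤ d ∧ RevMath.DNR S d k f) := by
  have : RevMath.Discrete N := ⟨hS.discrete⟩
  have : RevMath.Model S := ⟨hS⟩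
  have hstrategy : ∀ k, ¬ RevMath.LocallyOnlineColorable S K k →
      ∃ d w, RevMath.IsStrategy S K d k w := by
    intro k hk
    obtain ⟨d, hd⟩ := not_forall.1 hk
    by_contra! h
    exact hd (RevMath.existsWins_of_forall_not_isStrategy hK.mem (h d))
  constructor
  · intro k hk hcol
    obtain ⟨d, w, hw⟩ := hstrategy k hk
    have hd := hw.pos
    have hk0 : 0 < k := by
      -- the first vertex of a play has no color if `k = 0`
      obtain ⟨⟨r, hr, hrw, hr0⟩, h⟩ := hw
      obtain ⟨χ, -, hχ, -⟩ := hcol _ (h r hr hrw).2.1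
      exact lt_of_le_of_lt zero_le (hχ 0 zero_le)
    refine ⟨d, RevMath.Discrete.one_le d hd, fun f hf => ?_⟩
    obtain ⟨G, hG, h⟩ := RevMath.exists_diagonal_graph hK (d := fun _ => d) (k := fun _ => k)
      (w := fun _ => w) (by fun_prop) (by fun_prop) (by fun_prop) (fun _ => hw) (fun _ => hk0)
      hf.rec
    exact h 0 k le_rfl (hcol G hG)
  · intro hk hcol f hf
    -- the component with index `t` is for `t + 1` colors
    obtain ⟨z, hz, hz'⟩ := RevMath.Sig.choice (S := S) (P := fun t z =>
      RevMath.IsStrategy S K (RevMath.pfst z) (t + 1) (RevMath.psnd z))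
      (RevMath.Sig.isStrategy hK.mem (by fun_prop) (by fun_prop) (by fun_prop)) (by
        intro t
        obtain ⟨d, w, h⟩ := hstrategy _ (hk (t + 1))
        exact ⟨RevMath.pair d w, by rwa [RevMath.pfst_pair, RevMath.psnd_pair]⟩)
    obtain ⟨G, hG, h⟩ := RevMath.exists_diagonal_graph hK (d := fun t => RevMath.pfst (z t))
      (k := fun t => t + 1) (w := fun t => RevMath.psnd (z t)) (by fun_prop) (by fun_prop)
      (by fun_prop) hz' (fun t => lt_of_lt_of_le one_pos le_add_self) hf.rec
    obtain ⟨k, hkG⟩ := hcol G hG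
    exact ⟨_, k + 1, RevMath.Discrete.one_le _ (hz' k).pos, h k k (lt_add_one k).le hkG⟩
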